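/- **Setting.** Let $X$ be a centered random element of $L^2[0,1]$ with $E\|X\|^2<\infty$ and strictly positive covariance operator $\Gamma f=E[\langle X,f\rangle X]$, let $\epsilon$ be a centered real error with variance one and $E[\epsilon X]=0$, let $\sigma>0$, and let $Y=\langle\beta,X\rangle+\sigma\epsilon$ with unknown $\beta\in L^2[0,1]$. One observes $n$ independent copies $(Y_i,X_i)$ of $(Y,X)$. Let $(\psi_j)_{j\ge1}$ be an orthonormal basis of $L^2[0,1]$. For a positive weight sequence $w$ put $\|f\|_w^2=\sum_j w_j\langle f,\psi_j\rangle^2$, and for $\rho>0$ put $\mathcal W_b^\rho=\{f\in L^2[0,1]:\|f\|_b^2\le\rho\}$. For an operator $T$ and a function $f$ write $[T]_m=(\langle T\psi_l,\psi_j\rangle)_{j,l\le m}$ and $[f]_m=(\langle f,\psi_j\rangle)_{j\le m}$. Let $\hat g=\frac1n\sum_i Y_iX_i$ and $\hat\Gamma=\frac1n\sum_i\langle X_i,\cdot\rangle X_i$. The thresholded projection estimator with dimension $m$ and threshold $\gamma$ is $\hat\beta=\sum_{l\le m}([\hat\Gamma]_m^{-1}[\hat g]_m)_l\,\psi_l$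 if $[\hat\Gamma]_m$ is nonsingular and its inverse has spectral norm at most $\gamma$, and $\hat\beta=0$ otherwise. **Assumptions.** The sequences $\omega,b,\upsilon$ are strictly positive with $\omega_1=b_1=\upsilon_1=1$; $b$ and $b_j/\omega_j$ are non-decreasing; $\upsilon$ and $\upsilon_j^2/\omega_j$ are non-increasing; $\Lambda:=\sum_j\upsilon_j<\infty$. For some $d\ge1$, $\Gamma\in\mathcal N_\upsilon^d$, i.e. $\Gamma$ is self-adjoint and nuclear and $d^{-2}\|f\|_{\upsilon^2}^2\le\|\Gamma f\|^2\le d^2\|f\|_{\upsilon^2}^2$ for all $f$. For some $\eta\ge1$ and an integer $k\ge4$, $E|\epsilon|^{4k}\le\eta$ and, for all $m\ge 1$ and $j\ge1$ (with $j\le m$ in the second bound), $$E\bigl|\langle X,\psi_j\rangle/\langle\Gamma\psi_j,\psi_j\rangle^{1/2}\bigr|^{4k}\le\eta,\qquad E\bigl|([\Gamma]_m^{-1/2}[X]_m)_j\bigr|^{4k}\le\eta.$$ For some $\Delta\ge1$ and $n_0\ge1$, the integers $m_*=m_*(n)\ge1$ satisfy, for all $n\ge n_0$, $$\Delta^{-1}\le\frac{b_{m_*}}{n\,\omega_{m_*}}\sum_{j=1}^{m_*}\frac{\omega_j}{\upsilon_j}\le\Delta;\qquad\text{put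 }\ \delta_n^*=\omega_{m_*}/b_{m_*}.$$ The sequences $$\frac{m_*^{2k}}{\delta_n^*n^k},\qquad\frac{m_*}{\delta_n^*n}\sup_{1\le j\le m_*}\frac{\omega_j}{\upsilon_j},\qquad\frac{m_*^{2+k}}{n^{k/2-1}}$$ are bounded as $n\to\infty$, say by $K$ for all $n\ge n_0$. **Theorem.** There is a constant $C>0$, depending only on $k$ and $K$, such that for all $n\ge n_0$ the estimator $\hat\beta$ with $m=m_*$ and $\gamma=n\max(1,8d^3\Delta/b_{m_*})$ satisfies $$\sup_{\beta\in\mathcal W_b^\rho}E\|\hat\beta-\beta\|_\omega^2\le C\,\delta_n^*\,\eta\,d^{16}\Delta^2(\sigma^2+\rho\Lambda).$$ The rate $\delta_n^*$ is optimal, so $\hat\beta$ is minimax optimal: if moreover $\epsilon$ is standard normal and independent of $X$, then for all $n\ge n_0$ every estimator $\tilde\beta$ (a measurable function of the $n$ observations) satisfies $$\sup_{\beta\in\mathcal W_b^\rho}E\|\tilde\beta-\beta\|_\omega^2\ge\frac1{4\Delta}\min\Bigl\{\frac{\sigma^2}{2d},\frac\rho\Delta\Bigr\}\,\delta_n^*.$$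 -/

import Mathlib

open MeasureTheory ProbabilityTheory
open scoped ENNReal RealInnerProductSpace Matrix

namespace FunctionalLinearModel

/-- The real Hilbert space `L²[0,1]`. -/
abbrev L2I : Type := Lp ℝ 2 ((volume : Measure ℝ).restrict (Set.Icc (0 : ℝ) 1))

/-- `L²[0,1]` carries its Borel sigma-algebra. -/
noncomputable instance instMeasurableSpaceL2I : MeasurableSpace L2I := borel L2I

instance instBorelSpaceL2I : BorelSpace L2I := ⟨rfl⟩

/-! Sequences indexed by `j = 1, 2, …` in the mathematical text are indexed by `ℕ` here: the entry
at `j : ℕ` is the mathematical entry `j + 1`. In particular the mathematical entry with index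
`m ≥ 1` is the entry at `m - 1`, and `j = 1, …, m` corresponds to `j < m`, i.e. `j : Fin m`. -/

/-- The weighted squared norm `‖f‖_w² = ∑ⱼ wⱼ ⟨f, ψⱼ⟩²`, with values in `[0,∞]`. -/
noncomputable def wnormSq (ψ : HilbertBasis ℕ ℝ L2I) (w : ℕ → ℝ) (f : L2I) : ℝ≥0∞ :=
  ∑' j, ENNReal.ofReal (w j * ⟪f, ψ j⟫ ^ 2)

/-- The ellipsoid `W_b^ρ`. -/
def ellipsoid (ψ : HilbertBasis ℕ ℝ L2I) (b : ℕ → ℝ) (ρ : ℝ) : Set L2I :=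
  {f | wnormSq ψ b f ≤ ENNReal.ofReal ρ}

/-- The regularity assumption on the weight sequences. -/
structure RegularWeights (w b υ : ℕ → ℝ) : Prop where
  w_pos : ∀ j, 0 < w j
  b_pos : ∀ j, 0 < b j
  υ_pos : ∀ j, 0 < υ j
  w_one : w 0 = 1
  b_one : b 0 = 1
  υ_one : υ 0 = 1
  b_mono : Monotone b
  b_div_w_mono : Monotone fun j => b j / w j
  υ_anti : Antitone υ
  υ_sq_div_w_anti : Antitone fun j => υ j ^ 2 / w j
  υ_summable : Summable υ

/-- Nuclear operators on `L²[0,1]`: operators `f ↦ ∑ᵢ ⟨xᵢ, f⟩ yᵢ` with `∑ᵢ ‖xᵢ‖ ‖yᵢ‖ < ∞`. -/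
def IsNuclear (T : L2I →L[ℝ] L2I) : Prop :=
  ∃ x y : ℕ → L2I, (Summable fun i => ‖x i‖ * ‖y i‖) ∧
    ∀ f, HasSum (fun i => ⟪x i, f⟫ • y i) (T f)

/-- The class `N_υ^d`: self-adjoint nuclear operators satisfying the link condition. -/
structure LinkClass (ψ : HilbertBasis ℕ ℝ L2I) (υ : ℕ → ℝ) (d : ℝ) (T : L2I →L[ℝ] L2I) :
    Prop where
  selfAdjoint : IsSelfAdjoint T
  nuclear : IsNuclear T
  lower : ∀ f, wnormSq ψ (fun j => υ j ^ 2) f / ENNReal.ofReal (d ^ 2)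
    ≤ ENNReal.ofReal (‖T f‖ ^ 2)
  upper : ∀ f, ENNReal.ofReal (‖T f‖ ^ 2)
    ≤ ENNReal.ofReal (d ^ 2) * wnormSq ψ (fun j => υ j ^ 2) f

/-- The `m × m` matrix `[T]_m` with entries `⟨T ψ_l, ψ_j⟩`. -/
noncomputable def truncMatrix (ψ : HilbertBasis ℕ ℝ L2I) (m : ℕ) (T : L2I →L[ℝ] L2I) :
    Matrix (Fin m) (Fin m) ℝ :=
  Matrix.of fun j l => ⟪T (ψ l), ψ j⟫

/-- The vector `[f]_m` with entries `⟨f, ψ_j⟩`. -/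
noncomputable def truncVec (ψ : HilbertBasis ℕ ℝ L2I) (m : ℕ) (f : L2I) : Fin m → ℝ :=
  fun j => ⟪f, ψ j⟫

/-- The inverse square root `A^{-1/2}` of a symmetric positive definite matrix `A`, through the
functional calculus of symmetric matrices. -/
noncomputable def invSqrt {m : ℕ} (A : Matrix (Fin m) (Fin m) ℝ) : Matrix (Fin m) (Fin m) ℝ :=
  cfc (fun x : ℝ => (√x)⁻¹) A

section Model

variable {Ω : Type*} [MeasurableSpace Ω]

/-- The covariance operator `f ↦ E[⟨X, f⟩ X]` of a random function `X`. It is only used for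
centered `X` with finite second moment. -/
noncomputable def covOp (P : Measure Ω) (X : Ω → L2I) : L2I →L[ℝ] L2I :=
  covarianceOperator (P.map X)

/-- The class of centered random functions with finite second moment and strictly positive
covariance operator. -/
structure RegressorClass (P : Measure Ω) (X : Ω → L2I) : Prop where
  memLp : MemLp X 2 P
  centered : ∫ ω, X ω ∂P = 0
  strictlyPositive : ∀ f : L2I, f ≠ 0 → 0 < ⟪covOp P X f, f⟫

/-- The class `X_η^k`. -/
structure RegressorMomentClass (ψ : HilbertBasis ℕ ℝ L2I) (k : ℕ) (η : ℝ)
    (P : Measure Ω) (X : Ω → L2I) : Prop extends RegressorClass P X where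
  moment_coord : ∀ j, ∫⁻ ω, ENNReal.ofReal
    (|⟪X ω, ψ j⟫ / √⟪covOp P X (ψ j), ψ j⟫| ^ k) ∂P ≤ ENNReal.ofReal η
  moment_standardized : ∀ (m : ℕ) (j : Fin m), ∫⁻ ω, ENNReal.ofReal
    (|(invSqrt (truncMatrix ψ m (covOp P X)) *ᵥ truncVec ψ m (X ω)) j| ^ k) ∂P
      ≤ ENNReal.ofReal η

/-- The class `E_η^k` of centered error terms with variance one and `k`-th moment at most `η`. -/
structure ErrorClass (k : ℕ) (η : ℝ) (P : Measure Ω) (ε : Ω → ℝ) : Prop where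
  aemeasurable : AEMeasurable ε P
  memLp : MemLp ε 2 P
  centered : ∫ ω, ε ω ∂P = 0
  variance_one : ∫ ω, ε ω ^ 2 ∂P = 1
  moment : ∫⁻ ω, ENNReal.ofReal (|ε ω| ^ k) ∂P ≤ ENNReal.ofReal η

/-- `(Xs i, εs i)`, `i = 1, …, n`, are independent copies of `(X, ε)`. -/
structure IsSample {Ω' : Type*} [MeasurableSpace Ω'] (P : Measure Ω) (X : Ω → L2I) (ε : Ω → ℝ)
    (P' : Measure Ω') {n : ℕ} (Xs : Fin n → Ω' → L2I) (εs : Fin n → Ω' → ℝ) : Prop where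
  identDistrib : ∀ i, IdentDistrib (fun ω' => (Xs i ω', εs i ω')) (fun ω => (X ω, ε ω)) P' P
  indep : iIndepFun (fun i ω' => (Xs i ω', εs i ω')) P'

end Model

/-- The data `(Y_i, X_i)` of the functional linear model `Y_i = ∫ β X_i + σ ε_i`. -/
noncomputable def observations (β : L2I) (σ : ℝ) {n : ℕ} (x : Fin n → L2I) (e : Fin n → ℝ) :
    Fin n → ℝ × L2I :=
  fun i => (⟪β, x i⟫ + σ * e i, x i)

/-- `ĝ = (1/n) ∑ Y_i X_i`. -/
noncomputable def gHat {n : ℕ} (D : Fin n → ℝ × L2I) : L2I :=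
  (n : ℝ)⁻¹ • ∑ i, (D i).1 • (D i).2

/-- `Γ̂ = (1/n) ∑ ⟨X_i, ·⟩ X_i`. -/
noncomputable def gammaHat {n : ℕ} (D : Fin n → ℝ × L2I) : L2I →L[ℝ] L2I :=
  (n : ℝ)⁻¹ • ∑ i, InnerProductSpace.rankOne ℝ (D i).2 (D i).2

/-- The spectral norm of a matrix (operator norm for the Euclidean norm). -/
noncomputable def specNorm {m : ℕ} (A : Matrix (Fin m) (Fin m) ℝ) : ℝ :=
  ‖Matrix.toEuclideanCLM (n := Fin m) (𝕜 := ℝ) A‖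

open Classical in
/-- The thresholded projection estimator with dimension `m` and threshold `γ`. -/
noncomputable def betaHat (ψ : HilbertBasis ℕ ℝ L2I) (m : ℕ) (γ : ℝ) {n : ℕ}
    (D : Fin n → ℝ × L2I) : L2I :=
  if IsUnit (truncMatrix ψ m (gammaHat D)) ∧ specNorm (truncMatrix ψ m (gammaHat D))⁻¹ ≤ γ then
    ∑ l : Fin m, ((truncMatrix ψ m (gammaHat D))⁻¹ *ᵥ truncVec ψ m (gHat D)) l • ψ l
  else 0

/-- The maximal risk over the ellipsoid `W_b^ρ`, i.e. the supremum of `E ‖β̃ - β‖_w²`,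
of the estimator `est`, a function of the data. -/
noncomputable def maxRisk (ψ : HilbertBasis ℕ ℝ L2I) (w b : ℕ → ℝ) (ρ σ : ℝ)
    {Ω' : Type*} [MeasurableSpace Ω'] (P' : Measure Ω') {n : ℕ}
    (Xs : Fin n → Ω' → L2I) (εs : Fin n → Ω' → ℝ) (est : (Fin n → ℝ × L2I) → L2I) : ℝ≥0∞ :=
  ⨆ β ∈ ellipsoid ψ b ρ, ∫⁻ ω', wnormSq ψ w
    (est (observations β σ (fun i => Xs i ω') (fun i => εs i ω')) - β) ∂P'

/-- The rate `δ_n^* = w_m / b_m` for `m = m_*(n)`. -/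
noncomputable def rate (w b : ℕ → ℝ) (m : ℕ) : ℝ := w (m - 1) / b (m - 1)

/-- The relation that defines the dimension `m = m_*(n)`. -/
structure IsOptimalDim (w b υ : ℕ → ℝ) (Δ : ℝ) (n m : ℕ) : Prop where
  one_le : 1 ≤ m
  lower : Δ⁻¹ ≤ b (m - 1) / (n * w (m - 1)) * ∑ j ∈ Finset.range m, w j / υ j
  upper : b (m - 1) / (n * w (m - 1)) * ∑ j ∈ Finset.range m, w j / υ j ≤ Δ

/-- The three quantities that have to stay bounded as `n → ∞` are at most `K` at `n`,
where `m = m_*(n)`. -/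
structure RateBounds (w b υ : ℕ → ℝ) (k : ℕ) (K : ℝ) (n m : ℕ) : Prop where
  first : (m : ℝ) ^ (2 * k) / (rate w b m * (n : ℝ) ^ k) ≤ K
  second : (m : ℝ) / (rate w b m * n) * ⨆ j : Fin m, w j / υ j ≤ K
  third : (m : ℝ) ^ (2 + k) / (n : ℝ) ^ ((k : ℝ) / 2 - 1) ≤ K

end FunctionalLinearModel

open FunctionalLinearModel

/-!
The upper bound compares the estimator with the Galerkin solution `e` of `Γ e = Γ β` in the span
`S` of `ψ_0, …, ψ_{m-1}`. The link condition is a comparison of `Γ²` with the square of the diagonal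
operator `D` with entries `υ`; by operator monotonicity of the square root (Heinz,
`inner_le_inner_of_norm_le`) it gives `d⁻¹ D ≤ Γ ≤ d D`, which makes the Galerkin projection stable
and bounds the bias `‖β - e‖_w²` by a multiple of `d⁶ ρ δ*` (`galerkin_bias`).

With `R = [Γ]_m^{-1/2}`, the stochastic part is governed by two quantities: the relative deviation
`F`, the squared Frobenius norm of `R [Γ̂]_m R - 1` (`relDev`), and the size `Q = ‖R T‖²` of the
standardization of the noise `T = [ĝ - Γ̂ e]_m`. If `F ≤ 1/4`, then `[Γ̂]_m` is invertible, the
threshold is not exceeded, and the coordinate error is at most `2 ‖R T‖` in the metric of `[Γ]_m`.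
If `F > 1/4`, the threshold still bounds the error polynomially in `n`, and this event is rare. This
is `loss_le`. The entries of `R [Γ̂]_m R - 1` and of `R T` are means of independent centered
variables: the entries of `T` are centered because `e` solves the Galerkin equations and
`E[ε X] = 0`. A moment inequality for sums (`lintegral_mean_pow_le`) then yields
`E F^k ≲ (m²/n)^k` and `E Q⁴ ≲ (m d³ (σ² + ρ Λ)/n)⁴` (`lintegral_relDev_pow_le`,
`lintegral_noise_pow_le`), and the boundedness of the three sequences turns these estimates into the
rate (`maxRisk_betaHat_le`).

The lower bound is Assouad's argument. The slopes `∑ ± a_j ψ_j` with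
`a_j² = min (σ²/(2d)) (ρ/Δ) / (n υ_j)` lie in the ellipsoid. By the Gaussian change of measure
(`lintegral_pi_shift`), two slopes that differ in one sign have laws whose affinity is at least
`1/2`, so the coefficient at `ψ_j` cannot be estimated better than up to a multiple of `a_j`
(`coordinate_lower_bound`). Averaging over all signs gives `∑_{j < m} w_j a_j² / 4`
(`le_maxRisk_of_hypercube`), which has the order of the rate by the choice of `m`.
-/

/-! ### Operator inequalities -/

section Operators

variable {H : Type*} [NormedAddCommGroup H] [InnerProductSpace ℝ H]

/-- `T² ≤ ‖T‖ T` for positive `T`: the quadratic form of `T` is nonnegative at `f - N⁻¹ T f`. -/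
theorem norm_sq_le_mul_inner_of_nonneg (T : H →L[ℝ] H) (hT : ∀ x y, ⟪T x, y⟫ = ⟪x, T y⟫)
    (hpos : ∀ x, 0 ≤ ⟪T x, x⟫) {N : ℝ} (hN : 0 < N) (hTN : ‖T‖ ≤ N) (f : H) :
    ‖T f‖ ^ 2 ≤ N * ⟪T f, f⟫ := by
  have h := hpos (f + (-N⁻¹) • T f)
  have h1 : ⟪T (T f), T f⟫ ≤ N * ‖T f‖ ^ 2 := by
    calc ⟪T (T f), T f⟫ ≤ ‖T (T f)‖ * ‖T f‖ := real_inner_le_norm _ _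
      _ ≤ (N * ‖T f‖) * ‖T f‖ := by
        gcongr
        exact (T.le_opNorm _).trans (by gcongr)
      _ = _ := by ring
  have h2 : ⟪T (T f), f⟫ = ‖T f‖ ^ 2 := by rw [hT, real_inner_self_eq_norm_sq]
  simp only [map_add, map_smul, inner_add_left, inner_add_right, inner_smul_left,
    inner_smul_right, real_inner_self_eq_norm_sq, h2, conj_trivial] at h
  have h3 : 0 ≤ N * (⟪T f, f⟫ + -N⁻¹ * ‖T f‖ ^ 2 +
      -N⁻¹ * (‖T f‖ ^ 2 + -N⁻¹ * (N * ‖T f‖ ^ 2))) := by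
    apply mul_nonneg hN.le
    have : N⁻¹ * (N⁻¹ * ⟪T (T f), T f⟫) ≤ N⁻¹ * (N⁻¹ * (N * ‖T f‖ ^ 2)) := by gcongr
    linarith
  have h4 : N * (⟪T f, f⟫ + -N⁻¹ * ‖T f‖ ^ 2 + -N⁻¹ * (‖T f‖ ^ 2 + -N⁻¹ * (N * ‖T f‖ ^ 2)))
      = N * ⟪T f, f⟫ - ‖T f‖ ^ 2 := by field_simp; ring
  linarith

/-- The square root is operator monotone (the Löwner–Heinz inequality for the exponent `1/2`):
`A² ≤ B²` implies `A ≤ B` for positive operators. If `B - A` had the negative number `-c` as the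
infimum of its numerical range, an approximate eigenvector `f` for `-c` would make
`‖B f‖² - ‖A f‖² = ⟪(B - A) f, (A + B) f⟫` negative. -/
theorem inner_le_inner_of_norm_le (A B : H →L[ℝ] H) (hA : ∀ x y, ⟪A x, y⟫ = ⟪x, A y⟫)
    (hB : ∀ x y, ⟪B x, y⟫ = ⟪x, B y⟫) (hBpos : ∀ x, 0 ≤ ⟪B x, x⟫)
    (hAB : ∀ x, ‖A x‖ ≤ ‖B x‖) (f : H) : ⟪A f, f⟫ ≤ ⟪B f, f⟫ := by
  by_contra! hf
  have hf0 : 0 < ‖f‖ := by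
    rw [norm_pos_iff]; rintro rfl; simp at hf
  set V : Set ℝ := {c | 0 ≤ c ∧ ∀ x, -(c * ‖x‖ ^ 2) ≤ ⟪B x, x⟫ - ⟪A x, x⟫}
  have hV : V.Nonempty := by
    refine ⟨‖A‖, norm_nonneg _, fun x => ?_⟩
    have h1 : ⟪A x, x⟫ ≤ ‖A‖ * ‖x‖ ^ 2 := by
      calc ⟪A x, x⟫ ≤ ‖A x‖ * ‖x‖ := real_inner_le_norm _ _
        _ ≤ (‖A‖ * ‖x‖) * ‖x‖ := by gcongr; exact A.le_opNorm x
        _ = _ := by ring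
    linarith [hBpos x]
  have hVb : BddBelow V := ⟨0, fun c hc => hc.1⟩
  set c := sInf V
  have hcV : ∀ x, -(c * ‖x‖ ^ 2) ≤ ⟪B x, x⟫ - ⟪A x, x⟫ := by
    intro x
    rcases eq_or_ne x 0 with rfl | hx
    · simp
    have hx' : 0 < ‖x‖ ^ 2 := by positivity
    have : (⟪A x, x⟫ - ⟪B x, x⟫) / ‖x‖ ^ 2 ≤ c := by
      apply le_csInf hV
      intro a ha
      rw [div_le_iff₀ hx']
      linarith [ha.2 x]
    rw [div_le_iff₀ hx'] at this
    linarith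
  have hc : 0 < c := by
    have := hcV f
    by_contra! hc
    nlinarith [sq_nonneg ‖f‖]
  -- `T = B - A + c` is positive, and its numerical range comes arbitrarily close to `0`
  set T : H →L[ℝ] H := B - A + c • ContinuousLinearMap.id ℝ H
  have hTapp : ∀ x, T x = B x - A x + c • x := fun x => by simp [T]
  have hTin : ∀ x, ⟪T x, x⟫ = ⟪B x, x⟫ - ⟪A x, x⟫ + c * ‖x‖ ^ 2 := fun x => by
    rw [hTapp, inner_add_left, inner_sub_left, inner_smul_left, real_inner_self_eq_norm_sq]; simp
  have hT : ∀ x y, ⟪T x, y⟫ = ⟪x, T y⟫ := fun x y => by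
    simp only [hTapp, inner_add_left, inner_sub_left, inner_add_right, inner_sub_right, hA, hB,
      inner_smul_left, inner_smul_right, conj_trivial]
  have hTpos : ∀ x, 0 ≤ ⟪T x, x⟫ := fun x => by rw [hTin]; linarith [hcV x]
  set N := ‖T‖ + 1
  have hN : 0 < N := by positivity
  set M := ‖A + B‖ + 1
  have hM : 0 < M := by positivity
  obtain ⟨ε, hε, hεc, hεM⟩ : ∃ ε, 0 < ε ∧ ε < c / 2 ∧ N * ε * M ^ 2 < (c ^ 2 / 2) ^ 2 := by
    have hpos : 0 < (c ^ 2 / 2) ^ 2 / (N * M ^ 2) := by positivity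
    refine ⟨min (c / 2) ((c ^ 2 / 2) ^ 2 / (N * M ^ 2)) / 2, by positivity, ?_, ?_⟩
    · have := min_le_left (c / 2) ((c ^ 2 / 2) ^ 2 / (N * M ^ 2))
      linarith
    · have h1 := min_le_right (c / 2) ((c ^ 2 / 2) ^ 2 / (N * M ^ 2))
      have h2 : min (c / 2) ((c ^ 2 / 2) ^ 2 / (N * M ^ 2)) / 2
          < (c ^ 2 / 2) ^ 2 / (N * M ^ 2) := by linarith
      rw [lt_div_iff₀ (by positivity)] at h2
      linarith
  obtain ⟨g, hg⟩ : ∃ g, ⟪B g, g⟫ - ⟪A g, g⟫ < -((c - ε) * ‖g‖ ^ 2) := by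
    by_contra! hcon
    have : c - ε ∈ V := ⟨by linarith, hcon⟩
    linarith [csInf_le hVb this]
  have hg0 : 0 < ‖g‖ := by
    rw [norm_pos_iff]; rintro rfl; simp at hg
  have hTg : ⟪T g, g⟫ ≤ ε * ‖g‖ ^ 2 := by rw [hTin]; linarith
  have h1 : ‖T g‖ ^ 2 ≤ N * (ε * ‖g‖ ^ 2) :=
    (norm_sq_le_mul_inner_of_nonneg T hT hTpos hN (by simp [N]) g).trans (by gcongr)
  have h2 : 0 ≤ ⟪B g - A g, (A + B) g⟫ := by
    have : ⟪B g - A g, (A + B) g⟫ = ‖B g‖ ^ 2 - ‖A g‖ ^ 2 := by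
      simp only [add_apply, inner_sub_left, inner_add_right,
        real_inner_self_eq_norm_sq, real_inner_comm (A g) (B g)]
      ring
    rw [this]
    have := hAB g
    have h0 := norm_nonneg (A g)
    nlinarith
  have h3 : B g - A g = T g - c • g := by rw [hTapp]; simp
  rw [h3, inner_sub_left, inner_smul_left, conj_trivial] at h2
  have h4 : ⟪T g, (A + B) g⟫ ≤ ‖T g‖ * (M * ‖g‖) :=
    (real_inner_le_norm _ _).trans (by
      gcongr
      exact ((A + B).le_opNorm g).trans (by gcongr; simp [M]))
  have h5 : (c / 2) * ‖g‖ ^ 2 ≤ ⟪g, (A + B) g⟫ := by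
    rw [real_inner_comm, add_apply, inner_add_left]
    nlinarith [hBpos g, sq_nonneg ‖g‖]
  have h6 : c ^ 2 / 2 * ‖g‖ ≤ ‖T g‖ * M := by
    have : (c ^ 2 / 2 * ‖g‖) * ‖g‖ ≤ (‖T g‖ * M) * ‖g‖ := by nlinarith
    exact le_of_mul_le_mul_right this hg0
  have h7 : (c ^ 2 / 2 * ‖g‖) ^ 2 ≤ (‖T g‖ * M) ^ 2 := by gcongr
  have h8 : (‖T g‖ * M) ^ 2 ≤ (N * ε * M ^ 2) * ‖g‖ ^ 2 := by
    rw [mul_pow]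
    calc ‖T g‖ ^ 2 * M ^ 2 ≤ (N * (ε * ‖g‖ ^ 2)) * M ^ 2 := by gcongr
      _ = _ := by ring
  have h9 : (N * ε * M ^ 2) * ‖g‖ ^ 2 < (c ^ 2 / 2) ^ 2 * ‖g‖ ^ 2 := by gcongr
  rw [mul_pow] at h7
  linarith

/-- Stability of the Galerkin projection on `S` in the energy of `Γ`, when `Γ` is comparable to
an operator `D` with `D ≥ υ` on `S` and `D ≤ υ` on `Sᗮ`. -/
theorem norm_galerkin_le (Γ D : H →L[ℝ] H) (hΓ : ∀ x y, ⟪Γ x, y⟫ = ⟪x, Γ y⟫)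
    (hpos : ∀ x, 0 ≤ ⟪Γ x, x⟫) {d υ : ℝ} (hd : 0 < d) (hυ : 0 < υ)
    (hlow : ∀ x, ⟪D x, x⟫ ≤ d * ⟪Γ x, x⟫) (hup : ∀ x, ⟪Γ x, x⟫ ≤ d * ⟪D x, x⟫)
    {S : Submodule ℝ H} (hS : ∀ s ∈ S, υ * ‖s‖ ^ 2 ≤ ⟪D s, s⟫)
    (hS' : ∀ z ∈ Sᗮ, ⟪D z, z⟫ ≤ υ * ‖z‖ ^ 2) {t v : H} (ht : t ∈ S) (hv : v ∈ Sᗮ)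
    (hgal : ∀ s ∈ S, ⟪Γ (v - t), s⟫ = 0) : ‖t‖ ≤ d * ‖v‖ := by
  have h1 := hgal t ht
  have h2 := hpos (v - t)
  rw [inner_sub_right, h1] at h2
  simp only [map_sub, inner_sub_left] at h1 h2
  rw [hΓ t v, real_inner_comm (Γ v) t] at h2
  have h3 := hlow t
  have h4 := hup v
  have h5 := hS t ht
  have h6 := hS' v hv
  have h7 : υ * ‖t‖ ^ 2 ≤ υ * (d * ‖v‖) ^ 2 := by
    calc υ * ‖t‖ ^ 2 ≤ d * ⟪Γ t, t⟫ := h5.trans h3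
      _ ≤ d * (d * (υ * ‖v‖ ^ 2)) := by
        gcongr
        calc ⟪Γ t, t⟫ ≤ ⟪Γ v, v⟫ := by linarith
          _ ≤ _ := h4.trans (by gcongr)
      _ = _ := by ring
  have h8 := le_of_mul_le_mul_left h7 hυ
  exact le_of_sq_le_sq h8 (by positivity)

theorem exists_galerkin (Γ : H →L[ℝ] H) (hpos : ∀ x, x ≠ 0 → 0 < ⟪Γ x, x⟫)
    (S : Submodule ℝ H) [FiniteDimensional ℝ S] (u : H) :
    ∃ e ∈ S, ∀ s ∈ S, ⟪Γ (u - e), s⟫ = 0 := by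
  let L : S →ₗ[ℝ] S := (S.orthogonalProjectionOnto.comp (Γ.comp S.subtypeL)).toLinearMap
  have hL : ∀ x y : S, ⟪(L x : H), (y : H)⟫ = ⟪Γ x, (y : H)⟫ := fun x y => by
    simp only [L, ContinuousLinearMap.coe_coe, ContinuousLinearMap.comp_apply,
      Submodule.coe_orthogonalProjectionOnto_apply, Submodule.subtypeL_apply]
    rw [Submodule.inner_starProjection_left_eq_right, Submodule.starProjection_eq_self_iff.2 y.2]
  have hinj : Function.Injective L := by
    rw [injective_iff_map_eq_zero]
    intro x hx
    by_contra hne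
    have h1 := hpos x (by simpa using hne)
    rw [← hL, hx] at h1
    simp at h1
  obtain ⟨e, he⟩ := LinearMap.injective_iff_surjective.1 hinj (S.orthogonalProjectionOnto (Γ u))
  refine ⟨e, e.2, fun s hs => ?_⟩
  rw [map_sub, inner_sub_left, ← hL e ⟨s, hs⟩, he, Submodule.coe_orthogonalProjectionOnto_apply,
    Submodule.inner_starProjection_left_eq_right, Submodule.starProjection_eq_self_iff.2 hs,
    sub_self]

variable [CompleteSpace H]

/-- If `‖D x‖ ≤ d ‖Γ x‖` for self-adjoint `D` and `Γ`, then `D` factors through `Γ`, with a bound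
on the factor: this is the range inclusion of Douglas' lemma. -/
theorem exists_preimage_of_norm_le (Γ D : H →L[ℝ] H) (hΓ : ∀ x y, ⟪Γ x, y⟫ = ⟪x, Γ y⟫)
    (hD : ∀ x y, ⟪D x, y⟫ = ⟪x, D y⟫) (hpos : ∀ x, x ≠ 0 → 0 < ⟪Γ x, x⟫) {d : ℝ} (hd : 0 < d)
    (hDΓ : ∀ x, ‖D x‖ ≤ d * ‖Γ x‖) (f : H) : ∃ u, Γ u = D f ∧ ‖u‖ ≤ d * ‖f‖ := by
  have hdense : DenseRange (Γ : H →ₗ[ℝ] H) := by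
    have : (LinearMap.range (Γ : H →ₗ[ℝ] H)).topologicalClosure = ⊤ := by
      rw [Submodule.topologicalClosure_eq_top_iff, Submodule.eq_bot_iff]
      intro x hx
      by_contra hne
      have h1 := hpos x hne
      have h2 := Submodule.mem_orthogonal _ _ |>.1 hx (Γ x) ⟨x, rfl⟩
      linarith
    rw [← Submodule.dense_iff_topologicalClosure_eq_top] at this
    exact this
  let B : H →L[ℝ] H := (D : H →ₗ[ℝ] H).extendOfNorm (Γ : H →ₗ[ℝ] H)
  have hB : ∀ x, B (Γ x) = D x := fun x => LinearMap.extendOfNorm_eq hdense ⟨d, hDΓ⟩ x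
  have hBn : ‖B‖ ≤ d := ContinuousLinearMap.opNorm_le_bound _ hd.le fun x =>
    LinearMap.norm_extendOfNorm_apply_le hdense d hDΓ x
  refine ⟨ContinuousLinearMap.adjoint B f, ?_, ?_⟩
  · refine ext_inner_right ℝ fun y => ?_
    rw [hΓ, ContinuousLinearMap.adjoint_inner_left, hB, hD]
  · refine (ContinuousLinearMap.le_opNorm _ _).trans ?_
    rw [LinearIsometryEquiv.norm_map]
    gcongr

/-- The inverse estimate behind the weighted bounds: on `S` the operator `D` is controlled by the
compression of `Γ` to `S`. By duality it suffices to control the Galerkin projection of a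
preimage of `D (D h)` under `Γ`. -/
theorem norm_le_of_galerkin_pairing (Γ D : H →L[ℝ] H) (hΓ : ∀ x y, ⟪Γ x, y⟫ = ⟪x, Γ y⟫)
    (hD : ∀ x y, ⟪D x, y⟫ = ⟪x, D y⟫) (hpos : ∀ x, x ≠ 0 → 0 < ⟪Γ x, x⟫) {d υ : ℝ} (hd : 0 < d)
    (hυ : 0 < υ) (hDΓ : ∀ x, ‖D x‖ ≤ d * ‖Γ x‖)
    (hlow : ∀ x, ⟪D x, x⟫ ≤ d * ⟪Γ x, x⟫) (hup : ∀ x, ⟪Γ x, x⟫ ≤ d * ⟪D x, x⟫)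
    {S : Submodule ℝ H} [FiniteDimensional ℝ S] (hS : ∀ s ∈ S, υ * ‖s‖ ^ 2 ≤ ⟪D s, s⟫)
    (hS' : ∀ z ∈ Sᗮ, ⟪D z, z⟫ ≤ υ * ‖z‖ ^ 2) {h : H} (hh : h ∈ S) {M : ℝ} (hM : 0 ≤ M)
    (hpair : ∀ s ∈ S, ⟪Γ h, s⟫ ≤ M * ‖s‖) : ‖D h‖ ≤ d * (1 + d) * M := by
  have hpos0 : ∀ x, 0 ≤ ⟪Γ x, x⟫ := fun x => by
    rcases eq_or_ne x 0 with rfl | hx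
    · simp
    · exact (hpos x hx).le
  obtain ⟨u, hu, hun⟩ := exists_preimage_of_norm_le Γ D hΓ hD hpos hd hDΓ (D h)
  obtain ⟨e, heS, he⟩ := exists_galerkin Γ hpos S u
  -- `e - p` is the Galerkin projection of `u - p`, which lies in `Sᗮ`.
  set p : H := S.starProjection u
  have hpS : p ∈ S := Submodule.starProjection_apply_mem S u
  have hpO : u - p ∈ Sᗮ := Submodule.sub_starProjection_mem_orthogonal u
  have h1 : ‖e - p‖ ≤ d * ‖u - p‖ := by
    apply norm_galerkin_le Γ D hΓ hpos0 hd hυ hlow hup hS hS' (S.sub_mem heS hpS) hpO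
    intro s hs
    simpa using he s hs
  have h2 : ‖p‖ ≤ ‖u‖ := S.norm_starProjection_apply_le u
  have h3 : ‖u - p‖ ≤ ‖u‖ := by
    have := Submodule.norm_sq_eq_add_norm_sq_starProjection u S
    have h3 : S.starProjection u + Sᗮ.starProjection u = u := by
      simp
    have h4 : Sᗮ.starProjection u = u - p := by
      rw [← h3]; simp [p]
    rw [h4] at this
    nlinarith [norm_nonneg (u - p), norm_nonneg u, sq_nonneg ‖p‖]
  have h4 : ‖e‖ ≤ (1 + d) * ‖u‖ := by
    calc ‖e‖ = ‖p + (e - p)‖ := by simp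
      _ ≤ ‖p‖ + ‖e - p‖ := norm_add_le _ _
      _ ≤ ‖u‖ + d * ‖u‖ := by gcongr; exact h1.trans (by gcongr)
      _ = _ := by ring
  -- `Γ u = D (D h)` and the Galerkin equations for `e`, tested with `h`.
  have h5 : ‖D h‖ ^ 2 = ⟪Γ h, e⟫ := by
    have := he h hh
    rw [map_sub, inner_sub_left, hu, hD, real_inner_self_eq_norm_sq, hΓ e h,
      real_inner_comm] at this
    linarith
  have h6 : ‖D h‖ ^ 2 ≤ M * ((1 + d) * (d * ‖D h‖)) := by
    rw [h5]
    refine (hpair e heS).trans ?_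
    gcongr
    exact h4.trans (by gcongr)
  rcases (norm_nonneg (D h)).eq_or_lt with h0 | h0
  · rw [← h0]; positivity
  · nlinarith

end Operators

/-! ### Diagonal operators and the bias of the Galerkin projection -/

section Diagonal

variable {H : Type*} [NormedAddCommGroup H] [InnerProductSpace ℝ H]

theorem hasSum_inner_sq (ψ : HilbertBasis ℕ ℝ H) (f : H) :
    HasSum (fun j => ⟪f, ψ j⟫ ^ 2) (‖f‖ ^ 2) := by
  have := ψ.hasSum_inner_mul_inner f f
  rw [real_inner_self_eq_norm_sq] at this
  refine this.congr_fun fun j => ?_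
  rw [real_inner_comm f (ψ j), sq]

/-- The span of the first `m` basis functions. -/
def basisSpan (ψ : HilbertBasis ℕ ℝ H) (m : ℕ) : Submodule ℝ H :=
  Submodule.span ℝ (Set.range fun j : Fin m => ψ j)

instance instFiniteDimensionalBasisSpan (ψ : HilbertBasis ℕ ℝ H) (m : ℕ) :
    FiniteDimensional ℝ (basisSpan ψ m) :=
  FiniteDimensional.span_of_finite ℝ (Set.finite_range _)

theorem basis_mem_basisSpan (ψ : HilbertBasis ℕ ℝ H) {m j : ℕ} (hj : j < m) :
    ψ j ∈ basisSpan ψ m :=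
  Submodule.subset_span ⟨⟨j, hj⟩, rfl⟩

theorem inner_basis_of_mem_basisSpan (ψ : HilbertBasis ℕ ℝ H) {m j : ℕ} (hj : m ≤ j) {s : H}
    (hs : s ∈ basisSpan ψ m) : ⟪s, ψ j⟫ = 0 := by
  induction hs using Submodule.span_induction with
  | mem x hx =>
    obtain ⟨i, rfl⟩ := hx
    exact ψ.orthonormal.2 (by have := i.2; omega)
  | zero => simp
  | add x y _ _ hx hy => rw [inner_add_left, hx, hy, add_zero]
  | smul a x _ hx => rw [inner_smul_left, hx, mul_zero]

theorem inner_basis_of_mem_orthogonal (ψ : HilbertBasis ℕ ℝ H) {m j : ℕ} (hj : j < m) {z : H}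
    (hz : z ∈ (basisSpan ψ m)ᗮ) : ⟪z, ψ j⟫ = 0 := by
  rw [real_inner_comm]
  exact hz _ (basis_mem_basisSpan ψ hj)

theorem sum_inner_smul_of_mem_basisSpan (ψ : HilbertBasis ℕ ℝ H) {m : ℕ} {s : H}
    (hs : s ∈ basisSpan ψ m) : ∑ j : Fin m, ⟪s, ψ j⟫ • ψ j = s := by
  induction hs using Submodule.span_induction with
  | mem x hx =>
    obtain ⟨i, rfl⟩ := hx
    rw [Finset.sum_eq_single i]
    · have := ψ.orthonormal.1 (i : ℕ)
      simp [this]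
    · intro j _ hj
      have : ⟪ψ (i : ℕ), ψ (j : ℕ)⟫ = 0 := ψ.orthonormal.2 (fun h => hj (Fin.ext h.symm))
      simp only [this, zero_smul]
    · simp
  | zero => simp
  | add x y _ _ hx hy =>
    simp only [inner_add_left, add_smul, Finset.sum_add_distrib, hx, hy]
  | smul a x _ hx =>
    simp only [inner_smul_left, conj_trivial, mul_smul, ← Finset.smul_sum, hx]

variable [CompleteSpace H]

/-- The diagonal operator `ψ_j ↦ υ_j ψ_j`, as a series of rank one operators that converges in
operator norm when `υ` is summable. -/
noncomputable def diagOp (ψ : HilbertBasis ℕ ℝ H) (υ : ℕ → ℝ) : H →L[ℝ] H :=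
  ∑' j, υ j • InnerProductSpace.rankOne ℝ (ψ j) (ψ j)

theorem hasSum_diagOp_inner (ψ : HilbertBasis ℕ ℝ H) {υ : ℕ → ℝ} (hs : Summable υ) (f g : H) :
    HasSum (fun j => υ j * (⟪f, ψ j⟫ * ⟪g, ψ j⟫)) ⟪diagOp ψ υ f, g⟫ := by
  have h1 : Summable fun j => υ j • InnerProductSpace.rankOne ℝ (ψ j) (ψ j) := by
    refine Summable.of_norm ?_
    simp only [norm_smul, InnerProductSpace.norm_rankOne, ψ.orthonormal.1, mul_one]
    exact hs.norm
  have h2 := ((ContinuousLinearMap.apply ℝ H f).hasSum h1.hasSum)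
  have h3 := (innerSL ℝ g).hasSum h2
  have e : ⟪diagOp ψ υ f, g⟫ = (innerSL ℝ g) ((ContinuousLinearMap.apply ℝ H f)
      (∑' j, υ j • InnerProductSpace.rankOne ℝ (ψ j) (ψ j))) := by
    rw [real_inner_comm]; rfl
  rw [e]
  refine h3.congr_fun fun j => ?_
  simp [real_inner_comm f]

theorem inner_diagOp_basis (ψ : HilbertBasis ℕ ℝ H) {υ : ℕ → ℝ} (hs : Summable υ) (f : H)
    (j : ℕ) : ⟪diagOp ψ υ f, ψ j⟫ = υ j * ⟪f, ψ j⟫ := by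
  refine (hasSum_diagOp_inner ψ hs f (ψ j)).unique ?_
  have h : υ j * ⟪f, ψ j⟫ = υ j * (⟪f, ψ j⟫ * ⟪ψ j, ψ j⟫) := by
    rw [real_inner_self_eq_norm_sq, ψ.orthonormal.1]; simp
  rw [h]
  refine hasSum_single j fun i hi => ?_
  rw [ψ.orthonormal.2 (Ne.symm hi)]
  simp

theorem diagOp_symm (ψ : HilbertBasis ℕ ℝ H) {υ : ℕ → ℝ} (hs : Summable υ) (f g : H) :
    ⟪diagOp ψ υ f, g⟫ = ⟪f, diagOp ψ υ g⟫ := by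
  rw [real_inner_comm _ f]
  refine (hasSum_diagOp_inner ψ hs f g).unique ?_
  refine (hasSum_diagOp_inner ψ hs g f).congr_fun fun j => ?_
  ring

theorem hasSum_diagOp_self (ψ : HilbertBasis ℕ ℝ H) {υ : ℕ → ℝ} (hs : Summable υ) (f : H) :
    HasSum (fun j => υ j * ⟪f, ψ j⟫ ^ 2) ⟪diagOp ψ υ f, f⟫ :=
  (hasSum_diagOp_inner ψ hs f f).congr_fun fun j => by ring

theorem diagOp_nonneg (ψ : HilbertBasis ℕ ℝ H) {υ : ℕ → ℝ} (hs : Summable υ)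
    (hυ : ∀ j, 0 < υ j) (f : H) : 0 ≤ ⟪diagOp ψ υ f, f⟫ :=
  (hasSum_diagOp_self ψ hs f).nonneg fun j => by have := hυ j; positivity

theorem hasSum_norm_diagOp_sq (ψ : HilbertBasis ℕ ℝ H) {υ : ℕ → ℝ} (hs : Summable υ) (f : H) :
    HasSum (fun j => υ j ^ 2 * ⟪f, ψ j⟫ ^ 2) (‖diagOp ψ υ f‖ ^ 2) := by
  refine (hasSum_inner_sq ψ (diagOp ψ υ f)).congr_fun fun j => ?_
  rw [inner_diagOp_basis ψ hs]; ring

theorem diagOp_lower_on_basisSpan (ψ : HilbertBasis ℕ ℝ H) {υ : ℕ → ℝ} (hs : Summable υ)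
    (hanti : Antitone υ) {m : ℕ} {s : H} (hsm : s ∈ basisSpan ψ m) :
    υ (m - 1) * ‖s‖ ^ 2 ≤ ⟪diagOp ψ υ s, s⟫ := by
  refine hasSum_le (fun j => ?_) ((hasSum_inner_sq ψ s).mul_left _) (hasSum_diagOp_self ψ hs s)
  rcases lt_or_ge j m with hj | hj
  · have := hanti (show j ≤ m - 1 by omega)
    gcongr
  · simp [inner_basis_of_mem_basisSpan ψ hj hsm]

theorem diagOp_upper_on_orthogonal (ψ : HilbertBasis ℕ ℝ H) {υ : ℕ → ℝ} (hs : Summable υ)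
    (hanti : Antitone υ) {m : ℕ} {z : H} (hz : z ∈ (basisSpan ψ m)ᗮ) :
    ⟪diagOp ψ υ z, z⟫ ≤ υ (m - 1) * ‖z‖ ^ 2 := by
  refine hasSum_le (fun j => ?_) (hasSum_diagOp_self ψ hs z) ((hasSum_inner_sq ψ z).mul_left _)
  rcases lt_or_ge j m with hj | hj
  · simp [inner_basis_of_mem_orthogonal ψ hj hz]
  · have := hanti (show m - 1 ≤ j by omega)
    gcongr

theorem norm_diagOp_le_on_orthogonal (ψ : HilbertBasis ℕ ℝ H) {υ : ℕ → ℝ} (hs : Summable υ)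
    (hυ : ∀ j, 0 < υ j) (hanti : Antitone υ) {m : ℕ} {z : H} (hz : z ∈ (basisSpan ψ m)ᗮ) :
    ‖diagOp ψ υ z‖ ≤ υ (m - 1) * ‖z‖ := by
  have h := hυ (m - 1)
  refine le_of_sq_le_sq ?_ (by positivity)
  rw [mul_pow]
  refine hasSum_le (fun j => ?_) (hasSum_norm_diagOp_sq ψ hs z)
    ((hasSum_inner_sq ψ z).mul_left _)
  rcases lt_or_ge j m with hj | hj
  · simp [inner_basis_of_mem_orthogonal ψ hj hz]
  · have := hanti (show m - 1 ≤ j by omega)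
    have := hυ j
    gcongr

end Diagonal

section Link

theorem wnormSq_one (ψ : HilbertBasis ℕ ℝ L2I) (f : L2I) :
    wnormSq ψ (fun _ => 1) f = ENNReal.ofReal (‖f‖ ^ 2) := by
  simp only [wnormSq, one_mul]
  rw [← (hasSum_inner_sq ψ f).tsum_eq,
    ENNReal.ofReal_tsum_of_nonneg (fun _ => sq_nonneg _) (hasSum_inner_sq ψ f).summable]

theorem wnormSq_sq_eq_norm_diagOp (ψ : HilbertBasis ℕ ℝ L2I) {υ : ℕ → ℝ} (hs : Summable υ)
    (f : L2I) : wnormSq ψ (fun j => υ j ^ 2) f = ENNReal.ofReal (‖diagOp ψ υ f‖ ^ 2) := by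
  have h := hasSum_norm_diagOp_sq ψ hs f
  rw [wnormSq, ← h.tsum_eq, ENNReal.ofReal_tsum_of_nonneg (fun _ => by positivity) h.summable]

/-- The two-sided comparison of `Γ` with the diagonal operator of the sequence `υ`, at the level
of norms and, by operator monotonicity of the square root, at the level of quadratic forms. -/
structure DiagComparable (ψ : HilbertBasis ℕ ℝ L2I) (υ : ℕ → ℝ) (d : ℝ) (Γ : L2I →L[ℝ] L2I) :
    Prop where
  symm : ∀ x y, ⟪Γ x, y⟫ = ⟪x, Γ y⟫
  pos : ∀ x, x ≠ 0 → 0 < ⟪Γ x, x⟫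
  norm_le : ∀ x, ‖Γ x‖ ≤ d * ‖diagOp ψ υ x‖
  norm_diag_le : ∀ x, ‖diagOp ψ υ x‖ ≤ d * ‖Γ x‖
  inner_le : ∀ x, ⟪Γ x, x⟫ ≤ d * ⟪diagOp ψ υ x, x⟫
  inner_diag_le : ∀ x, ⟪diagOp ψ υ x, x⟫ ≤ d * ⟪Γ x, x⟫

theorem DiagComparable.nonneg {ψ : HilbertBasis ℕ ℝ L2I} {υ : ℕ → ℝ} {d : ℝ}
    {Γ : L2I →L[ℝ] L2I} (h : DiagComparable ψ υ d Γ) (x : L2I) : 0 ≤ ⟪Γ x, x⟫ := by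
  rcases eq_or_ne x 0 with rfl | hx
  · simp
  · exact (h.pos x hx).le

theorem DiagComparable.of_linkClass {ψ : HilbertBasis ℕ ℝ L2I} {υ : ℕ → ℝ} {d : ℝ}
    {Γ : L2I →L[ℝ] L2I} (hd : 1 ≤ d) (hs : Summable υ) (hυ : ∀ j, 0 < υ j)
    (hΓ : LinkClass ψ υ d Γ) (hpos : ∀ x, x ≠ 0 → 0 < ⟪Γ x, x⟫) : DiagComparable ψ υ d Γ := by
  have hd0 : 0 < d := by linarith
  have hsymm : ∀ x y, ⟪Γ x, y⟫ = ⟪x, Γ y⟫ := fun x y => hΓ.selfAdjoint.isSymmetric x y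
  have hpos0 : ∀ x, 0 ≤ ⟪Γ x, x⟫ := fun x => by
    rcases eq_or_ne x 0 with rfl | hx
    · simp
    · exact (hpos x hx).le
  have h1 : ∀ x, ‖Γ x‖ ≤ d * ‖diagOp ψ υ x‖ := fun x => by
    have := hΓ.upper x
    rw [wnormSq_sq_eq_norm_diagOp ψ hs, ← ENNReal.ofReal_mul (by positivity),
      ENNReal.ofReal_le_ofReal_iff (by positivity), ← mul_pow] at this
    exact le_of_sq_le_sq this (by positivity)
  have h2 : ∀ x, ‖diagOp ψ υ x‖ ≤ d * ‖Γ x‖ := fun x => by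
    have := hΓ.lower x
    rw [wnormSq_sq_eq_norm_diagOp ψ hs, ← ENNReal.ofReal_div_of_pos (by positivity),
      ENNReal.ofReal_le_ofReal_iff (by positivity), div_le_iff₀ (by positivity), mul_comm,
      ← mul_pow] at this
    exact le_of_sq_le_sq this (by positivity)
  refine ⟨hsymm, hpos, h1, h2, fun x => ?_, fun x => ?_⟩
  · have := inner_le_inner_of_norm_le Γ (d • diagOp ψ υ) hsymm
      (fun x y => by simp [inner_smul_left, inner_smul_right, diagOp_symm ψ hs x y])
      (fun x => by
        have := diagOp_nonneg ψ hs hυ x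
        simp only [smul_apply, inner_smul_left, conj_trivial]; positivity)
      (fun x => by simpa [norm_smul, abs_of_pos hd0] using h1 x) x
    simpa [inner_smul_left] using this
  · have := inner_le_inner_of_norm_le (diagOp ψ υ) (d • Γ) (diagOp_symm ψ hs)
      (fun x y => by simp [inner_smul_left, inner_smul_right, hsymm x y])
      (fun x => by
        have := hpos0 x
        simp only [smul_apply, inner_smul_left, conj_trivial]; positivity)
      (fun x => by simpa [norm_smul, abs_of_pos hd0] using h2 x) x
    simpa [inner_smul_left] using this

/-- The bias of the Galerkin projection `e` of `β`, in the weighted norm and in `L²`. With `p` the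
orthogonal projection of `β` onto the span and `v = β - p`, the remainder `t = e - p` is the
Galerkin projection of `v`. The coefficients of `v` are those of `β` beyond the first `m`, and the
weighted norm of `t` is controlled through `‖D t‖`, since `w_j ≤ (w_m / υ_m²) υ_j²` for `j ≤ m`. -/
theorem galerkin_bias {ψ : HilbertBasis ℕ ℝ L2I} {w b υ : ℕ → ℝ} {d ρ : ℝ} {Γ : L2I →L[ℝ] L2I}
    (hd : 1 ≤ d) (hρ : 0 < ρ) (hW : RegularWeights w b υ) (hΓ : DiagComparable ψ υ d Γ) {m : ℕ}
    {β e : L2I} (hβ : β ∈ ellipsoid ψ b ρ) (he : e ∈ basisSpan ψ m)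
    (hgal : ∀ s ∈ basisSpan ψ m, ⟪Γ (β - e), s⟫ = 0) :
    wnormSq ψ w (e - β) ≤ ENNReal.ofReal (5 * d ^ 6 * ρ * rate w b m) ∧
      ‖β - e‖ ^ 2 ≤ 4 * d ^ 2 * ρ := by
  have hs := hW.υ_summable
  have hd0 : 0 < d := by linarith
  have hυm := hW.υ_pos (m - 1)
  have hwm := hW.w_pos (m - 1)
  have hbm := hW.b_pos (m - 1)
  set S := basisSpan ψ m
  set D := diagOp ψ υ
  set p : L2I := S.starProjection β
  set v := β - p
  set t := e - p
  have hpS : p ∈ S := Submodule.starProjection_apply_mem S β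
  have hvO : v ∈ Sᗮ := Submodule.sub_starProjection_mem_orthogonal β
  have htS : t ∈ S := S.sub_mem he hpS
  have hvt : β - e = v - t := by simp [v, t]
  rw [hvt] at hgal
  have hS : ∀ s ∈ S, υ (m - 1) * ‖s‖ ^ 2 ≤ ⟪D s, s⟫ := fun s h =>
    diagOp_lower_on_basisSpan ψ hs hW.υ_anti h
  have hS' : ∀ z ∈ Sᗮ, ⟪D z, z⟫ ≤ υ (m - 1) * ‖z‖ ^ 2 := fun z h =>
    diagOp_upper_on_orthogonal ψ hs hW.υ_anti h
  have ht : ‖t‖ ≤ d * ‖v‖ := norm_galerkin_le Γ D hΓ.symm hΓ.nonneg hd0 hυm hΓ.inner_diag_le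
    hΓ.inner_le hS hS' htS hvO hgal
  have hDt : ‖D t‖ ≤ d * (1 + d) * ‖Γ v‖ := by
    refine norm_le_of_galerkin_pairing Γ D hΓ.symm (diagOp_symm ψ hs) hΓ.pos hd0 hυm
      hΓ.norm_diag_le hΓ.inner_diag_le hΓ.inner_le hS hS' htS (norm_nonneg _) fun s hsS => ?_
    have := hgal s hsS
    rw [map_sub, inner_sub_left] at this
    have h2 := real_inner_le_norm (Γ v) s
    linarith
  have hDt' : ‖D t‖ ≤ 2 * d ^ 3 * (υ (m - 1) * ‖v‖) := by
    have h1 := (hΓ.norm_le v).trans (mul_le_mul_of_nonneg_left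
      (norm_diagOp_le_on_orthogonal ψ hs hW.υ_pos hW.υ_anti hvO) hd0.le)
    calc ‖D t‖ ≤ d * (1 + d) * (d * (υ (m - 1) * ‖v‖)) := hDt.trans (by gcongr)
      _ ≤ d * (d + d) * (d * (υ (m - 1) * ‖v‖)) := by gcongr
      _ = _ := by ring
  have hβj : ∀ j, m ≤ j → ⟪v, ψ j⟫ = ⟪β, ψ j⟫ := fun j hj => by
    simp only [v]
    rw [inner_sub_left, inner_basis_of_mem_basisSpan ψ hj hpS, sub_zero]
  have hv : ‖v‖ ^ 2 ≤ ρ / b (m - 1) := by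
    rw [← ENNReal.ofReal_le_ofReal_iff (by positivity), ← wnormSq_one ψ,
      ENNReal.ofReal_div_of_pos hbm, ENNReal.le_div_iff_mul_le (by simp [hbm]) (by simp)]
    refine le_trans ?_ hβ
    rw [wnormSq, wnormSq, ← ENNReal.tsum_mul_right]
    refine ENNReal.tsum_le_tsum fun j => ?_
    rw [← ENNReal.ofReal_mul (by positivity)]
    apply ENNReal.ofReal_le_ofReal
    rcases lt_or_ge j m with hj | hj
    · rw [inner_basis_of_mem_orthogonal ψ hj hvO]
      have := hW.b_pos j
      simp only [ne_eq, OfNat.ofNat_ne_zero, not_false_eq_true, zero_pow, mul_zero, zero_mul]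
      positivity
    · rw [hβj j hj, one_mul, mul_comm]
      have := hW.b_mono (show m - 1 ≤ j by omega)
      gcongr
  constructor
  -- Coordinates of `t` live below `m`, those of `v` at and above `m`.
  · have hterm : ∀ j, ENNReal.ofReal (w j * ⟪e - β, ψ j⟫ ^ 2) ≤
        ENNReal.ofReal (w (m - 1) / υ (m - 1) ^ 2) * ENNReal.ofReal (υ j ^ 2 * ⟪t, ψ j⟫ ^ 2)
        + ENNReal.ofReal (w (m - 1) / b (m - 1)) * ENNReal.ofReal (b j * ⟪β, ψ j⟫ ^ 2) := by
      intro j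
      have h0 : e - β = t - v := by simp [v, t]
      have hwj := hW.w_pos j
      have hbj := hW.b_pos j
      rw [← ENNReal.ofReal_mul (by positivity), ← ENNReal.ofReal_mul (by positivity), h0,
        inner_sub_left]
      rcases lt_or_ge j m with hj | hj
      · rw [inner_basis_of_mem_orthogonal ψ hj hvO, sub_zero]
        refine le_add_right (ENNReal.ofReal_le_ofReal ?_)
        rw [← mul_assoc]
        gcongr
        have := hW.υ_sq_div_w_anti (show j ≤ m - 1 by omega)
        simp only at this
        rw [div_le_div_iff₀ hwm hwj] at this
        rw [div_mul_eq_mul_div, le_div_iff₀ (by positivity)]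
        linarith
      · rw [inner_basis_of_mem_basisSpan ψ hj htS, hβj j hj, zero_sub, neg_sq]
        refine le_add_left (ENNReal.ofReal_le_ofReal ?_)
        rw [← mul_assoc]
        gcongr
        have := hW.b_div_w_mono (show m - 1 ≤ j by omega)
        simp only at this
        rw [div_le_div_iff₀ hwm hwj] at this
        rw [div_mul_eq_mul_div, le_div_iff₀ (by positivity)]
        linarith
    calc wnormSq ψ w (e - β)
        ≤ ENNReal.ofReal (w (m - 1) / υ (m - 1) ^ 2) * wnormSq ψ (fun j => υ j ^ 2) t
          + ENNReal.ofReal (w (m - 1) / b (m - 1)) * wnormSq ψ b β := by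
          refine (ENNReal.tsum_le_tsum hterm).trans_eq ?_
          rw [ENNReal.tsum_add, ENNReal.tsum_mul_left, ENNReal.tsum_mul_left]
          rfl
      _ ≤ ENNReal.ofReal (w (m - 1) / υ (m - 1) ^ 2) *
            ENNReal.ofReal ((2 * d ^ 3 * υ (m - 1)) ^ 2 * (ρ / b (m - 1)))
          + ENNReal.ofReal (w (m - 1) / b (m - 1)) * ENNReal.ofReal ρ := by
          gcongr
          · rw [wnormSq_sq_eq_norm_diagOp ψ hs]
            apply ENNReal.ofReal_le_ofReal
            calc ‖D t‖ ^ 2 ≤ (2 * d ^ 3 * (υ (m - 1) * ‖v‖)) ^ 2 := by gcongr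
              _ = (2 * d ^ 3 * υ (m - 1)) ^ 2 * ‖v‖ ^ 2 := by ring
              _ ≤ _ := by gcongr
          · exact hβ
      _ = ENNReal.ofReal ((4 * d ^ 6 + 1) * ρ * rate w b m) := by
          rw [← ENNReal.ofReal_mul (by positivity), ← ENNReal.ofReal_mul (by positivity),
            ← ENNReal.ofReal_add (by positivity) (by positivity), rate]
          congr 1
          field_simp
          ring
      _ ≤ _ := by
          apply ENNReal.ofReal_le_ofReal
          have : 0 < rate w b m := div_pos hwm hbm
          have : 1 ≤ d ^ 6 := one_le_pow₀ hd
          gcongr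
          linarith
  · have hb1 : 1 ≤ b (m - 1) := by rw [← hW.b_one]; exact hW.b_mono (Nat.zero_le _)
    have hvρ : ‖v‖ ^ 2 ≤ ρ := hv.trans (div_le_self hρ.le hb1)
    rw [hvt]
    calc ‖v - t‖ ^ 2 ≤ (‖v‖ + ‖t‖) ^ 2 := by gcongr; exact norm_sub_le v t
      _ ≤ (d * ‖v‖ + d * ‖v‖) ^ 2 := by
        gcongr
        exact le_mul_of_one_le_left (norm_nonneg _) hd
      _ = 4 * d ^ 2 * ‖v‖ ^ 2 := by ring
      _ ≤ _ := by gcongr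

end Link

/-! ### The inverse square root and the perturbation argument -/

section Matrices

variable {m : ℕ}

theorem invSqrt_transpose (A : Matrix (Fin m) (Fin m) ℝ) : (invSqrt A)ᵀ = invSqrt A := by
  have h : IsSelfAdjoint (invSqrt A) := cfc_predicate _ A
  have := h.star_eq
  rwa [Matrix.star_eq_conjTranspose, Matrix.conjTranspose_eq_transpose_of_trivial] at this

theorem invSqrt_mul_mul_invSqrt {A : Matrix (Fin m) (Fin m) ℝ} (hA : A.PosDef) :
    invSqrt A * A * invSqrt A = 1 := by
  have hsa : IsSelfAdjoint A := hA.isHermitian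
  have hc : ∀ g : ℝ → ℝ, ContinuousOn g (spectrum ℝ A) := fun g =>
    (Matrix.finite_real_spectrum (A := A)).continuousOn g
  have hpos : ∀ x ∈ spectrum ℝ A, 0 < x := by
    intro x hx
    rw [hA.isHermitian.spectrum_real_eq_range_eigenvalues] at hx
    obtain ⟨i, rfl⟩ := hx
    exact hA.eigenvalues_pos i
  have h1 : invSqrt A * A * invSqrt A = cfc (fun x : ℝ => (√x)⁻¹ * x * (√x)⁻¹) A := by
    rw [cfc_mul _ _ A (hc _) (hc _), cfc_mul _ _ A (hc _) (hc _), cfc_id' ℝ A]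
    rfl
  rw [h1, ← cfc_const_one ℝ A]
  refine cfc_congr fun x hx => ?_
  have h2 := hpos x hx
  have h3 := Real.sq_sqrt h2.le
  have h4 : 0 < √x := Real.sqrt_pos.2 h2
  field_simp
  exact h3.symm

/-- `R A R = 1` for symmetric `A` and `R`: `R` is an inverse square root of `A`. -/
structure IsInvSqrt (R A : Matrix (Fin m) (Fin m) ℝ) : Prop where
  symm_R : Rᵀ = R
  symm_A : Aᵀ = A
  mul_mul : R * A * R = 1

variable {R A G : Matrix (Fin m) (Fin m) ℝ}

theorem IsInvSqrt.mul_eq (h : IsInvSqrt R A) : R * A = A * R := by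
  have h1 := h.mul_mul
  have h2 : R * (A * R) = 1 := by rw [← mul_assoc]; exact h1
  calc R * A = R * A * (R * (A * R)) := by rw [h2, mul_one]
    _ = R * A * R * (A * R) := by simp only [mul_assoc]
    _ = A * R := by rw [h1, one_mul]

theorem dotProduct_mulVec_invSqrt (h : IsInvSqrt R A) (x : Fin m → ℝ) :
    (R *ᵥ x) ⬝ᵥ (A *ᵥ (R *ᵥ x)) = x ⬝ᵥ x := by
  rw [Matrix.mulVec_mulVec, ← Matrix.vecMul_transpose, h.symm_R, ← Matrix.dotProduct_mulVec,
    Matrix.mulVec_mulVec, ← mul_assoc, h.mul_mul, Matrix.one_mulVec]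

theorem invSqrt_mulVec_mulVec (h : IsInvSqrt R A) (y : Fin m → ℝ) :
    R *ᵥ ((A * R) *ᵥ y) = y := by
  rw [Matrix.mulVec_mulVec, ← mul_assoc, h.mul_mul, Matrix.one_mulVec]

theorem dotProduct_self_sqrt_mulVec (h : IsInvSqrt R A) (y : Fin m → ℝ) :
    ((A * R) *ᵥ y) ⬝ᵥ ((A * R) *ᵥ y) = y ⬝ᵥ (A *ᵥ y) := by
  rw [← dotProduct_mulVec_invSqrt h ((A * R) *ᵥ y), invSqrt_mulVec_mulVec h]

theorem dotProduct_self_mulVec_le (M : Matrix (Fin m) (Fin m) ℝ) (z : Fin m → ℝ) :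
    (M *ᵥ z) ⬝ᵥ (M *ᵥ z) ≤ (∑ j, ∑ l, M j l ^ 2) * (z ⬝ᵥ z) := by
  rw [dotProduct, Finset.sum_mul]
  refine Finset.sum_le_sum fun j _ => ?_
  have := Finset.sum_mul_sq_le_sq_mul_sq Finset.univ (M j) z
  simp only [Matrix.mulVec, dotProduct]
  calc _ = (∑ i, M j i * z i) ^ 2 := by ring
    _ ≤ _ := this
    _ = _ := by congr 1; exact Finset.sum_congr rfl fun i _ => by ring

theorem dotProduct_self_nonneg (x : Fin m → ℝ) : 0 ≤ x ⬝ᵥ x :=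
  Finset.sum_nonneg fun i _ => mul_self_nonneg (x i)

/-- The squared Frobenius norm of `R G R - 1`, the relative deviation of `G` from `A` when `R` is
the inverse square root of `A`. -/
noncomputable def relDev (R G : Matrix (Fin m) (Fin m) ℝ) : ℝ :=
  ∑ j, ∑ l, (R * G * R - 1) j l ^ 2

theorem relDev_nonneg (R G : Matrix (Fin m) (Fin m) ℝ) : 0 ≤ relDev R G :=
  Finset.sum_nonneg fun _ _ => Finset.sum_nonneg fun _ _ => sq_nonneg _

/-- For `y` with `G y = x`, the vector `z = R⁻¹ y` solves `z = R x - (R G R - 1) z`. -/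
theorem dotProduct_sqrt_mulVec_le (h : IsInvSqrt R A) (y : Fin m → ℝ) :
    ((A * R) *ᵥ y) ⬝ᵥ ((A * R) *ᵥ y) ≤
      2 * ((R *ᵥ (G *ᵥ y)) ⬝ᵥ (R *ᵥ (G *ᵥ y))) +
        2 * relDev R G * (((A * R) *ᵥ y) ⬝ᵥ ((A * R) *ᵥ y)) := by
  set z := (A * R) *ᵥ y
  have hz : R *ᵥ z = y := invSqrt_mulVec_mulVec h y
  have h1 : z = R *ᵥ (G *ᵥ y) - (R * G * R - 1) *ᵥ z := by
    rw [Matrix.sub_mulVec, Matrix.one_mulVec, ← Matrix.mulVec_mulVec, hz, Matrix.mulVec_mulVec]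
    simp
  have h2 := dotProduct_self_mulVec_le (R * G * R - 1) z
  set u := R *ᵥ (G *ᵥ y)
  set v := (R * G * R - 1) *ᵥ z
  have h3 : z ⬝ᵥ z ≤ 2 * (u ⬝ᵥ u) + 2 * (v ⬝ᵥ v) := by
    rw [h1]
    simp only [dotProduct, Finset.mul_sum, ← Finset.sum_add_distrib, Pi.sub_apply]
    exact Finset.sum_le_sum fun i _ => by nlinarith [sq_nonneg (u i + v i)]
  change v ⬝ᵥ v ≤ relDev R G * (z ⬝ᵥ z) at h2
  linarith

theorem dotProduct_sqrt_mulVec_le_of_relDev_le (h : IsInvSqrt R A) (hF : relDev R G ≤ 1 / 4)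
    (y : Fin m → ℝ) : ((A * R) *ᵥ y) ⬝ᵥ ((A * R) *ᵥ y) ≤
      4 * ((R *ᵥ (G *ᵥ y)) ⬝ᵥ (R *ᵥ (G *ᵥ y))) := by
  have h1 := dotProduct_sqrt_mulVec_le (G := G) h y
  have h2 := dotProduct_self_nonneg ((A * R) *ᵥ y)
  nlinarith

theorem dotProduct_mulVec_le_specNorm (M : Matrix (Fin m) (Fin m) ℝ) (x : Fin m → ℝ) :
    (M *ᵥ x) ⬝ᵥ (M *ᵥ x) ≤ specNorm M ^ 2 * (x ⬝ᵥ x) := by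
  have h := (Matrix.toEuclideanCLM (n := Fin m) (𝕜 := ℝ) M).le_opNorm (WithLp.toLp 2 x)
  have h2 := pow_le_pow_left₀ (norm_nonneg _) h 2
  rw [Matrix.toEuclideanCLM_toLp, mul_pow, EuclideanSpace.real_norm_sq_eq,
    EuclideanSpace.real_norm_sq_eq] at h2
  simp only [dotProduct, ← sq]
  exact h2

theorem specNorm_le {M : Matrix (Fin m) (Fin m) ℝ} {c : ℝ} (hc : 0 ≤ c)
    (h : ∀ x, (M *ᵥ x) ⬝ᵥ (M *ᵥ x) ≤ c ^ 2 * (x ⬝ᵥ x)) : specNorm M ≤ c := by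
  refine ContinuousLinearMap.opNorm_le_bound _ hc fun x => ?_
  obtain ⟨x, rfl⟩ := WithLp.toLp_surjective 2 x
  refine le_of_sq_le_sq ?_ (by positivity)
  rw [Matrix.toEuclideanCLM_toLp, mul_pow, EuclideanSpace.real_norm_sq_eq,
    EuclideanSpace.real_norm_sq_eq]
  have := h x
  simp only [dotProduct, ← sq] at this
  exact this

/-- A matrix with small relative deviation from `A` is invertible, and its inverse is bounded by
twice the bound for `A⁻¹`. -/
theorem isUnit_and_specNorm_inv_le (h : IsInvSqrt R A) {c : ℝ} (hc : 0 < c)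
    (hA : ∀ x, x ⬝ᵥ x ≤ c * (x ⬝ᵥ (A *ᵥ x))) (hF : relDev R G ≤ 1 / 4) :
    IsUnit G ∧ specNorm G⁻¹ ≤ 2 * c := by
  have key : ∀ y, y ⬝ᵥ y ≤ (2 * c) ^ 2 * ((G *ᵥ y) ⬝ᵥ (G *ᵥ y)) := fun y => by
    have h1 := hA y
    rw [← dotProduct_self_sqrt_mulVec h] at h1
    have h2 := dotProduct_sqrt_mulVec_le_of_relDev_le h hF y
    have h3 := hA (R *ᵥ (G *ᵥ y))
    rw [dotProduct_mulVec_invSqrt h] at h3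
    calc y ⬝ᵥ y ≤ c * (4 * (c * ((G *ᵥ y) ⬝ᵥ (G *ᵥ y)))) := by
          refine h1.trans ?_
          gcongr
          exact h2.trans (by gcongr)
      _ = _ := by ring
  have hU : IsUnit G := by
    rw [← Matrix.mulVec_injective_iff_isUnit]
    intro y y' hyy
    have h1 := key (y - y')
    have h2 : G *ᵥ (y - y') = 0 := by rw [Matrix.mulVec_sub]; exact sub_eq_zero.2 hyy
    rw [h2, dotProduct_zero, mul_zero] at h1
    exact sub_eq_zero.1 (dotProduct_self_eq_zero.1 (le_antisymm h1 (dotProduct_self_nonneg _)))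
  refine ⟨hU, specNorm_le (by positivity) fun x => ?_⟩
  have h1 := key (G⁻¹ *ᵥ x)
  rwa [Matrix.mulVec_mulVec, Matrix.mul_nonsing_inv G ((Matrix.isUnit_iff_isUnit_det G).1 hU),
    Matrix.one_mulVec] at h1

/-- Bound on `R⁻¹ y`, where `y` solves `G y = x`, when the inverse of `G` is only known to be
bounded by the threshold `γ`. -/
theorem dotProduct_sqrt_mulVec_le_of_specNorm_le (h : IsInvSqrt R A) {d γ : ℝ}
    (hA : ∀ x, x ⬝ᵥ (A *ᵥ x) ≤ d * (x ⬝ᵥ x)) (hd : 0 ≤ d) (hU : IsUnit G)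
    (hγ : specNorm G⁻¹ ≤ γ) (y : Fin m → ℝ) :
    ((A * R) *ᵥ y) ⬝ᵥ ((A * R) *ᵥ y) ≤
      d ^ 2 * γ ^ 2 * ((R *ᵥ (G *ᵥ y)) ⬝ᵥ (R *ᵥ (G *ᵥ y))) := by
  have h0 : 0 ≤ specNorm G⁻¹ := norm_nonneg _
  have h1 : y ⬝ᵥ y ≤ γ ^ 2 * ((G *ᵥ y) ⬝ᵥ (G *ᵥ y)) := by
    have := dotProduct_mulVec_le_specNorm G⁻¹ (G *ᵥ y)
    rw [Matrix.mulVec_mulVec, Matrix.nonsing_inv_mul G ((Matrix.isUnit_iff_isUnit_det G).1 hU),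
      Matrix.one_mulVec] at this
    refine this.trans ?_
    have := dotProduct_self_nonneg (G *ᵥ y)
    gcongr
  have h2 : (G *ᵥ y) ⬝ᵥ (G *ᵥ y) ≤ d * ((R *ᵥ (G *ᵥ y)) ⬝ᵥ (R *ᵥ (G *ᵥ y))) := by
    have h3 : (A * R) *ᵥ (R *ᵥ (G *ᵥ y)) = G *ᵥ y := by
      rw [Matrix.mulVec_mulVec, ← h.mul_eq, h.mul_mul, Matrix.one_mulVec]
    conv_lhs => rw [← h3]
    rw [dotProduct_self_sqrt_mulVec h]
    exact hA _
  rw [dotProduct_self_sqrt_mulVec h]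
  calc y ⬝ᵥ (A *ᵥ y) ≤ d * (y ⬝ᵥ y) := hA y
    _ ≤ d * (γ ^ 2 * (d * ((R *ᵥ (G *ᵥ y)) ⬝ᵥ (R *ᵥ (G *ᵥ y))))) := by
      gcongr
      exact h1.trans (by gcongr)
    _ = _ := by ring

end Matrices

section Trunc

variable {ψ : HilbertBasis ℕ ℝ L2I} {m : ℕ}

theorem sum_smul_mem_basisSpan (c : Fin m → ℝ) : ∑ l, c l • ψ l ∈ basisSpan ψ m :=
  Submodule.sum_mem _ fun l _ => Submodule.smul_mem _ _ (basis_mem_basisSpan ψ l.2)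

theorem inner_sum_smul_basis (c : Fin m → ℝ) (j : Fin m) : ⟪∑ l, c l • ψ l, ψ j⟫ = c j := by
  rw [sum_inner, Finset.sum_eq_single j]
  · rw [inner_smul_left, real_inner_self_eq_norm_sq, ψ.orthonormal.1]; simp
  · intro l _ hl
    rw [inner_smul_left, ψ.orthonormal.2 (fun h => hl (Fin.ext h)), mul_zero]
  · simp

theorem hasSum_sum_smul (c : Fin m → ℝ) (a : ℕ → ℝ) :
    HasSum (fun j => a j * ⟪∑ l, c l • ψ l, ψ j⟫ ^ 2) (∑ j : Fin m, a j * c j ^ 2) := by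
  have h : HasSum (fun j => a j * ⟪∑ l, c l • ψ l, ψ j⟫ ^ 2)
      (∑ j ∈ Finset.range m, a j * ⟪∑ l, c l • ψ l, ψ j⟫ ^ 2) :=
    hasSum_sum_of_ne_finset_zero (fun j hj => by
      rw [inner_basis_of_mem_basisSpan ψ (by simpa using hj) (sum_smul_mem_basisSpan c)]; simp)
  rw [← Fin.sum_univ_eq_sum_range (fun j => a j * ⟪∑ l, c l • ψ l, ψ j⟫ ^ 2)] at h
  simpa only [inner_sum_smul_basis] using h

theorem truncMatrix_mulVec (T : L2I →L[ℝ] L2I) (c : Fin m → ℝ) :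
    truncMatrix ψ m T *ᵥ c = truncVec ψ m (T (∑ l, c l • ψ l)) := by
  ext j
  simp [Matrix.mulVec, dotProduct, truncMatrix, truncVec, sum_inner, inner_smul_left, mul_comm]

theorem dotProduct_truncVec (c : Fin m → ℝ) (f : L2I) :
    c ⬝ᵥ truncVec ψ m f = ⟪f, ∑ l, c l • ψ l⟫ := by
  simp [dotProduct, truncVec, inner_sum, inner_smul_right]

theorem dotProduct_truncMatrix_mulVec (T : L2I →L[ℝ] L2I) (c : Fin m → ℝ) :
    c ⬝ᵥ (truncMatrix ψ m T *ᵥ c) = ⟪T (∑ l, c l • ψ l), ∑ l, c l • ψ l⟫ := by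
  rw [truncMatrix_mulVec, dotProduct_truncVec]

variable {υ : ℕ → ℝ} {d : ℝ} {Γ : L2I →L[ℝ] L2I}

theorem truncMatrix_transpose (hΓ : DiagComparable ψ υ d Γ) :
    (truncMatrix ψ m Γ)ᵀ = truncMatrix ψ m Γ := by
  ext j l
  simp only [truncMatrix, Matrix.transpose_apply, Matrix.of_apply]
  rw [hΓ.symm, real_inner_comm]

theorem posDef_truncMatrix (hΓ : DiagComparable ψ υ d Γ) : (truncMatrix ψ m Γ).PosDef := by
  refine Matrix.PosDef.of_dotProduct_mulVec_pos ?_ fun x hx => ?_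
  · rw [Matrix.IsHermitian, Matrix.conjTranspose_eq_transpose_of_trivial, truncMatrix_transpose hΓ]
  · rw [star_trivial, dotProduct_truncMatrix_mulVec]
    refine hΓ.pos _ fun h => hx ?_
    ext j
    rw [← inner_sum_smul_basis (ψ := ψ) x j, h]
    simp

theorem isInvSqrt_truncMatrix (hΓ : DiagComparable ψ υ d Γ) :
    IsInvSqrt (invSqrt (truncMatrix ψ m Γ)) (truncMatrix ψ m Γ) :=
  ⟨invSqrt_transpose _, truncMatrix_transpose hΓ, invSqrt_mul_mul_invSqrt (posDef_truncMatrix hΓ)⟩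

theorem dotProduct_truncMatrix_le (hs : Summable υ) (hυ1 : ∀ j, υ j ≤ 1) (hd : 0 ≤ d)
    (hΓ : DiagComparable ψ υ d Γ) (c : Fin m → ℝ) :
    c ⬝ᵥ (truncMatrix ψ m Γ *ᵥ c) ≤ d * (c ⬝ᵥ c) := by
  rw [dotProduct_truncMatrix_mulVec]
  refine (hΓ.inner_le _).trans ?_
  rw [(hasSum_diagOp_self ψ hs _).unique (hasSum_sum_smul c υ)]
  gcongr
  refine Finset.sum_le_sum fun j _ => ?_
  have := hυ1 j
  nlinarith [sq_nonneg (c j)]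

theorem sum_le_dotProduct_truncMatrix (hs : Summable υ) (hΓ : DiagComparable ψ υ d Γ)
    (c : Fin m → ℝ) :
    ∑ j : Fin m, υ j * c j ^ 2 ≤ d * (c ⬝ᵥ (truncMatrix ψ m Γ *ᵥ c)) := by
  rw [dotProduct_truncMatrix_mulVec, ← (hasSum_diagOp_self ψ hs _).unique (hasSum_sum_smul c υ)]
  exact hΓ.inner_diag_le _

theorem wnormSq_sum_smul {w : ℕ → ℝ} (hw : ∀ j, 0 < w j) (c : Fin m → ℝ) :
    wnormSq ψ w (∑ l, c l • ψ l) = ENNReal.ofReal (∑ j : Fin m, w j * c j ^ 2) := by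
  have h := hasSum_sum_smul (ψ := ψ) c w
  rw [wnormSq, ← h.tsum_eq, ENNReal.ofReal_tsum_of_nonneg (fun j => ?_) h.summable]
  have := hw j
  positivity

theorem two_mul_ofReal (x : ℝ) : 2 * ENNReal.ofReal x = ENNReal.ofReal (2 * x) := by
  rw [ENNReal.ofReal_mul (by norm_num), ENNReal.ofReal_ofNat]

theorem wnormSq_add_le {w : ℕ → ℝ} (hw : ∀ j, 0 < w j) (f g : L2I) :
    wnormSq ψ w (f + g) ≤ 2 * wnormSq ψ w f + 2 * wnormSq ψ w g := by
  simp only [wnormSq]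
  rw [← ENNReal.tsum_mul_left, ← ENNReal.tsum_mul_left, ← ENNReal.tsum_add]
  refine ENNReal.tsum_le_tsum fun j => ?_
  have := hw j
  rw [two_mul_ofReal, two_mul_ofReal, ← ENNReal.ofReal_add (by positivity) (by positivity)]
  refine ENNReal.ofReal_le_ofReal ?_
  rw [inner_add_left]
  nlinarith [mul_nonneg this.le (sq_nonneg (⟪f, ψ j⟫ - ⟪g, ψ j⟫))]

open Classical in
/-- The loss of the thresholded estimator, bounded by the bias, by the standardized noise
`q = ‖R [ĝ - Γ̂ e]‖²`, and by the indicator of the event that the relative deviation of the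
empirical covariance matrix exceeds `1 / 4`. -/
theorem loss_le {w b : ℕ → ℝ} {ρ γ s : ℝ} (hd : 1 ≤ d)
    (hW : RegularWeights w b υ) (hΓ : DiagComparable ψ υ d Γ) {β e : L2I}
    (hβ : β ∈ ellipsoid ψ b ρ) (he : e ∈ basisSpan ψ m)
    (hγ : 2 * (d / υ (m - 1)) ≤ γ) (hs : ∀ j : Fin m, w j / υ j ≤ s)
    {n : ℕ} (D : Fin n → ℝ × L2I) :
    let F := relDev (invSqrt (truncMatrix ψ m Γ)) (truncMatrix ψ m (gammaHat D))
    let S := invSqrt (truncMatrix ψ m Γ) *ᵥ truncVec ψ m (gHat D - gammaHat D e)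
    wnormSq ψ w (betaHat ψ m γ D - β) ≤ 2 * wnormSq ψ w (e - β)
      + ENNReal.ofReal (8 * s * d * (S ⬝ᵥ S)
        + 4 * s * d ^ 3 * γ ^ 2 * ((if 1 / 4 < F then 1 else 0) * F * (S ⬝ᵥ S)))
      + ENNReal.ofReal ρ * ENNReal.ofReal (if 1 / 4 < F then 1 else 0) := by
  intro F S
  set A := truncMatrix ψ m Γ
  set R := invSqrt A
  set G := truncMatrix ψ m (gammaHat D)
  have hd0 : 0 < d := by linarith
  have hinv : IsInvSqrt R A := isInvSqrt_truncMatrix hΓ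
  have hυ1 : ∀ j, υ j ≤ 1 := fun j => by rw [← hW.υ_one]; exact hW.υ_anti (Nat.zero_le j)
  have hsum := hW.υ_summable
  have hυm := hW.υ_pos (m - 1)
  have hlow : ∀ x, x ⬝ᵥ x ≤ d / υ (m - 1) * (x ⬝ᵥ (A *ᵥ x)) := fun x => by
    rw [div_mul_eq_mul_div, le_div_iff₀ hυm]
    refine le_trans ?_ (sum_le_dotProduct_truncMatrix hsum hΓ x)
    rw [dotProduct, Finset.sum_mul]
    refine Finset.sum_le_sum fun j _ => ?_
    have := hW.υ_anti (show (j : ℕ) ≤ m - 1 by have := j.2; omega)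
    nlinarith [sq_nonneg (x j)]
  have hFS : 0 ≤ F := relDev_nonneg _ _
  have hSS : 0 ≤ S ⬝ᵥ S := dotProduct_self_nonneg S
  by_cases hΩ : IsUnit G ∧ specNorm G⁻¹ ≤ γ
  · have hs0 : ∀ j : Fin m, w j ≤ s * υ j := fun j => by
      have := hs j
      rwa [div_le_iff₀ (hW.υ_pos j)] at this
    -- The coordinates `y` of the stochastic error solve `G y = [ĝ - Γ̂ e]`.
    set y : Fin m → ℝ := G⁻¹ *ᵥ truncVec ψ m (gHat D) - truncVec ψ m e
    have hβhat : betaHat ψ m γ D - e = ∑ l, y l • ψ l := by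
      rw [betaHat, if_pos hΩ]
      conv_lhs => rw [← sum_inner_smul_of_mem_basisSpan ψ he]
      simp only [y, Pi.sub_apply, sub_smul, Finset.sum_sub_distrib]
      rfl
    have hGy : G *ᵥ y = truncVec ψ m (gHat D - gammaHat D e) := by
      rw [Matrix.mulVec_sub, Matrix.mulVec_mulVec,
        Matrix.mul_nonsing_inv G ((Matrix.isUnit_iff_isUnit_det G).1 hΩ.1), Matrix.one_mulVec,
        truncMatrix_mulVec]
      have h1 : ∑ l : Fin m, truncVec ψ m e l • ψ l = e := sum_inner_smul_of_mem_basisSpan ψ he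
      rw [h1]
      ext j
      simp [truncVec, inner_sub_left]
    have hS : R *ᵥ (G *ᵥ y) = S := by rw [hGy]
    have hz : ((A * R) *ᵥ y) ⬝ᵥ ((A * R) *ᵥ y) ≤ 4 * (S ⬝ᵥ S) +
        2 * d ^ 2 * γ ^ 2 * ((if 1 / 4 < F then 1 else 0) * F * (S ⬝ᵥ S)) := by
      split_ifs with hF
      · have h1 := dotProduct_sqrt_mulVec_le (G := G) hinv y
        have h2 := dotProduct_sqrt_mulVec_le_of_specNorm_le hinv
          (dotProduct_truncMatrix_le hsum hυ1 hd0.le hΓ) hd0.le hΩ.1 hΩ.2 y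
        rw [hS] at h1 h2
        change _ ≤ _ + 2 * F * _ at h1
        have h3 := mul_le_mul_of_nonneg_left h2 (show 0 ≤ 2 * F by positivity)
        linarith
      · have h1 := dotProduct_sqrt_mulVec_le_of_relDev_le hinv (not_lt.1 hF) y
        rw [hS] at h1
        simpa using h1
    have hw : ∑ j : Fin m, w j * y j ^ 2 ≤ s * d * (4 * (S ⬝ᵥ S) +
        2 * d ^ 2 * γ ^ 2 * ((if 1 / 4 < F then 1 else 0) * F * (S ⬝ᵥ S))) := by
      rcases Nat.eq_zero_or_pos m with rfl | hm
      · simp [dotProduct]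
      have hspos : 0 ≤ s :=
        (div_pos (hW.w_pos _) (hW.υ_pos _)).le.trans (hs ⟨0, hm⟩)
      calc ∑ j : Fin m, w j * y j ^ 2 ≤ ∑ j : Fin m, s * (υ j * y j ^ 2) := by
            refine Finset.sum_le_sum fun j _ => ?_
            rw [← mul_assoc]
            exact mul_le_mul_of_nonneg_right (hs0 j) (sq_nonneg _)
        _ = s * ∑ j : Fin m, υ j * y j ^ 2 := by rw [Finset.mul_sum]
        _ ≤ s * (d * (y ⬝ᵥ (A *ᵥ y))) := by
            gcongr
            exact sum_le_dotProduct_truncMatrix hsum hΓ y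
        _ = s * d * (((A * R) *ᵥ y) ⬝ᵥ ((A * R) *ᵥ y)) := by
            rw [dotProduct_self_sqrt_mulVec hinv]; ring
        _ ≤ _ := by gcongr
    have hsplit : betaHat ψ m γ D - β = (e - β) + (betaHat ψ m γ D - e) := by abel
    rw [hsplit]
    refine (wnormSq_add_le hW.w_pos _ _).trans ?_
    refine le_add_right ?_
    gcongr
    rw [hβhat, wnormSq_sum_smul hW.w_pos, two_mul_ofReal]
    refine ENNReal.ofReal_le_ofReal ?_
    refine (mul_le_mul_of_nonneg_left hw (by positivity)).trans_eq ?_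
    ring
  -- If the estimator is thresholded to zero, the loss is `‖β‖_w² ≤ ‖β‖_b² ≤ ρ`.
  · have hF : 1 / 4 < F := by
      by_contra! hF
      have := isUnit_and_specNorm_inv_le hinv (by positivity) hlow hF
      exact hΩ ⟨this.1, this.2.trans hγ⟩
    rw [betaHat, if_neg hΩ, if_pos hF]
    refine le_add_left ?_
    rw [ENNReal.ofReal_one, mul_one]
    refine le_trans ?_ hβ
    refine ENNReal.tsum_le_tsum fun j => ENNReal.ofReal_le_ofReal ?_
    have h1 : 1 ≤ b j / w j := by
      have := hW.b_div_w_mono (Nat.zero_le j)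
      simpa [hW.b_one, hW.w_one] using this
    rw [one_le_div (hW.w_pos j)] at h1
    rw [zero_sub, inner_neg_left, neg_sq]
    gcongr

end Trunc

/-! ### Moments of sums of independent centered variables -/

section Moments

theorem pow_mul_pow_le_add {x y : ℝ} (hx : 0 ≤ x) (hy : 0 ≤ y) (a b : ℕ) :
    x ^ a * y ^ b ≤ x ^ (a + b) + y ^ (a + b) := by
  rcases le_total x y with h | h
  · calc x ^ a * y ^ b ≤ y ^ a * y ^ b := by gcongr
      _ = y ^ (a + b) := by rw [pow_add]
      _ ≤ _ := by have := pow_nonneg hx (a + b); linarith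
  · calc x ^ a * y ^ b ≤ x ^ a * x ^ b := by gcongr
      _ = x ^ (a + b) := by rw [pow_add]
      _ ≤ _ := by have := pow_nonneg hy (a + b); linarith

theorem pow_le_one_add_pow {x : ℝ} (hx : 0 ≤ x) {a b : ℕ} (hab : a ≤ b) : x ^ a ≤ 1 + x ^ b := by
  have h := pow_mul_pow_le_add zero_le_one hx (b - a) a
  rw [Nat.sub_add_cancel hab] at h
  simpa using h

theorem even_pow_abs (x : ℝ) (p : ℕ) : |x| ^ (2 * p) = x ^ (2 * p) := by
  rw [pow_mul, pow_mul, sq_abs]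

/-- Second-order expansion of an even power. -/
theorem add_pow_even_le (s z : ℝ) (p : ℕ) :
    (s + z) ^ (2 * (p + 1)) ≤ s ^ (2 * (p + 1)) + (2 * (p + 1) : ℕ) * (s ^ (2 * p + 1) * z) +
      2 ^ (2 * (p + 1)) * (s ^ (2 * p) * z ^ 2 + z ^ (2 * (p + 1))) := by
  set N := 2 * (p + 1)
  have hN : N + 1 = (2 * p + 1) + 1 + 1 := by omega
  have hterm : ∀ i ∈ Finset.range (2 * p + 1),
      z ^ (i + 1 + 1) * s ^ (N - (i + 1 + 1)) * (N.choose (i + 1 + 1) : ℝ)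
        ≤ (N.choose (i + 1 + 1) : ℝ) * (s ^ (2 * p) * z ^ 2 + z ^ N) := by
    intro i hi
    rw [mul_comm]
    gcongr
    have hi' : i ≤ 2 * p := by simpa [Nat.lt_succ_iff] using hi
    have h1 := pow_mul_pow_le_add (abs_nonneg s) (abs_nonneg z) (2 * p - i) i
    rw [Nat.sub_add_cancel hi', even_pow_abs, even_pow_abs] at h1
    calc z ^ (i + 1 + 1) * s ^ (N - (i + 1 + 1))
        ≤ |z ^ (i + 1 + 1) * s ^ (N - (i + 1 + 1))| := le_abs_self _
      _ = |z| ^ 2 * (|s| ^ (2 * p - i) * |z| ^ i) := by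
        rw [abs_mul, abs_pow, abs_pow, show N - (i + 1 + 1) = 2 * p - i by omega]; ring
      _ ≤ |z| ^ 2 * (s ^ (2 * p) + z ^ (2 * p)) := by gcongr
      _ = _ := by
        rw [sq_abs, show N = 2 * p + 2 by omega]; ring
  have hsum : ∑ i ∈ Finset.range (2 * p + 1), (N.choose (i + 1 + 1) : ℝ) ≤ 2 ^ N := by
    have h := Nat.sum_range_choose N
    rw [hN, Finset.sum_range_succ', Finset.sum_range_succ'] at h
    have : ∑ i ∈ Finset.range (2 * p + 1), N.choose (i + 1 + 1) ≤ 2 ^ N := by omega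
    exact_mod_cast this
  have hnn : 0 ≤ s ^ (2 * p) * z ^ 2 + z ^ N := by
    have h1 : 0 ≤ s ^ (2 * p) := by rw [pow_mul]; positivity
    have h2 : 0 ≤ z ^ N := by rw [pow_mul]; positivity
    positivity
  rw [add_comm s z, add_pow, hN, Finset.sum_range_succ', Finset.sum_range_succ']
  have h3 := Finset.sum_le_sum hterm
  rw [← Finset.sum_mul] at h3
  have h4 := mul_le_mul_of_nonneg_right hsum hnn
  have h5 : N - 1 = 2 * p + 1 := by omega
  simp only [zero_add, pow_one, Nat.choose_one_right, pow_zero, Nat.sub_zero, one_mul,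
    Nat.choose_zero_right, Nat.cast_one, mul_one, h5]
  nlinarith

variable {Ω' : Type*} [MeasurableSpace Ω'] {P : Measure Ω'}

/-- The constants of the moment bound for sums of independent variables. -/
def momentConst : ℕ → ℝ
  | 0 => 1
  | p + 1 => 2 ^ (2 * (p + 1)) * (2 * momentConst p + 2)

theorem momentConst_pos (p : ℕ) : 0 < momentConst p := by
  induction p with
  | zero => simp [momentConst]
  | succ p ih => rw [momentConst]; positivity

theorem MemLp.integrable_pow_mul_pow [IsProbabilityMeasure P] {S Z : Ω' → ℝ} {N a b : ℕ}
    (hS : MemLp S N P) (hZ : MemLp Z N P) (hab : a + b ≤ N) :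
    Integrable (fun x => S x ^ a * Z x ^ b) P := by
  have h1 : Integrable (fun x => ‖S x‖ ^ (a + b) + ‖Z x‖ ^ (a + b)) P :=
    (MemLp.integrable_norm_pow' (hS.mono_exponent (by exact_mod_cast hab))).add
      (MemLp.integrable_norm_pow' (hZ.mono_exponent (by exact_mod_cast hab)))
  refine h1.mono' ((hS.1.pow a).mul (hZ.1.pow b)) (ae_of_all _ fun x => ?_)
  rw [norm_mul, norm_pow, norm_pow]
  exact pow_mul_pow_le_add (norm_nonneg _) (norm_nonneg _) a b

theorem MemLp.integrable_pow_of_le [IsProbabilityMeasure P] {S : Ω' → ℝ} {N a : ℕ}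
    (hS : MemLp S N P) (ha : a ≤ N) : Integrable (fun x => S x ^ a) P := by
  simpa using MemLp.integrable_pow_mul_pow (b := 0) hS hS (by simpa using ha)

/-- The normalized moment bound. One summand is added at a time: in the expansion
`add_pow_even_le` the linear term has mean zero by independence, and the remainder involves the
moment of order `2 p` of the partial sum, which the induction on the order controls. -/
theorem integral_sum_pow_le_of_le_two [IsProbabilityMeasure P] {ι : Type*} {Z : ι → Ω' → ℝ}
    (hind : iIndepFun Z P) (h0 : ∀ i, ∫ x, Z i x ∂P = 0) (p : ℕ)
    (hZ : ∀ i, MemLp (Z i) (2 * p : ℕ) P) (hm : ∀ i, ∀ q ≤ p, ∫ x, Z i x ^ (2 * q) ∂P ≤ 2)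
    (s : Finset ι) :
    ∫ x, (∑ i ∈ s, Z i x) ^ (2 * p) ∂P ≤ momentConst p * (s.card : ℝ) ^ p := by
  classical
  induction p generalizing s with
  | zero => simp [momentConst]
  | succ p ih =>
    have ihp := ih (fun i => (hZ i).mono_exponent (by gcongr; omega))
      (fun i q hq => hm i q (by omega))
    have key : ∀ s : Finset ι, ∫ x, (∑ i ∈ s, Z i x) ^ (2 * (p + 1)) ∂P ≤
        s.card * (momentConst (p + 1) * (s.card : ℝ) ^ p) := by
      intro s
      induction s using Finset.induction_on with
      | empty => simp
      | insert i s hi ihs =>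
        have hSL : MemLp (fun x => ∑ j ∈ s, Z j x) (2 * (p + 1) : ℕ) P :=
          memLp_finsetSum s fun j _ => hZ j
        have hindS : IndepFun (fun x => ∑ j ∈ s, Z j x) (Z i) P := by
          have := hind.indepFun_finsetSum_of_notMem₀ (fun j => (hZ j).1.aemeasurable) hi
          convert this using 1
          ext x; simp
        have hmul : ∀ a b : ℕ, a + b ≤ 2 * (p + 1) →
            ∫ x, (∑ j ∈ s, Z j x) ^ a * Z i x ^ b ∂P =
              (∫ x, (∑ j ∈ s, Z j x) ^ a ∂P) * ∫ x, Z i x ^ b ∂P := by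
          intro a b hab
          have h1 := hindS.comp (φ := fun t : ℝ => t ^ a) (ψ := fun t : ℝ => t ^ b)
            (by fun_prop) (by fun_prop)
          exact h1.integral_fun_mul_eq_mul_integral (hSL.1.pow a) ((hZ i).1.pow b)
        have hcard : ((insert i s).card : ℝ) = s.card + 1 := by
          rw [Finset.card_insert_of_notMem hi]; push_cast; ring
        have hI1 := MemLp.integrable_pow_of_le hSL le_rfl
        have hI2 : Integrable (fun x => (∑ j ∈ s, Z j x) ^ (2 * p + 1) * Z i x) P := by
          simpa using MemLp.integrable_pow_mul_pow (a := 2 * p + 1) (b := 1) hSL (hZ i) (by omega)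
        have hI3 := MemLp.integrable_pow_mul_pow (a := 2 * p) (b := 2) hSL (hZ i) (by omega)
        have hI4 := MemLp.integrable_pow_of_le (hZ i) le_rfl
        have hI12 : Integrable (fun x => (∑ j ∈ s, Z j x) ^ (2 * (p + 1)) +
            (2 * (p + 1) : ℕ) * ((∑ j ∈ s, Z j x) ^ (2 * p + 1) * Z i x)) P :=
          hI1.add (hI2.const_mul _)
        have hI34 : Integrable (fun x => (2 : ℝ) ^ (2 * (p + 1)) *
            ((∑ j ∈ s, Z j x) ^ (2 * p) * Z i x ^ 2 + Z i x ^ (2 * (p + 1)))) P :=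
          (hI3.add hI4).const_mul _
        have hz2 := hm i 1 (by omega)
        have hzp := hm i (p + 1) le_rfl
        have hS2 := ihp s
        have hS0 : 0 ≤ ∫ x, (∑ j ∈ s, Z j x) ^ (2 * p) ∂P :=
          integral_nonneg fun x => by simp only [Pi.zero_apply, pow_mul]; positivity
        rw [hcard]
        calc ∫ x, (∑ j ∈ insert i s, Z j x) ^ (2 * (p + 1)) ∂P
            ≤ ∫ x, ((∑ j ∈ s, Z j x) ^ (2 * (p + 1)) +
                (2 * (p + 1) : ℕ) * ((∑ j ∈ s, Z j x) ^ (2 * p + 1) * Z i x) +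
                2 ^ (2 * (p + 1)) * ((∑ j ∈ s, Z j x) ^ (2 * p) * Z i x ^ 2 +
                  Z i x ^ (2 * (p + 1)))) ∂P := by
              refine integral_mono_of_nonneg (ae_of_all _ fun x => ?_)
                (hI12.add hI34)
                (ae_of_all _ fun x => ?_)
              · simp only [Pi.zero_apply, pow_mul]; positivity
              · simp only [Finset.sum_insert hi, add_comm (Z i x)]
                exact add_pow_even_le _ _ p
          _ = ∫ x, (∑ j ∈ s, Z j x) ^ (2 * (p + 1)) ∂P +
                2 ^ (2 * (p + 1)) * ((∫ x, (∑ j ∈ s, Z j x) ^ (2 * p) ∂P) *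
                  (∫ x, Z i x ^ 2 ∂P) + ∫ x, Z i x ^ (2 * (p + 1)) ∂P) := by
              rw [integral_add hI12 hI34, integral_add hI1 (hI2.const_mul _), integral_const_mul,
                integral_const_mul, integral_add hI3 hI4, hmul _ _ (by omega)]
              have := hmul (2 * p + 1) 1 (by omega)
              simp only [pow_one, h0 i, mul_zero] at this
              rw [this]; ring
          _ ≤ s.card * (momentConst (p + 1) * (s.card : ℝ) ^ p) +
                2 ^ (2 * (p + 1)) * ((momentConst p * (s.card : ℝ) ^ p) * 2 + 2) := by
              have : (∫ x, (∑ j ∈ s, Z j x) ^ (2 * p) ∂P) * (∫ x, Z i x ^ 2 ∂P)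
                  ≤ (momentConst p * (s.card : ℝ) ^ p) * 2 := by
                refine (mul_le_mul_of_nonneg_left hz2 hS0).trans ?_
                gcongr
              gcongr
          _ ≤ s.card * (momentConst (p + 1) * ((s.card : ℝ) + 1) ^ p) +
                2 ^ (2 * (p + 1)) * ((momentConst p * ((s.card : ℝ) + 1) ^ p) * 2 +
                  2 * ((s.card : ℝ) + 1) ^ p) := by
              have h1 : (1 : ℝ) ≤ ((s.card : ℝ) + 1) ^ p := one_le_pow₀ (by simp)
              have := momentConst_pos p
              have := momentConst_pos (p + 1)
              gcongr
              · linarith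
              · linarith
              · linarith
          _ = _ := by rw [momentConst]; ring
    refine (key s).trans_eq ?_
    ring

/-- Moments of sums of independent centered variables grow like the corresponding power of the
square root of the number of summands. -/
theorem integral_sum_pow_le [IsProbabilityMeasure P] {ι : Type*} {Z : ι → Ω' → ℝ}
    (hind : iIndepFun Z P) (h0 : ∀ i, ∫ x, Z i x ∂P = 0) {p : ℕ} (hp : p ≠ 0)
    (hZ : ∀ i, MemLp (Z i) (2 * p : ℕ) P) {M : ℝ} (hM : 0 < M)
    (hm : ∀ i, ∫ x, Z i x ^ (2 * p) ∂P ≤ M) (s : Finset ι) :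
    ∫ x, (∑ i ∈ s, Z i x) ^ (2 * p) ∂P ≤ momentConst p * (s.card : ℝ) ^ p * M := by
  -- Rescaling to `M = 1` makes all lower even moments at most `2`.
  obtain ⟨a, ha, haM⟩ : ∃ a : ℝ, 0 < a ∧ a ^ (2 * p) = M⁻¹ :=
    ⟨M⁻¹ ^ (((2 * p : ℕ) : ℝ)⁻¹), by positivity,
      Real.rpow_inv_natCast_pow (by positivity) (by omega)⟩
  have h1 := integral_sum_pow_le_of_le_two (Z := fun i x => a * Z i x)
    (hind.comp (fun _ t => a * t) (fun _ => by fun_prop))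
    (fun i => by rw [integral_const_mul, h0, mul_zero]) p (fun i => (hZ i).const_mul a)
    (fun i q hq => ?_) s
  · simp only [← Finset.mul_sum, mul_pow, haM, integral_const_mul] at h1
    rw [inv_mul_le_iff₀ hM] at h1
    linarith
  · calc ∫ x, (a * Z i x) ^ (2 * q) ∂P ≤ ∫ x, (1 + a ^ (2 * p) * Z i x ^ (2 * p)) ∂P := by
          refine integral_mono (MemLp.integrable_pow_of_le ((hZ i).const_mul a) (by omega))
            ((integrable_const _).add ((MemLp.integrable_pow_of_le (hZ i) le_rfl).const_mul _))
            fun x => ?_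
          have := pow_le_one_add_pow (abs_nonneg (a * Z i x)) (show 2 * q ≤ 2 * p by omega)
          rwa [even_pow_abs, even_pow_abs, mul_pow a (Z i x) (2 * p)] at this
      _ = 1 + a ^ (2 * p) * ∫ x, Z i x ^ (2 * p) ∂P := by
          rw [integral_add (integrable_const _)
            ((MemLp.integrable_pow_of_le (hZ i) le_rfl).const_mul _), integral_const_mul]
          simp
      _ ≤ 1 + M⁻¹ * M := by rw [haM]; gcongr; exact hm i
      _ = 2 := by field_simp; norm_num

theorem memLp_of_lintegral_pow_le {Z : Ω' → ℝ} {N : ℕ} (hN : N ≠ 0) {M : ℝ≥0∞} (hM : M ≠ ∞)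
    (hZ : AEMeasurable Z P) (h : ∫⁻ x, ENNReal.ofReal (|Z x| ^ N) ∂P ≤ M) : MemLp Z N P := by
  refine ⟨hZ.aestronglyMeasurable, ?_⟩
  rw [eLpNorm_lt_top_iff_lintegral_rpow_enorm_lt_top (by simpa using hN) (by simp)]
  refine lt_of_le_of_lt ?_ (lt_of_le_of_lt h hM.lt_top)
  refine lintegral_mono fun x => le_of_eq ?_
  rw [ENNReal.toReal_natCast, ENNReal.rpow_natCast, ENNReal.ofReal_pow (abs_nonneg _),
    Real.enorm_eq_ofReal_abs]

/-- The moment bound for the mean of `n` independent centered variables, in terms of Lebesgue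
integrals. -/
theorem lintegral_mean_pow_le [IsProbabilityMeasure P] {n : ℕ} (hn : 0 < n) {Z : Fin n → Ω' → ℝ}
    (hind : iIndepFun Z P) (hmeas : ∀ i, AEMeasurable (Z i) P) (h0 : ∀ i, ∫ x, Z i x ∂P = 0)
    {p : ℕ} (hp : p ≠ 0) {M : ℝ} (hM : 0 < M)
    (hm : ∀ i, ∫⁻ x, ENNReal.ofReal (Z i x ^ (2 * p)) ∂P ≤ ENNReal.ofReal M) :
    ∫⁻ x, ENNReal.ofReal (((n : ℝ)⁻¹ * ∑ i, Z i x) ^ (2 * p)) ∂P ≤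
      ENNReal.ofReal (momentConst p * M / (n : ℝ) ^ p) := by
  have hZ : ∀ i, MemLp (Z i) (2 * p : ℕ) P := fun i =>
    memLp_of_lintegral_pow_le (by omega) ENNReal.ofReal_ne_top (hmeas i)
      (by simpa only [even_pow_abs] using hm i)
  have hS : MemLp (fun x => (n : ℝ)⁻¹ * ∑ i, Z i x) (2 * p : ℕ) P :=
    (memLp_finsetSum _ fun j _ => hZ j).const_mul _
  rw [← ofReal_integral_eq_lintegral_ofReal (MemLp.integrable_pow_of_le hS le_rfl)
    (ae_of_all _ fun x => by simp only [Pi.zero_apply, pow_mul]; positivity)]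
  apply ENNReal.ofReal_le_ofReal
  have hm' : ∀ i, ∫ x, Z i x ^ (2 * p) ∂P ≤ M := fun i => by
    have := hm i
    rwa [← ofReal_integral_eq_lintegral_ofReal (MemLp.integrable_pow_of_le (hZ i) le_rfl)
      (ae_of_all _ fun x => by simp only [Pi.zero_apply, pow_mul]; positivity),
      ENNReal.ofReal_le_ofReal_iff hM.le] at this
  have h := integral_sum_pow_le hind h0 hp hZ hM hm' Finset.univ
  rw [Finset.card_univ, Fintype.card_fin] at h
  simp only [mul_pow, integral_const_mul]
  have hn' : (0 : ℝ) < n := by exact_mod_cast hn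
  calc ((n : ℝ)⁻¹) ^ (2 * p) * ∫ x, (∑ i, Z i x) ^ (2 * p) ∂P
      ≤ ((n : ℝ)⁻¹) ^ (2 * p) * (momentConst p * (n : ℝ) ^ p * M) := by gcongr
    _ = _ := by
      rw [two_mul, pow_add, inv_pow]
      field_simp

end Moments

/-! ### Moments of the noise and of the empirical covariance matrix -/

section PowerBounds

variable {Ω : Type*} [MeasurableSpace Ω] {P : Measure Ω}

theorem add_pow_even_le_two_pow (x y : ℝ) (p : ℕ) :
    (x + y) ^ (2 * p) ≤ 2 ^ (2 * p) * (x ^ (2 * p) + y ^ (2 * p)) := by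
  refine ((even_two_mul p).add_pow_le).trans ?_
  have h1 : 0 ≤ x ^ (2 * p) + y ^ (2 * p) := by
    rw [pow_mul, pow_mul]; positivity
  gcongr
  · norm_num
  · omega

theorem lintegral_pow_le_of_le [IsProbabilityMeasure P] {Z : Ω → ℝ} {N a : ℕ} {η : ℝ}
    (hη : 0 ≤ η) (h : ∫⁻ x, ENNReal.ofReal (|Z x| ^ N) ∂P ≤ ENNReal.ofReal η) (ha : a ≤ N) :
    ∫⁻ x, ENNReal.ofReal (|Z x| ^ a) ∂P ≤ ENNReal.ofReal (1 + η) := by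
  calc ∫⁻ x, ENNReal.ofReal (|Z x| ^ a) ∂P
      ≤ ∫⁻ x, (1 + ENNReal.ofReal (|Z x| ^ N)) ∂P := by
        refine lintegral_mono fun x => ?_
        rw [← ENNReal.ofReal_one, ← ENNReal.ofReal_add zero_le_one (by positivity)]
        exact ENNReal.ofReal_le_ofReal (pow_le_one_add_pow (abs_nonneg _) ha)
    _ = 1 + ∫⁻ x, ENNReal.ofReal (|Z x| ^ N) ∂P := by
        rw [lintegral_add_left measurable_const]; simp
    _ ≤ _ := by
        rw [ENNReal.ofReal_add zero_le_one hη, ENNReal.ofReal_one]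
        gcongr

theorem lintegral_sum_pow_le {ι : Type*} [Fintype ι] {f : ι → Ω → ℝ} (hf : ∀ i x, 0 ≤ f i x)
    (hm : ∀ i, AEMeasurable (f i) P) {p : ℕ} (hp : p ≠ 0) {B : ℝ}
    (h : ∀ i, ∫⁻ x, ENNReal.ofReal (f i x ^ p) ∂P ≤ ENNReal.ofReal B) :
    ∫⁻ x, ENNReal.ofReal ((∑ i, f i x) ^ p) ∂P ≤
      ENNReal.ofReal ((Fintype.card ι : ℝ) ^ p * B) := by
  obtain ⟨q, rfl⟩ := Nat.exists_eq_succ_of_ne_zero hp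
  calc ∫⁻ x, ENNReal.ofReal ((∑ i, f i x) ^ (q + 1)) ∂P
      ≤ ∫⁻ x, ENNReal.ofReal ((Fintype.card ι : ℝ) ^ q) *
          ∑ i, ENNReal.ofReal (f i x ^ (q + 1)) ∂P := by
        refine lintegral_mono fun x => ?_
        rw [← ENNReal.ofReal_sum_of_nonneg fun i _ => pow_nonneg (hf i x) _,
          ← ENNReal.ofReal_mul (by positivity)]
        exact ENNReal.ofReal_le_ofReal (pow_sum_le_card_mul_sum_pow (fun i _ => hf i x) q)
    _ = ENNReal.ofReal ((Fintype.card ι : ℝ) ^ q) *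
          ∑ i, ∫⁻ x, ENNReal.ofReal (f i x ^ (q + 1)) ∂P := by
        rw [lintegral_const_mul' _ _ ENNReal.ofReal_ne_top, lintegral_finsetSum']
        exact fun i _ => ((hm i).pow_const _).ennreal_ofReal
    _ ≤ ENNReal.ofReal ((Fintype.card ι : ℝ) ^ q) * ∑ _i : ι, ENNReal.ofReal B := by
        gcongr with i
        exact h i
    _ = _ := by
        rw [Finset.sum_const, Finset.card_univ, nsmul_eq_mul, ← mul_assoc,
          ENNReal.ofReal_mul (p := (Fintype.card ι : ℝ) ^ (q + 1)) (by positivity), pow_succ,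
          ENNReal.ofReal_mul (p := (Fintype.card ι : ℝ) ^ q) (by positivity),
          ENNReal.ofReal_natCast]

/-- Jensen's inequality for a weighted series. -/
theorem tsum_mul_pow_le (a z : ℕ → ℝ≥0∞) (N : ℕ) (hN : N ≠ 0) :
    (∑' j, a j * z j) ^ N ≤ (∑' j, a j) ^ (N - 1) * ∑' j, a j * z j ^ N := by
  have hN1 : (1 : ℝ) ≤ N := by exact_mod_cast Nat.one_le_iff_ne_zero.2 hN
  have hN0 : (N : ℝ) ≠ 0 := by positivity
  have h1 : ∑' j, a j * z j ≤
      (∑' j, a j) ^ (1 - (N : ℝ)⁻¹) * (∑' j, a j * z j ^ N) ^ ((N : ℝ)⁻¹) := by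
    rw [ENNReal.tsum_eq_iSup_sum]
    refine iSup_le fun s => ?_
    refine (ENNReal.inner_le_weight_mul_Lp_of_nonneg s hN1 a z).trans ?_
    have : (N : ℝ)⁻¹ ≤ 1 := inv_le_one_of_one_le₀ hN1
    simp only [ENNReal.rpow_natCast]
    gcongr
    · exact ENNReal.sum_le_tsum s
    · exact ENNReal.sum_le_tsum s
  refine (pow_le_pow_left₀ (by simp) h1 N).trans_eq ?_
  rw [mul_pow, ← ENNReal.rpow_natCast, ← ENNReal.rpow_natCast, ← ENNReal.rpow_mul,
    ← ENNReal.rpow_mul, inv_mul_cancel₀ hN0, ENNReal.rpow_one, sub_mul, inv_mul_cancel₀ hN0,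
    one_mul, ← Nat.cast_one (R := ℝ), ← Nat.cast_sub (Nat.one_le_iff_ne_zero.2 hN),
    ENNReal.rpow_natCast]

end PowerBounds

section Covariance

instance instSecondCountableTopologyL2I : SecondCountableTopology L2I := by
  have : Fact ((2 : ℝ≥0∞) ≠ ∞) := ⟨by simp⟩
  exact Lp.SecondCountableTopology

variable {Ω : Type*} [MeasurableSpace Ω] {P : Measure Ω} {X : Ω → L2I}
  {ψ : HilbertBasis ℕ ℝ L2I} {m : ℕ}

theorem inner_covOp (hX : MemLp X 2 P) (f g : L2I) :
    ⟪covOp P X f, g⟫ = ∫ ω, ⟪X ω, f⟫ * ⟪X ω, g⟫ ∂P := by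
  have hm := hX.1.aemeasurable
  have hid : MemLp id 2 (P.map X) :=
    (memLp_map_measure_iff aestronglyMeasurable_id hm).2 hX
  rw [covOp, covarianceOperator_inner hid, integral_map hm]
  · simp only [real_inner_comm]
  · fun_prop

/-- The function `∑ₐ R_{ja} ψₐ`, whose inner product with `X` is the `j`-th standardized
coordinate of `X` when `R` is the inverse square root of the covariance matrix. -/
noncomputable def stdFun (ψ : HilbertBasis ℕ ℝ L2I) (R : Matrix (Fin m) (Fin m) ℝ) (j : Fin m) :
    L2I :=
  ∑ a, R j a • ψ a

theorem stdFun_mem (R : Matrix (Fin m) (Fin m) ℝ) (j : Fin m) :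
    stdFun ψ R j ∈ basisSpan ψ m :=
  sum_smul_mem_basisSpan _

theorem mulVec_truncVec (R : Matrix (Fin m) (Fin m) ℝ) (f : L2I) (j : Fin m) :
    (R *ᵥ truncVec ψ m f) j = ⟪f, stdFun ψ R j⟫ :=
  dotProduct_truncVec (R j) f

theorem mul_truncMatrix_mul {R : Matrix (Fin m) (Fin m) ℝ} (hR : Rᵀ = R) (T : L2I →L[ℝ] L2I)
    (j l : Fin m) :
    (R * truncMatrix ψ m T * R) j l = ⟪T (stdFun ψ R l), stdFun ψ R j⟫ := by
  rw [← mulVec_truncVec, stdFun, ← truncMatrix_mulVec, Matrix.mulVec_mulVec]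
  conv_lhs => rw [← hR, hR]
  rw [Matrix.mul_apply, Matrix.mulVec, dotProduct]
  refine Finset.sum_congr rfl fun a _ => ?_
  conv_lhs => rw [← hR, Matrix.transpose_apply, hR]

theorem inner_gammaHat {n : ℕ} (D : Fin n → ℝ × L2I) (f g : L2I) :
    ⟪gammaHat D f, g⟫ = (n : ℝ)⁻¹ * ∑ i, ⟪(D i).2, f⟫ * ⟪(D i).2, g⟫ := by
  simp [gammaHat, inner_smul_left, sum_inner]

theorem inner_gHat {n : ℕ} (D : Fin n → ℝ × L2I) (g : L2I) :
    ⟪gHat D, g⟫ = (n : ℝ)⁻¹ * ∑ i, (D i).1 * ⟪(D i).2, g⟫ := by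
  simp [gHat, inner_smul_left, sum_inner]

/-- Moments of `‖X‖`, from those of the standardized coordinates: `‖X‖²` is the series of the
squares of these coordinates with the summable weights `⟪Γ ψ_j, ψ_j⟫ ≤ d υ_j`. -/
theorem lintegral_norm_pow_le {υ : ℕ → ℝ} {d M : ℝ} (hX : AEMeasurable X P)
    (hd : 0 ≤ d) (hυ : ∀ j, 0 < υ j) (hs : Summable υ) (hΓ : DiagComparable ψ υ d (covOp P X))
    {p : ℕ} (hp : p ≠ 0)
    (hM : ∀ j, ∫⁻ ω, ENNReal.ofReal (|⟪X ω, ψ j⟫ / √⟪covOp P X (ψ j), ψ j⟫| ^ (2 * p)) ∂P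
      ≤ ENNReal.ofReal M) :
    ∫⁻ ω, ENNReal.ofReal (‖X ω‖ ^ (2 * p)) ∂P ≤ ENNReal.ofReal ((d * ∑' j, υ j) ^ p * M) := by
  set t : ℕ → ℝ := fun j => ⟪covOp P X (ψ j), ψ j⟫
  have ht : ∀ j, 0 < t j := fun j => hΓ.pos _ (fun h => by
    have := ψ.orthonormal.1 j
    rw [h, norm_zero] at this
    exact zero_ne_one this)
  have htd : ∀ j, t j ≤ d * υ j := fun j => by
    have h1 := hΓ.inner_le (ψ j)
    rw [inner_diagOp_basis ψ hs, real_inner_self_eq_norm_sq, ψ.orthonormal.1] at h1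
    simpa using h1
  have hsum : ∑' j, ENNReal.ofReal (t j) ≤ ENNReal.ofReal (d * ∑' j, υ j) := by
    rw [← tsum_mul_left, ENNReal.ofReal_tsum_of_nonneg (fun j => mul_nonneg hd (hυ j).le)
      (hs.mul_left d)]
    exact ENNReal.tsum_le_tsum fun j => ENNReal.ofReal_le_ofReal (htd j)
  set z : ℕ → Ω → ℝ := fun j ω => (⟪X ω, ψ j⟫ / √(t j)) ^ 2
  have hnorm : ∀ ω, ENNReal.ofReal (‖X ω‖ ^ 2) =
      ∑' j, ENNReal.ofReal (t j) * ENNReal.ofReal (z j ω) := fun ω => by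
    rw [← (hasSum_inner_sq ψ (X ω)).tsum_eq,
      ENNReal.ofReal_tsum_of_nonneg (fun _ => sq_nonneg _) (hasSum_inner_sq ψ (X ω)).summable]
    refine tsum_congr fun j => ?_
    rw [← ENNReal.ofReal_mul (ht j).le]
    congr 1
    have := ht j
    simp only [z]
    rw [div_pow, Real.sq_sqrt this.le]
    field_simp
  have hzm : ∀ j, AEMeasurable (z j) P := fun j => by
    have h1 : Measurable fun x : L2I => (⟪x, ψ j⟫ / √(t j)) ^ 2 :=
      (by fun_prop : Continuous fun x : L2I => (⟪x, ψ j⟫ / √(t j)) ^ 2).measurable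
    exact h1.comp_aemeasurable hX
  calc ∫⁻ ω, ENNReal.ofReal (‖X ω‖ ^ (2 * p)) ∂P
      ≤ ∫⁻ ω, (∑' j, ENNReal.ofReal (t j)) ^ (p - 1) *
          ∑' j, ENNReal.ofReal (t j) * ENNReal.ofReal (z j ω) ^ p ∂P := by
        refine lintegral_mono fun ω => ?_
        rw [pow_mul, ENNReal.ofReal_pow (sq_nonneg _), hnorm]
        exact tsum_mul_pow_le _ _ p hp
    _ = (∑' j, ENNReal.ofReal (t j)) ^ (p - 1) *
          ∑' j, ENNReal.ofReal (t j) * ∫⁻ ω, ENNReal.ofReal (z j ω) ^ p ∂P := by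
        rw [lintegral_const_mul' _ _ (ENNReal.pow_ne_top (hsum.trans_lt ENNReal.ofReal_lt_top).ne),
          lintegral_tsum fun j => ((hzm j).ennreal_ofReal.pow_const p).const_mul _]
        simp only [lintegral_const_mul' _ _ ENNReal.ofReal_ne_top]
    _ ≤ (∑' j, ENNReal.ofReal (t j)) ^ (p - 1) *
          ∑' j, ENNReal.ofReal (t j) * ENNReal.ofReal M := by
        gcongr with j
        refine le_trans (le_of_eq ?_) (hM j)
        refine lintegral_congr fun ω => ?_
        rw [even_pow_abs, pow_mul, ENNReal.ofReal_pow (sq_nonneg _)]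
    _ = (∑' j, ENNReal.ofReal (t j)) ^ p * ENNReal.ofReal M := by
        rw [ENNReal.tsum_mul_right, ← mul_assoc, ← pow_succ, Nat.sub_add_cancel (by omega)]
    _ ≤ ENNReal.ofReal (d * ∑' j, υ j) ^ p * ENNReal.ofReal M := by gcongr
    _ = _ := by
        have : 0 ≤ ∑' j, υ j := tsum_nonneg fun j => (hυ j).le
        rw [← ENNReal.ofReal_pow (by positivity), ← ENNReal.ofReal_mul (by positivity)]

end Covariance

section Sample

variable {Ω Ω' : Type*} [MeasurableSpace Ω] [MeasurableSpace Ω'] {P : Measure Ω}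
  {P' : Measure Ω'} [IsProbabilityMeasure P'] {X : Ω → L2I} {ε : Ω → ℝ}
  {ψ : HilbertBasis ℕ ℝ L2I} {m n : ℕ} {Xs : Fin n → Ω' → L2I} {εs : Fin n → Ω' → ℝ}

/-- Moments of the sample mean of a centered function of the regressor and the error. -/
theorem sample_mean_pow_le (hS : IsSample P X ε P' Xs εs) (hn : 0 < n) {φ : L2I × ℝ → ℝ}
    (hφ : Measurable φ) (h0 : ∫ ω, φ (X ω, ε ω) ∂P = 0) {p : ℕ} (hp : p ≠ 0) {M : ℝ}
    (hM : 0 < M) (hm : ∫⁻ ω, ENNReal.ofReal (φ (X ω, ε ω) ^ (2 * p)) ∂P ≤ ENNReal.ofReal M) :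
    ∫⁻ ω', ENNReal.ofReal (((n : ℝ)⁻¹ * ∑ i, φ (Xs i ω', εs i ω')) ^ (2 * p)) ∂P' ≤
      ENNReal.ofReal (momentConst p * M / (n : ℝ) ^ p) := by
  have hid : ∀ i, IdentDistrib (fun ω' => φ (Xs i ω', εs i ω')) (fun ω => φ (X ω, ε ω)) P' P :=
    fun i => (hS.identDistrib i).comp hφ
  refine lintegral_mean_pow_le (Z := fun i ω' => φ (Xs i ω', εs i ω')) hn
    (hS.indep.comp (fun _ => φ) (fun _ => hφ)) (fun i => (hid i).aemeasurable_fst)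
    (fun i => (hid i).integral_eq.trans h0) hp hM fun i => ?_
  have h := ((hid i).comp (u := fun t : ℝ => ENNReal.ofReal (t ^ (2 * p)))
    (by fun_prop)).lintegral_eq
  exact h.trans_le hm

theorem measurable_inner_left (r : L2I) : Measurable fun x : L2I => ⟪x, r⟫ :=
  (by fun_prop : Continuous fun x : L2I => ⟪x, r⟫).measurable

theorem memLp_inner (hX : MemLp X 2 P) (r : L2I) : MemLp (fun ω => ⟪X ω, r⟫) 2 P :=
  hX.inner_const r

theorem integrable_inner_mul_inner (hX : MemLp X 2 P) (f g : L2I) :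
    Integrable (fun ω => ⟪X ω, f⟫ * ⟪X ω, g⟫) P :=
  (memLp_inner hX f).integrable_mul (memLp_inner hX g)

variable {υ : ℕ → ℝ} {d : ℝ}

theorem integral_std_mul_std (hX : MemLp X 2 P) (hΓ : DiagComparable ψ υ d (covOp P X))
    (j l : Fin m) :
    ∫ ω, ⟪X ω, stdFun ψ (invSqrt (truncMatrix ψ m (covOp P X))) l⟫ *
      ⟪X ω, stdFun ψ (invSqrt (truncMatrix ψ m (covOp P X))) j⟫ ∂P =
        (1 : Matrix (Fin m) (Fin m) ℝ) j l := by
  have h := isInvSqrt_truncMatrix (m := m) hΓ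
  rw [← inner_covOp hX, ← mul_truncMatrix_mul h.symm_R, h.mul_mul]

/-- Moments of the relative deviation of the empirical covariance matrix. -/
theorem lintegral_relDev_pow_le [IsProbabilityMeasure P] (hX : MemLp X 2 P)
    (hΓ : DiagComparable ψ υ d (covOp P X))
    (hS : IsSample P X ε P' Xs εs) (hn : 0 < n) {k p : ℕ} (hp : p ≠ 0) (hpk : p ≤ k) {η : ℝ}
    (hη : 1 ≤ η)
    (hmom : ∀ j : Fin m, ∫⁻ ω, ENNReal.ofReal
      (|(invSqrt (truncMatrix ψ m (covOp P X)) *ᵥ truncVec ψ m (X ω)) j| ^ (4 * k)) ∂P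
        ≤ ENNReal.ofReal η) (β : L2I) (σ : ℝ) :
    AEMeasurable (fun ω' => relDev (invSqrt (truncMatrix ψ m (covOp P X))) (truncMatrix ψ m
        (gammaHat (observations β σ (fun i => Xs i ω') (fun i => εs i ω'))))) P' ∧
    ∫⁻ ω', ENNReal.ofReal (relDev (invSqrt (truncMatrix ψ m (covOp P X))) (truncMatrix ψ m
        (gammaHat (observations β σ (fun i => Xs i ω') (fun i => εs i ω')))) ^ p) ∂P' ≤
      ENNReal.ofReal ((5 * 4 ^ p * momentConst p) * η * ((m : ℝ) ^ 2 / n) ^ p) := by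
  set R := invSqrt (truncMatrix ψ m (covOp P X))
  have hR : Rᵀ = R := (isInvSqrt_truncMatrix (m := m) hΓ).symm_R
  set one : Matrix (Fin m) (Fin m) ℝ := 1
  have hn' : (n : ℝ) ≠ 0 := by exact_mod_cast hn.ne'
  let φ : Fin m × Fin m → L2I × ℝ → ℝ := fun q x =>
    ⟪x.1, stdFun ψ R q.2⟫ * ⟪x.1, stdFun ψ R q.1⟫ - one q.1 q.2
  have hφ : ∀ q, Measurable (φ q) := fun q =>
    (((measurable_inner_left _).comp measurable_fst).mul
      ((measurable_inner_left _).comp measurable_fst)).sub_const _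
  have hrel : ∀ ω', relDev R (truncMatrix ψ m
      (gammaHat (observations β σ (fun i => Xs i ω') (fun i => εs i ω')))) =
        ∑ q : Fin m × Fin m, ((n : ℝ)⁻¹ * ∑ i, φ q (Xs i ω', εs i ω')) ^ 2 := fun ω' => by
    rw [relDev, Fintype.sum_prod_type]
    refine Finset.sum_congr rfl fun j _ => Finset.sum_congr rfl fun l _ => ?_
    rw [Matrix.sub_apply, mul_truncMatrix_mul hR, inner_gammaHat]
    simp only [φ, observations, Finset.sum_sub_distrib, Finset.sum_const, Finset.card_univ,
      Fintype.card_fin, nsmul_eq_mul, mul_sub, inv_mul_cancel_left₀ hn']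
    rfl
  have hmom' : ∀ j : Fin m, ∫⁻ ω, ENNReal.ofReal (|⟪X ω, stdFun ψ R j⟫| ^ (4 * p)) ∂P
      ≤ ENNReal.ofReal (1 + η) := fun j => by
    refine lintegral_pow_le_of_le (N := 4 * k) (by linarith) ?_ (by omega)
    simpa only [mulVec_truncVec] using hmom j
  have hmean : ∀ q, ∫ ω, φ q (X ω, ε ω) ∂P = 0 := fun q => by
    simp only [φ]
    rw [integral_sub (integrable_inner_mul_inner hX _ _) (integrable_const _),
      integral_std_mul_std hX hΓ]
    simp [one]
  have hM : ∀ q, ∫⁻ ω, ENNReal.ofReal (φ q (X ω, ε ω) ^ (2 * p)) ∂P ≤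
      ENNReal.ofReal (4 ^ p * (5 * η)) := fun q => by
    have hpt : ∀ ω, φ q (X ω, ε ω) ^ (2 * p) ≤ 4 ^ p * (|⟪X ω, stdFun ψ R q.2⟫| ^ (4 * p) +
        |⟪X ω, stdFun ψ R q.1⟫| ^ (4 * p) + 1) := fun ω => by
      have h1 := add_pow_even_le_two_pow (⟪X ω, stdFun ψ R q.2⟫ * ⟪X ω, stdFun ψ R q.1⟫)
        (-one q.1 q.2) p
      rw [← sub_eq_add_neg, pow_mul (2 : ℝ)] at h1
      norm_num at h1
      refine h1.trans ?_
      gcongr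
      · have := pow_mul_pow_le_add (abs_nonneg ⟪X ω, stdFun ψ R q.2⟫)
          (abs_nonneg ⟪X ω, stdFun ψ R q.1⟫) (2 * p) (2 * p)
        rw [even_pow_abs, even_pow_abs, ← mul_pow, ← two_mul, ← mul_assoc] at this
        exact this
      · simp only [Matrix.one_apply]
        split_ifs
        · simp
        · simp [hp]
    calc ∫⁻ ω, ENNReal.ofReal (φ q (X ω, ε ω) ^ (2 * p)) ∂P
        ≤ ∫⁻ ω, ENNReal.ofReal (4 ^ p) * (ENNReal.ofReal (|⟪X ω, stdFun ψ R q.2⟫| ^ (4 * p)) +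
            ENNReal.ofReal (|⟪X ω, stdFun ψ R q.1⟫| ^ (4 * p)) + 1) ∂P := by
          refine lintegral_mono fun ω => ?_
          rw [← ENNReal.ofReal_one, ← ENNReal.ofReal_add (by positivity) (by positivity),
            ← ENNReal.ofReal_add (by positivity) (by positivity),
            ← ENNReal.ofReal_mul (by positivity)]
          exact ENNReal.ofReal_le_ofReal (hpt ω)
      _ = ENNReal.ofReal (4 ^ p) * (∫⁻ ω, ENNReal.ofReal (|⟪X ω, stdFun ψ R q.2⟫| ^ (4 * p)) ∂P +
            ∫⁻ ω, ENNReal.ofReal (|⟪X ω, stdFun ψ R q.1⟫| ^ (4 * p)) ∂P + 1) := by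
          have hms : ∀ r : L2I, AEMeasurable
              (fun ω => ENNReal.ofReal (|⟪X ω, r⟫| ^ (4 * p))) P := fun r => by
            have h1 : Measurable fun t : ℝ => ENNReal.ofReal (|t| ^ (4 * p)) := by fun_prop
            exact h1.comp_aemeasurable (memLp_inner hX r).1.aemeasurable
          rw [lintegral_const_mul' _ _ ENNReal.ofReal_ne_top,
            lintegral_add_right' _ aemeasurable_const, lintegral_add_left' (hms _)]
          simp
      _ ≤ ENNReal.ofReal (4 ^ p) * (ENNReal.ofReal (1 + η) + ENNReal.ofReal (1 + η) +
            ENNReal.ofReal 1) := by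
          rw [ENNReal.ofReal_one]
          gcongr
          · exact hmom' _
          · exact hmom' _
      _ ≤ _ := by
          rw [← ENNReal.ofReal_add (by positivity) (by positivity),
            ← ENNReal.ofReal_add (by positivity) (by positivity),
            ← ENNReal.ofReal_mul (by positivity)]
          apply ENNReal.ofReal_le_ofReal
          gcongr
          linarith
  simp only [hrel]
  have hmeas : ∀ q, AEMeasurable
      (fun ω' => ((n : ℝ)⁻¹ * ∑ i, φ q (Xs i ω', εs i ω')) ^ 2) P' := fun q =>
    ((Finset.aemeasurable_fun_sum _ fun i _ => (hφ q).comp_aemeasurable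
      (hS.identDistrib i).aemeasurable_fst).const_mul _).pow_const 2
  refine ⟨Finset.aemeasurable_fun_sum _ fun q _ => hmeas q, ?_⟩
  refine (lintegral_sum_pow_le (fun q ω' => sq_nonneg _) hmeas hp
    (B := momentConst p * (4 ^ p * (5 * η)) / (n : ℝ) ^ p) fun q => ?_).trans_eq ?_
  · have := sample_mean_pow_le hS hn (hφ q) (hmean q) hp (by positivity) (hM q)
    simpa only [← pow_mul] using this
  · congr 1
    rw [Fintype.card_prod, Fintype.card_fin, div_pow]
    push_cast
    ring

theorem mul_add_pow_eight_le {V : ℝ} (hV : 0 < V) (a b t : ℝ) :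
    ((a + b) * t) ^ (2 * 4) ≤ 2 ^ 16 / V ^ 4 * (a ^ 16 + b ^ 16) + V ^ 4 * t ^ 16 := by
  have h1 := pow_mul_pow_le_add (show 0 ≤ (a + b) ^ 2 / V by positivity) (sq_nonneg t) 4 4
  have h3 : (a + b) ^ 16 ≤ 2 ^ 16 * (a ^ 16 + b ^ 16) := add_pow_even_le_two_pow a b 8
  have h4 : ((a + b) * t) ^ (2 * 4) = V ^ 4 * (((a + b) ^ 2 / V) ^ 4 * (t ^ 2) ^ 4) := by
    generalize a + b = u
    field_simp
    ring
  have h5 : V ^ 4 * (((a + b) ^ 2 / V) ^ 8 + (t ^ 2) ^ 8) =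
      (a + b) ^ 16 / V ^ 4 + V ^ 4 * t ^ 16 := by
    generalize a + b = u
    field_simp
  norm_num only at h1
  rw [h4]
  refine (mul_le_mul_of_nonneg_left h1 (by positivity)).trans ?_
  rw [h5, div_mul_eq_mul_div]
  gcongr

/-- Moments of the standardized noise `R [ĝ - Γ̂ e]`, where `e` is the Galerkin projection of `β`
and `V` bounds the variance scale of the residual response `⟪X, β - e⟫ + σ ε`. -/
theorem lintegral_noise_pow_le [IsProbabilityMeasure P] (hX : MemLp X 2 P) (hd : 1 ≤ d)
    (hυ : ∀ j, 0 < υ j)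
    (hs : Summable υ) (hΓ : DiagComparable ψ υ d (covOp P X))
    (hS : IsSample P X ε P' Xs εs) (hn : 0 < n) {k : ℕ} (hk : 4 ≤ k) {η : ℝ} (hη : 1 ≤ η)
    (hmom : ∀ j : Fin m, ∫⁻ ω, ENNReal.ofReal
      (|(invSqrt (truncMatrix ψ m (covOp P X)) *ᵥ truncVec ψ m (X ω)) j| ^ (4 * k)) ∂P
        ≤ ENNReal.ofReal η)
    (hcoord : ∀ j, ∫⁻ ω, ENNReal.ofReal
      (|⟪X ω, ψ j⟫ / √⟪covOp P X (ψ j), ψ j⟫| ^ (4 * k)) ∂P ≤ ENNReal.ofReal η)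
    (hε : ErrorClass (4 * k) η P ε) (hεX : ∫ ω, ε ω • X ω ∂P = 0) {β e : L2I} {σ V : ℝ}
    (hgal : ∀ s ∈ basisSpan ψ m, ⟪covOp P X (β - e), s⟫ = 0)
    (hV : 0 < V) (hVσ : σ ^ 2 ≤ V) (hVβ : ‖β - e‖ ^ 2 * (d * ∑' j, υ j) ≤ V) :
    AEMeasurable (fun ω' =>
        invSqrt (truncMatrix ψ m (covOp P X)) *ᵥ truncVec ψ m
          (gHat (observations β σ (fun i => Xs i ω') (fun i => εs i ω')) -
            gammaHat (observations β σ (fun i => Xs i ω') (fun i => εs i ω')) e) ⬝ᵥ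
        invSqrt (truncMatrix ψ m (covOp P X)) *ᵥ truncVec ψ m
          (gHat (observations β σ (fun i => Xs i ω') (fun i => εs i ω')) -
            gammaHat (observations β σ (fun i => Xs i ω') (fun i => εs i ω')) e)) P' ∧
    ∫⁻ ω', ENNReal.ofReal (
        (invSqrt (truncMatrix ψ m (covOp P X)) *ᵥ truncVec ψ m
          (gHat (observations β σ (fun i => Xs i ω') (fun i => εs i ω')) -
            gammaHat (observations β σ (fun i => Xs i ω') (fun i => εs i ω')) e) ⬝ᵥ
        invSqrt (truncMatrix ψ m (covOp P X)) *ᵥ truncVec ψ m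
          (gHat (observations β σ (fun i => Xs i ω') (fun i => εs i ω')) -
            gammaHat (observations β σ (fun i => Xs i ω') (fun i => εs i ω')) e)) ^ 4) ∂P' ≤
      ENNReal.ofReal ((2 ^ 19 * momentConst 4) * η * (m * V / n) ^ 4) := by
  set R := invSqrt (truncMatrix ψ m (covOp P X))
  set f := β - e
  let φ : Fin m → L2I × ℝ → ℝ := fun j x => (⟪x.1, f⟫ + σ * x.2) * ⟪x.1, stdFun ψ R j⟫
  have hφ : ∀ j, Measurable (φ j) := fun j =>
    (((measurable_inner_left _).comp measurable_fst).add (measurable_snd.const_mul σ)).mul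
      ((measurable_inner_left _).comp measurable_fst)
  have hrel : ∀ ω', (R *ᵥ truncVec ψ m
          (gHat (observations β σ (fun i => Xs i ω') (fun i => εs i ω')) -
            gammaHat (observations β σ (fun i => Xs i ω') (fun i => εs i ω')) e) ⬝ᵥ
        R *ᵥ truncVec ψ m
          (gHat (observations β σ (fun i => Xs i ω') (fun i => εs i ω')) -
            gammaHat (observations β σ (fun i => Xs i ω') (fun i => εs i ω')) e)) =
      ∑ j, ((n : ℝ)⁻¹ * ∑ i, φ j (Xs i ω', εs i ω')) ^ 2 := fun ω' => by
    rw [dotProduct]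
    refine Finset.sum_congr rfl fun j _ => ?_
    rw [← sq, mulVec_truncVec, inner_sub_left, inner_gHat, inner_gammaHat, ← mul_sub,
      ← Finset.sum_sub_distrib]
    congr 2
    refine Finset.sum_congr rfl fun i _ => ?_
    simp only [φ, f, observations, inner_sub_right, real_inner_comm β]
    ring
  -- Both parts are centered: the first by the Galerkin equations, the second by `E[ε X] = 0`.
  have hmean : ∀ j, ∫ ω, φ j (X ω, ε ω) ∂P = 0 := fun j => by
    have hI2 : Integrable (fun ω => ε ω • X ω) P :=
      memLp_one_iff_integrable.1 (hX.smul hε.memLp)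
    have h2 : ∫ ω, ε ω * ⟪X ω, stdFun ψ R j⟫ ∂P = 0 := by
      have := integral_inner (𝕜 := ℝ) hI2 (stdFun ψ R j)
      rw [hεX, inner_zero_right] at this
      refine Eq.trans ?_ this
      refine integral_congr_ae (ae_of_all _ fun ω => ?_)
      simp only [inner_smul_right, real_inner_comm (X ω)]
    have hI3 : Integrable (fun ω => ε ω * ⟪X ω, stdFun ψ R j⟫) P :=
      hε.memLp.integrable_mul (memLp_inner hX _)
    calc ∫ ω, φ j (X ω, ε ω) ∂P
        = ∫ ω, (⟪X ω, f⟫ * ⟪X ω, stdFun ψ R j⟫ + σ * (ε ω * ⟪X ω, stdFun ψ R j⟫)) ∂P := by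
          refine integral_congr_ae (ae_of_all _ fun ω => ?_)
          simp only [φ]; ring
      _ = 0 := by
          rw [integral_add (integrable_inner_mul_inner hX _ _) (hI3.const_mul _),
            integral_const_mul, h2, ← inner_covOp hX, hgal _ (stdFun_mem R j)]
          simp
  have hmom' : ∀ j : Fin m, ∫⁻ ω, ENNReal.ofReal (|⟪X ω, stdFun ψ R j⟫| ^ 16) ∂P
      ≤ ENNReal.ofReal (1 + η) := fun j => by
    refine lintegral_pow_le_of_le (N := 4 * k) (by linarith) ?_ (by omega)
    simpa only [mulVec_truncVec] using hmom j
  have hε16 : ∫⁻ ω, ENNReal.ofReal (|ε ω| ^ 16) ∂P ≤ ENNReal.ofReal (1 + η) :=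
    lintegral_pow_le_of_le (by linarith) hε.moment (by omega)
  have hX16 : ∫⁻ ω, ENNReal.ofReal (‖X ω‖ ^ 16) ∂P ≤
      ENNReal.ofReal ((d * ∑' j, υ j) ^ 8 * (1 + η)) :=
    lintegral_norm_pow_le (p := 8) hX.1.aemeasurable (by linarith) hυ hs hΓ (by norm_num)
      fun j => lintegral_pow_le_of_le (by linarith) (hcoord j) (by omega)
  have hΛ : 0 ≤ ∑' j, υ j := tsum_nonneg fun j => (hυ j).le
  have hM : ∀ j, ∫⁻ ω, ENNReal.ofReal (φ j (X ω, ε ω) ^ (2 * 4)) ∂P ≤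
      ENNReal.ofReal (2 ^ 19 * V ^ 4 * η) := fun j => by
    have hpt : ∀ ω, φ j (X ω, ε ω) ^ (2 * 4) ≤ 2 ^ 16 / V ^ 4 * ‖f‖ ^ 16 * ‖X ω‖ ^ 16 +
        2 ^ 16 / V ^ 4 * σ ^ 16 * |ε ω| ^ 16 + V ^ 4 * |⟪X ω, stdFun ψ R j⟫| ^ 16 := fun ω => by
      have h4 : ⟪X ω, f⟫ ^ 16 ≤ ‖f‖ ^ 16 * ‖X ω‖ ^ 16 := by
        rw [← (by decide : Even 16).pow_abs, ← mul_pow, mul_comm]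
        exact pow_le_pow_left₀ (abs_nonneg _) (abs_real_inner_le_norm _ _) _
      refine (mul_add_pow_eight_le hV ⟪X ω, f⟫ (σ * ε ω) ⟪X ω, stdFun ψ R j⟫).trans ?_
      rw [(by decide : Even 16).pow_abs, (by decide : Even 16).pow_abs]
      have h5 := mul_le_mul_of_nonneg_left h4 (show 0 ≤ 2 ^ 16 / V ^ 4 by positivity)
      rw [mul_pow]
      linarith
    have hmX : AEMeasurable (fun ω => ENNReal.ofReal (‖X ω‖ ^ 16)) P :=
      (hX.1.aemeasurable.norm.pow_const _).ennreal_ofReal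
    have hmε : AEMeasurable (fun ω => ENNReal.ofReal (|ε ω| ^ 16)) P := by
      have h1 : Measurable fun t : ℝ => ENNReal.ofReal (|t| ^ 16) := by fun_prop
      exact h1.comp_aemeasurable hε.aemeasurable
    calc ∫⁻ ω, ENNReal.ofReal (φ j (X ω, ε ω) ^ (2 * 4)) ∂P
        ≤ ∫⁻ ω, (ENNReal.ofReal (2 ^ 16 / V ^ 4 * ‖f‖ ^ 16) * ENNReal.ofReal (‖X ω‖ ^ 16) +
            ENNReal.ofReal (2 ^ 16 / V ^ 4 * σ ^ 16) * ENNReal.ofReal (|ε ω| ^ 16) +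
            ENNReal.ofReal (V ^ 4) * ENNReal.ofReal (|⟪X ω, stdFun ψ R j⟫| ^ 16)) ∂P := by
          refine lintegral_mono fun ω => ?_
          have hσ : 0 ≤ σ ^ 16 := (by decide : Even 16).pow_nonneg σ
          rw [← ENNReal.ofReal_mul (by positivity), ← ENNReal.ofReal_mul (by positivity),
            ← ENNReal.ofReal_mul (by positivity), ← ENNReal.ofReal_add (by positivity)
            (by positivity), ← ENNReal.ofReal_add (by positivity) (by positivity)]
          exact ENNReal.ofReal_le_ofReal (hpt ω)
      _ = ENNReal.ofReal (2 ^ 16 / V ^ 4 * ‖f‖ ^ 16) * ∫⁻ ω, ENNReal.ofReal (‖X ω‖ ^ 16) ∂P +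
            ENNReal.ofReal (2 ^ 16 / V ^ 4 * σ ^ 16) * ∫⁻ ω, ENNReal.ofReal (|ε ω| ^ 16) ∂P +
            ENNReal.ofReal (V ^ 4) *
              ∫⁻ ω, ENNReal.ofReal (|⟪X ω, stdFun ψ R j⟫| ^ 16) ∂P := by
          have hsum : AEMeasurable (fun ω =>
              ENNReal.ofReal (2 ^ 16 / V ^ 4 * ‖f‖ ^ 16) * ENNReal.ofReal (‖X ω‖ ^ 16) +
                ENNReal.ofReal (2 ^ 16 / V ^ 4 * σ ^ 16) * ENNReal.ofReal (|ε ω| ^ 16)) P :=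
            (hmX.const_mul _).add (hmε.const_mul _)
          rw [lintegral_add_left' hsum, lintegral_add_left' (hmX.const_mul _),
            lintegral_const_mul' _ _ ENNReal.ofReal_ne_top,
            lintegral_const_mul' _ _ ENNReal.ofReal_ne_top,
            lintegral_const_mul' _ _ ENNReal.ofReal_ne_top]
      _ ≤ ENNReal.ofReal (2 ^ 16 / V ^ 4 * ‖f‖ ^ 16) *
              ENNReal.ofReal ((d * ∑' j, υ j) ^ 8 * (1 + η)) +
            ENNReal.ofReal (2 ^ 16 / V ^ 4 * σ ^ 16) * ENNReal.ofReal (1 + η) +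
            ENNReal.ofReal (V ^ 4) * ENNReal.ofReal (1 + η) := by
          gcongr
          exact hmom' j
      _ ≤ _ := by
          have hσ : 0 ≤ σ ^ 16 := (by decide : Even 16).pow_nonneg σ
          have hd0 : 0 ≤ d := by linarith
          rw [← ENNReal.ofReal_mul (by positivity), ← ENNReal.ofReal_mul (by positivity),
            ← ENNReal.ofReal_mul (by positivity), ← ENNReal.ofReal_add (by positivity)
            (by positivity), ← ENNReal.ofReal_add (by positivity) (by positivity)]
          apply ENNReal.ofReal_le_ofReal
          have h1 : (‖f‖ ^ 2 * (d * ∑' j, υ j)) ^ 8 ≤ V ^ 8 := by gcongr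
          have h2 : (σ ^ 2) ^ 8 ≤ V ^ 8 := by gcongr
          calc _ = 2 ^ 16 / V ^ 4 * (‖f‖ ^ 2 * (d * ∑' j, υ j)) ^ 8 * (1 + η) +
                2 ^ 16 / V ^ 4 * (σ ^ 2) ^ 8 * (1 + η) + V ^ 4 * (1 + η) := by ring
            _ ≤ 2 ^ 16 / V ^ 4 * V ^ 8 * (η + η) + 2 ^ 16 / V ^ 4 * V ^ 8 * (η + η) +
                V ^ 4 * (η + η) := by gcongr
            _ = (2 ^ 18 + 2) * V ^ 4 * η := by field_simp; ring
            _ ≤ _ := by gcongr; norm_num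
  simp only [hrel]
  have hmeas : ∀ q, AEMeasurable
      (fun ω' => ((n : ℝ)⁻¹ * ∑ i, φ q (Xs i ω', εs i ω')) ^ 2) P' := fun q =>
    ((Finset.aemeasurable_fun_sum _ fun i _ => (hφ q).comp_aemeasurable
      (hS.identDistrib i).aemeasurable_fst).const_mul _).pow_const 2
  refine ⟨Finset.aemeasurable_fun_sum _ fun q _ => hmeas q, ?_⟩
  refine (lintegral_sum_pow_le (fun q ω' => sq_nonneg _) hmeas (by norm_num)
    (B := momentConst 4 * (2 ^ 19 * V ^ 4 * η) / (n : ℝ) ^ 4) fun q => ?_).trans_eq ?_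
  · have := sample_mean_pow_le hS hn (hφ q) (hmean q) (p := 4) (by norm_num) (by positivity)
      (hM q)
    simpa only [← pow_mul] using this
  · congr 1
    rw [Fintype.card_fin, div_pow]
    ring

end Sample

/-! ### The upper bound -/

section Upper

theorem mul_mul_le_sq_add_pow_four {x y z : ℝ} :
    x * y * z ≤ x ^ 2 + y ^ 4 + z ^ 4 := by
  nlinarith [sq_nonneg (x - y * z), sq_nonneg (y ^ 2 - z ^ 2), sq_nonneg x, sq_nonneg (y ^ 2),
    sq_nonneg (z ^ 2)]

/-- Linearization of the stochastic part of the loss, with `q` the squared norm of the noise, `F`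
the relative deviation of the covariance matrix, `f` and `v` the typical magnitudes of `F` and `q`,
and `p` that of the square root of the probability of `1 / 4 < F`. The product of three factors is
linearized by `x y z ≤ x² + y⁴ + z⁴`, in place of Hölder's inequality. -/
theorem loss_linearization {F q p f v a G ρ : ℝ} {k : ℕ} (hF : 0 ≤ F) (hq : 0 ≤ q) (hp : 0 < p)
    (hf : 0 < f) (hv : 0 < v) (ha : 0 ≤ a) (hG : 0 ≤ G) (hρ : 0 ≤ ρ) {χ : ℝ}
    (hχ : χ = if 1 / 4 < F then 1 else 0) :
    a * q + G * (χ * F * q) + ρ * χ ≤ a * v + (G * p * f * v * 4 ^ k / p ^ 2 + ρ * 4 ^ k) * F ^ k +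
      G * p * f * v / f ^ 4 * F ^ 4 + (a * v + G * p * f * v) / v ^ 4 * q ^ 4 := by
  have hχ01 : 0 ≤ χ ∧ χ ^ 2 ≤ 4 ^ k * F ^ k ∧ χ ≤ 4 ^ k * F ^ k := by
    rw [hχ, ← mul_pow]
    split_ifs with h
    · have : 1 ≤ (4 * F) ^ k := one_le_pow₀ (by linarith)
      norm_num [this]
    · norm_num; positivity
  have h1 : q / v ≤ 1 + (q / v) ^ 4 := by
    simpa using pow_le_one_add_pow (show 0 ≤ q / v by positivity) (show 1 ≤ 4 by norm_num)
  have h2 := mul_mul_le_sq_add_pow_four (x := χ / p) (y := F / f) (z := q / v)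
  have h3 : (χ / p) ^ 2 ≤ 4 ^ k * F ^ k / p ^ 2 := by
    rw [div_pow]; gcongr; exact hχ01.2.1
  calc a * q + G * (χ * F * q) + ρ * χ
      = a * v * (q / v) + G * p * f * v * (χ / p * (F / f) * (q / v)) + ρ * χ := by
        field_simp
    _ ≤ a * v * (1 + (q / v) ^ 4) + G * p * f * v *
          (4 ^ k * F ^ k / p ^ 2 + (F / f) ^ 4 + (q / v) ^ 4) + ρ * (4 ^ k * F ^ k) := by
        gcongr
        · linarith
        · exact hχ01.2.2
    _ = _ := by
        rw [div_pow, div_pow]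
        ring

/-- The constant in the upper bound; it depends only on `k` and `K`. -/
noncomputable def upperConst (k : ℕ) (K : ℝ) : ℝ :=
  10 + 32 * |K| * (1 + 2 ^ 19 * momentConst 4) +
    1024 * K ^ 2 * (4 ^ k * (5 * 4 ^ k * momentConst k) + 5 * 4 ^ 4 * momentConst 4 +
      2 ^ 19 * momentConst 4) +
    4 ^ k * (5 * 4 ^ k * momentConst k) * |K|

theorem upperConst_pos (k : ℕ) (K : ℝ) : 0 < upperConst k K := by
  have := momentConst_pos k
  have := momentConst_pos 4
  rw [upperConst]
  positivity

/-- The bound for the constants that result from integrating `loss_linearization`. -/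
theorem upper_numerics {M N K δ d Δ η W ρ γ f p v s a G : ℝ} {k : ℕ} (hM : 0 < M) (hN : 0 < N)
    (hK : 0 < K) (hδ : 0 < δ) (hd : 1 ≤ d) (hΔ : 1 ≤ Δ) (hη : 1 ≤ η) (hW0 : 0 < W) (hρ : 0 < ρ)
    (hρW : ρ ≤ W) (hγ0 : 0 ≤ γ) (hγ : γ ≤ N * (8 * d ^ 3 * Δ)) (hf : f = M ^ 2 / N) (hp : 0 < p)
    (hpf : p ^ 2 = f ^ k) (hpK : N * M ^ 2 * p ≤ K) (hfk : f ^ k ≤ K * δ)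
    (hv : v = M * (4 * d ^ 3 * W) / N) (hs : s = K * δ * N / M) (ha : a = 8 * s * d)
    (hG : G = 4 * s * d ^ 3 * γ ^ 2) :
    (10 * d ^ 6 * ρ * δ + a * v) +
      (G * p * f * v * 4 ^ k / p ^ 2 + ρ * 4 ^ k) * (5 * 4 ^ k * momentConst k * η * f ^ k) +
      (G * p * f * v / f ^ 4) * (5 * 4 ^ 4 * momentConst 4 * η * f ^ 4) +
      ((a * v + G * p * f * v) / v ^ 4) * (2 ^ 19 * momentConst 4 * η * v ^ 4) ≤
    upperConst k K * δ * η * d ^ 16 * Δ ^ 2 * W := by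
  set CF := 5 * 4 ^ k * momentConst k
  set CF4 := 5 * 4 ^ 4 * momentConst 4
  set CS := 2 ^ 19 * momentConst 4
  have hCF : 0 < CF := by have := momentConst_pos k; positivity
  have hCF4 : 0 < CF4 := by have := momentConst_pos 4; positivity
  have hCS : 0 < CS := by have := momentConst_pos 4; positivity
  have hf0 : 0 < f := by rw [hf]; positivity
  have hv0 : 0 < v := by rw [hv]; positivity
  have hav : a * v = 32 * K * δ * d ^ 4 * W := by
    rw [ha, hv, hs]
    field_simp
    ring
  have hGp : G * p * f * v ≤ 1024 * K ^ 2 * δ * d ^ 12 * Δ ^ 2 * W := by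
    have h1 : G * p * f * v = 16 * K * δ * d ^ 6 * W * (p * M ^ 2 / N) * γ ^ 2 := by
      rw [hG, hf, hv, hs]
      field_simp
      ring
    rw [h1]
    calc 16 * K * δ * d ^ 6 * W * (p * M ^ 2 / N) * γ ^ 2
        ≤ 16 * K * δ * d ^ 6 * W * (p * M ^ 2 / N) * (N * (8 * d ^ 3 * Δ)) ^ 2 := by gcongr
      _ = 1024 * K * δ * d ^ 12 * Δ ^ 2 * W * (N * M ^ 2 * p) := by
        field_simp
        ring
      _ ≤ 1024 * K * δ * d ^ 12 * Δ ^ 2 * W * K := by gcongr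
      _ = _ := by ring
  have hexp : (10 * d ^ 6 * ρ * δ + a * v) +
        (G * p * f * v * 4 ^ k / p ^ 2 + ρ * 4 ^ k) * (CF * η * f ^ k) +
        (G * p * f * v / f ^ 4) * (CF4 * η * f ^ 4) +
        ((a * v + G * p * f * v) / v ^ 4) * (CS * η * v ^ 4) =
      10 * d ^ 6 * ρ * δ + a * v + G * p * f * v * (4 ^ k * CF + CF4 + CS) * η +
        a * v * CS * η + ρ * 4 ^ k * CF * η * f ^ k := by
    rw [hpf]
    field_simp
    ring
  have hdle : ∀ i ≤ 16, d ^ i ≤ d ^ 16 := fun i hi => pow_le_pow_right₀ hd hi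
  have hd1 : 1 ≤ d ^ 16 := one_le_pow₀ hd
  have hΔ2 : 1 ≤ Δ ^ 2 := one_le_pow₀ hΔ
  set B := δ * η * d ^ 16 * Δ ^ 2 * W
  have hB0 : 0 < B := by positivity
  have hmono : ∀ i ≤ 16, ∀ x y z : ℝ, x ≤ W → 1 ≤ y → y ≤ η → 1 ≤ z → z ≤ Δ ^ 2 → 0 ≤ x →
      δ * y * d ^ i * z * x ≤ B := fun i hi x y z hx hy1 hy hz1 hz hx0 => by
    have := hdle i hi
    simp only [B]
    gcongr
  have t1 : 10 * d ^ 6 * ρ * δ ≤ 10 * B := by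
    have := hmono 6 (by norm_num) ρ 1 1 hρW le_rfl hη le_rfl hΔ2 hρ.le
    linarith
  have t2 : a * v ≤ 32 * K * B := by
    have := hmono 4 (by norm_num) W 1 1 le_rfl le_rfl hη le_rfl hΔ2 hW0.le
    rw [hav]
    have := mul_le_mul_of_nonneg_left this (show 0 ≤ 32 * K by positivity)
    linarith
  have t3 : G * p * f * v * (4 ^ k * CF + CF4 + CS) * η ≤
      1024 * K ^ 2 * (4 ^ k * CF + CF4 + CS) * B := by
    have h1 := hmono 12 (by norm_num) W η (Δ ^ 2) le_rfl hη le_rfl hΔ2 le_rfl hW0.le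
    calc G * p * f * v * (4 ^ k * CF + CF4 + CS) * η
        ≤ 1024 * K ^ 2 * δ * d ^ 12 * Δ ^ 2 * W * (4 ^ k * CF + CF4 + CS) * η := by gcongr
      _ = 1024 * K ^ 2 * (4 ^ k * CF + CF4 + CS) * (δ * η * d ^ 12 * Δ ^ 2 * W) := by ring
      _ ≤ _ := by gcongr
  have t4 : a * v * CS * η ≤ 32 * K * CS * B := by
    have h1 := hmono 4 (by norm_num) W η 1 le_rfl hη le_rfl le_rfl hΔ2 hW0.le
    rw [hav]
    calc 32 * K * δ * d ^ 4 * W * CS * η = 32 * K * CS * (δ * η * d ^ 4 * 1 * W) := by ring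
      _ ≤ _ := by gcongr
  have t5 : ρ * 4 ^ k * CF * η * f ^ k ≤ 4 ^ k * CF * K * B := by
    have h1 := hmono 0 (by norm_num) ρ η 1 hρW hη le_rfl le_rfl hΔ2 hρ.le
    calc ρ * 4 ^ k * CF * η * f ^ k ≤ ρ * 4 ^ k * CF * η * (K * δ) := by gcongr
      _ = 4 ^ k * CF * K * (δ * η * d ^ 0 * 1 * ρ) := by ring
      _ ≤ _ := by gcongr
  have hC : upperConst k K * δ * η * d ^ 16 * Δ ^ 2 * W = upperConst k K * B := by
    simp only [B]; ring
  rw [hexp, hC, upperConst, abs_of_pos hK]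
  change _ ≤ (10 + 32 * K * (1 + CS) + 1024 * K ^ 2 * (4 ^ k * CF + CF4 + CS) +
    4 ^ k * CF * K) * B
  linarith

theorem lintegral_le_of_le_pow {Ω' : Type*} [MeasurableSpace Ω'] {P' : Measure Ω'}
    [IsProbabilityMeasure P'] {L : Ω' → ℝ≥0∞} {F Q : Ω' → ℝ} (hFm : AEMeasurable F P')
    (hQm : AEMeasurable Q P') (hF0 : ∀ x, 0 ≤ F x) (hQ0 : ∀ x, 0 ≤ Q x) {A₀ A₁ A₂ A₃ B₁ B₂ B₃ : ℝ}
    {k : ℕ} (hA₀ : 0 ≤ A₀) (hA₁ : 0 ≤ A₁) (hA₂ : 0 ≤ A₂) (hA₃ : 0 ≤ A₃) (hB₁ : 0 ≤ B₁)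
    (hB₂ : 0 ≤ B₂) (hB₃ : 0 ≤ B₃)
    (hL : ∀ x, L x ≤ ENNReal.ofReal (A₀ + A₁ * F x ^ k + A₂ * F x ^ 4 + A₃ * Q x ^ 4))
    (hFk : ∫⁻ x, ENNReal.ofReal (F x ^ k) ∂P' ≤ ENNReal.ofReal B₁)
    (hF4 : ∫⁻ x, ENNReal.ofReal (F x ^ 4) ∂P' ≤ ENNReal.ofReal B₂)
    (hQ4 : ∫⁻ x, ENNReal.ofReal (Q x ^ 4) ∂P' ≤ ENNReal.ofReal B₃) :
    ∫⁻ x, L x ∂P' ≤ ENNReal.ofReal (A₀ + A₁ * B₁ + A₂ * B₂ + A₃ * B₃) := by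
  have hFkm : AEMeasurable (fun ω' => ENNReal.ofReal A₁ * ENNReal.ofReal (F ω' ^ k)) P' :=
    (hFm.pow_const k).ennreal_ofReal.const_mul _
  have hF4m : AEMeasurable (fun ω' => ENNReal.ofReal A₂ * ENNReal.ofReal (F ω' ^ 4)) P' :=
    (hFm.pow_const 4).ennreal_ofReal.const_mul _
  have hQ4m : AEMeasurable (fun ω' => ENNReal.ofReal A₃ * ENNReal.ofReal (Q ω' ^ 4)) P' :=
    (hQm.pow_const 4).ennreal_ofReal.const_mul _
  calc ∫⁻ x, L x ∂P' ≤ ∫⁻ x, (ENNReal.ofReal A₀ + ENNReal.ofReal A₁ * ENNReal.ofReal (F x ^ k) +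
          ENNReal.ofReal A₂ * ENNReal.ofReal (F x ^ 4) +
          ENNReal.ofReal A₃ * ENNReal.ofReal (Q x ^ 4)) ∂P' := by
        refine lintegral_mono fun x => (hL x).trans_eq ?_
        have hF1 := hF0 x
        have hQ1 := hQ0 x
        rw [ENNReal.ofReal_add (by positivity) (by positivity),
            ENNReal.ofReal_add (by positivity) (by positivity),
            ENNReal.ofReal_add (by positivity) (by positivity), ENNReal.ofReal_mul hA₁,
            ENNReal.ofReal_mul hA₂, ENNReal.ofReal_mul hA₃]
    _ = ENNReal.ofReal A₀ + ENNReal.ofReal A₁ * ∫⁻ x, ENNReal.ofReal (F x ^ k) ∂P' +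
          ENNReal.ofReal A₂ * ∫⁻ x, ENNReal.ofReal (F x ^ 4) ∂P' +
          ENNReal.ofReal A₃ * ∫⁻ x, ENNReal.ofReal (Q x ^ 4) ∂P' := by
        rw [lintegral_add_right' _ hQ4m, lintegral_add_right' _ hF4m,
          lintegral_add_right' _ hFkm, lintegral_const_mul' _ _ ENNReal.ofReal_ne_top,
          lintegral_const_mul' _ _ ENNReal.ofReal_ne_top,
          lintegral_const_mul' _ _ ENNReal.ofReal_ne_top, lintegral_const, measure_univ, mul_one]
    _ ≤ ENNReal.ofReal A₀ + ENNReal.ofReal A₁ * ENNReal.ofReal B₁ +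
          ENNReal.ofReal A₂ * ENNReal.ofReal B₂ + ENNReal.ofReal A₃ * ENNReal.ofReal B₃ := by
        gcongr
    _ = _ := by
        rw [← ENNReal.ofReal_mul hA₁, ← ENNReal.ofReal_mul hA₂, ← ENNReal.ofReal_mul hA₃,
          ← ENNReal.ofReal_add (by positivity) (by positivity),
          ← ENNReal.ofReal_add (by positivity) (by positivity),
          ← ENNReal.ofReal_add (by positivity) (by positivity)]

variable {Ω Ω' : Type*} [MeasurableSpace Ω] [MeasurableSpace Ω'] {P : Measure Ω}
  [IsProbabilityMeasure P] {P' : Measure Ω'} [IsProbabilityMeasure P'] {X : Ω → L2I} {ε : Ω → ℝ}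
  {ψ : HilbertBasis ℕ ℝ L2I} {m n : ℕ} {Xs : Fin n → Ω' → L2I} {εs : Fin n → Ω' → ℝ}
  {w b υ : ℕ → ℝ} {d Δ η σ ρ K : ℝ} {k : ℕ}

theorem rate_pos (hW : RegularWeights w b υ) : 0 < rate w b m :=
  div_pos (hW.w_pos _) (hW.b_pos _)

/-- The threshold is at least twice the bound `d / υ_m` for the norm of the inverse of the
covariance matrix, so that the estimator is not thresholded when the relative deviation is small. -/
theorem two_mul_le_threshold (hW : RegularWeights w b υ) (hd : 1 ≤ d) (hΔ : 1 ≤ Δ) (hn : 0 < n)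
    (hm : IsOptimalDim w b υ Δ n m) :
    2 * (d / υ (m - 1)) ≤ n * max 1 (8 * d ^ 3 * Δ / b (m - 1)) := by
  have hυm := hW.υ_pos (m - 1)
  have hwm := hW.w_pos (m - 1)
  have hbm := hW.b_pos (m - 1)
  have hn' : (0 : ℝ) < n := by exact_mod_cast hn
  have h1 : w (m - 1) / υ (m - 1) ≤ ∑ j ∈ Finset.range m, w j / υ j :=
    Finset.single_le_sum (f := fun j => w j / υ j)
      (fun j _ => (div_pos (hW.w_pos j) (hW.υ_pos j)).le)
      (Finset.mem_range.2 (by have := hm.one_le; omega))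
  have h2 := hm.upper
  have h3 : b (m - 1) / (n * w (m - 1)) * (w (m - 1) / υ (m - 1)) ≤ Δ :=
    (mul_le_mul_of_nonneg_left h1 (by positivity)).trans h2
  have h4 : b (m - 1) / (n * w (m - 1)) * (w (m - 1) / υ (m - 1)) =
      b (m - 1) / n * (1 / υ (m - 1)) := by field_simp
  rw [h4] at h3
  have h5 : 1 / υ (m - 1) ≤ n * Δ / b (m - 1) := by
    rw [le_div_iff₀ hbm]
    rw [div_mul_eq_mul_div, div_le_iff₀ hn'] at h3
    linarith
  have h6 : (1 : ℝ) ≤ d ^ 2 := one_le_pow₀ hd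
  calc 2 * (d / υ (m - 1)) = 2 * d * (1 / υ (m - 1)) := by ring
    _ ≤ 2 * d * (n * Δ / b (m - 1)) := by gcongr
    _ = n * (2 * 1 * d * Δ / b (m - 1)) := by ring
    _ ≤ n * (8 * d ^ 2 * d * Δ / b (m - 1)) := by gcongr; norm_num
    _ = n * (8 * d ^ 3 * Δ / b (m - 1)) := by ring
    _ ≤ _ := by gcongr; exact le_max_right _ _

theorem threshold_le (hW : RegularWeights w b υ) (hd : 1 ≤ d) (hΔ : 1 ≤ Δ) :
    n * max 1 (8 * d ^ 3 * Δ / b (m - 1)) ≤ n * (8 * d ^ 3 * Δ) := by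
  have hb1 : 1 ≤ b (m - 1) := by rw [← hW.b_one]; exact hW.b_mono (Nat.zero_le _)
  have h6 : (1 : ℝ) ≤ d ^ 3 := one_le_pow₀ hd
  gcongr
  refine max_le ?_ (div_le_self (by positivity) hb1)
  nlinarith

/-- The upper bound for the maximal risk of the thresholded projection estimator. -/
theorem maxRisk_betaHat_le (hk : 4 ≤ k) (hd : 1 ≤ d) (hΔ : 1 ≤ Δ) (hη : 1 ≤ η) (hσ : 0 < σ)
    (hρ : 0 < ρ) (hW : RegularWeights w b υ) (hX : RegressorMomentClass ψ (4 * k) η P X)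
    (hε : ErrorClass (4 * k) η P ε) (hεX : ∫ ω, ε ω • X ω ∂P = 0)
    (hL : LinkClass ψ υ d (covOp P X)) (hn : 0 < n) (hm : IsOptimalDim w b υ Δ n m)
    (hB : RateBounds w b υ k K n m) (hS : IsSample P X ε P' Xs εs) :
    maxRisk ψ w b ρ σ P' Xs εs (betaHat ψ m (n * max 1 (8 * d ^ 3 * Δ / b (m - 1))))
      ≤ ENNReal.ofReal (upperConst k K * rate w b m * η * d ^ 16 * Δ ^ 2 *
        (σ ^ 2 + ρ * ∑' j, υ j)) := by
  have hsum := hW.υ_summable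
  have hΓ : DiagComparable ψ υ d (covOp P X) :=
    DiagComparable.of_linkClass hd hsum hW.υ_pos hL hX.strictlyPositive
  set γ : ℝ := n * max 1 (8 * d ^ 3 * Δ / b (m - 1))
  have hγ1 : 2 * (d / υ (m - 1)) ≤ γ := two_mul_le_threshold hW hd hΔ hn hm
  have hγ2 : γ ≤ n * (8 * d ^ 3 * Δ) := threshold_le hW hd hΔ
  set δ := rate w b m
  have hδ : 0 < δ := rate_pos hW
  have hd0 : 0 < d := by linarith
  have hN : (0 : ℝ) < n := by exact_mod_cast hn
  have hM : (0 : ℝ) < m := by exact_mod_cast hm.one_le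
  have hK : 0 < K := lt_of_lt_of_le (by positivity) hB.first
  have hγ0 : 0 ≤ γ := by positivity
  set s := K * δ * n / m
  have hs : ∀ j : Fin m, w j / υ j ≤ s := fun j => by
    have h1 : w j / υ j ≤ ⨆ j : Fin m, w j / υ j :=
      le_ciSup (f := fun j : Fin m => w j / υ j) (Set.finite_range _).bddAbove j
    have h2 := hB.second
    rw [div_mul_eq_mul_div, div_le_iff₀ (by positivity)] at h2
    rw [le_div_iff₀ hM]
    calc w j / υ j * m = m * (w j / υ j) := by ring
      _ ≤ m * ⨆ j : Fin m, w j / υ j := by gcongr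
      _ ≤ _ := by linarith
  set Λ := ∑' j, υ j
  have hΛ : 1 ≤ Λ := by
    rw [← hW.υ_one]
    exact hsum.le_tsum 0 fun j _ => (hW.υ_pos j).le
  set W := σ ^ 2 + ρ * Λ
  have hρW : ρ ≤ W := by
    have : ρ * 1 ≤ ρ * Λ := by gcongr
    have := sq_nonneg σ
    simp only [W]
    linarith
  have hW0 : 0 < W := by linarith
  set V := 4 * d ^ 3 * W
  have hV : 0 < V := by positivity
  -- `f` is the typical magnitude of the relative deviation, and `p²` that of the probability that
  -- it exceeds `1 / 4`.
  set f : ℝ := (m : ℝ) ^ 2 / n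
  have hf : 0 < f := by positivity
  set p : ℝ := (m : ℝ) ^ k / (n : ℝ) ^ ((k : ℝ) / 2)
  have hp : 0 < p := by positivity
  have hpf : p ^ 2 = f ^ k := by
    simp only [p, f]
    rw [div_pow, div_pow, ← pow_mul, ← pow_mul, mul_comm k 2, ← Real.rpow_natCast (n ^ (k / 2 : ℝ)),
      ← Real.rpow_mul hN.le]
    congr 1
    push_cast
    rw [div_mul_cancel₀ _ (by norm_num), Real.rpow_natCast]
  have hpK : n * (m : ℝ) ^ 2 * p ≤ K := by
    refine le_trans (le_of_eq ?_) hB.third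
    rw [Real.rpow_sub_one hN.ne', pow_add]
    simp only [p]
    field_simp
  set v : ℝ := m * V / n
  have hv : 0 < v := by positivity
  set a := 8 * s * d
  set G := 4 * s * d ^ 3 * γ ^ 2
  have hs0 : 0 < s := by positivity
  have ha : 0 < a := by positivity
  have hG : 0 ≤ G := by positivity
  refine iSup₂_le fun β hβ => ?_
  obtain ⟨e, heS, hgal⟩ := exists_galerkin (covOp P X) hΓ.pos (basisSpan ψ m) β
  obtain ⟨hb1, hb2⟩ := galerkin_bias hd hρ hW hΓ hβ heS hgal
  have hVσ : σ ^ 2 ≤ V := by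
    have h1 : (1 : ℝ) ≤ d ^ 3 := one_le_pow₀ hd
    have h2 : σ ^ 2 ≤ W := by
      simp only [W]
      have : 0 ≤ ρ * Λ := by positivity
      linarith
    calc σ ^ 2 ≤ 1 * W := by linarith
      _ ≤ 4 * d ^ 3 * W := by gcongr; linarith
  have hVβ : ‖β - e‖ ^ 2 * (d * Λ) ≤ V := by
    calc ‖β - e‖ ^ 2 * (d * Λ) ≤ (4 * d ^ 2 * ρ) * (d * Λ) := by gcongr
      _ = 4 * d ^ 3 * (ρ * Λ) := by ring
      _ ≤ _ := mul_le_mul_of_nonneg_left (le_add_of_nonneg_left (sq_nonneg σ)) (by positivity)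
  obtain ⟨hFm, hFk⟩ := lintegral_relDev_pow_le (p := k) (k := k) hX.memLp hΓ hS hn (by omega) le_rfl
    hη (hX.moment_standardized m) β σ
  obtain ⟨-, hF4⟩ := lintegral_relDev_pow_le (p := 4) (k := k) hX.memLp hΓ hS hn (by omega) hk
    hη (hX.moment_standardized m) β σ
  obtain ⟨hQm, hQ4⟩ := lintegral_noise_pow_le hX.memLp hd hW.υ_pos hsum hΓ hS hn hk hη
    (hX.moment_standardized m) hX.moment_coord hε hεX hgal hV hVσ hVβ
  set F : Ω' → ℝ := fun ω' => relDev (invSqrt (truncMatrix ψ m (covOp P X))) (truncMatrix ψ m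
        (gammaHat (observations β σ (fun i => Xs i ω') (fun i => εs i ω'))))
  set Q : Ω' → ℝ := fun ω' =>
        invSqrt (truncMatrix ψ m (covOp P X)) *ᵥ truncVec ψ m
          (gHat (observations β σ (fun i => Xs i ω') (fun i => εs i ω')) -
            gammaHat (observations β σ (fun i => Xs i ω') (fun i => εs i ω')) e) ⬝ᵥ
        invSqrt (truncMatrix ψ m (covOp P X)) *ᵥ truncVec ψ m
          (gHat (observations β σ (fun i => Xs i ω') (fun i => εs i ω')) -
            gammaHat (observations β σ (fun i => Xs i ω') (fun i => εs i ω')) e)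
  have hF0 : ∀ ω', 0 ≤ F ω' := fun ω' => relDev_nonneg _ _
  have hQ0 : ∀ ω', 0 ≤ Q ω' := fun ω' => dotProduct_self_nonneg _
  set A₀ := 10 * d ^ 6 * ρ * δ + a * v
  set A₁ := G * p * f * v * 4 ^ k / p ^ 2 + ρ * 4 ^ k
  set A₂ := G * p * f * v / f ^ 4
  set A₃ := (a * v + G * p * f * v) / v ^ 4
  have hA₀ : 0 ≤ A₀ := by positivity
  have hA₁ : 0 ≤ A₁ := by positivity
  have hA₂ : 0 ≤ A₂ := by positivity
  have hA₃ : 0 ≤ A₃ := by positivity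
  have hfk : f ^ k ≤ K * δ := by
    have h1 := hB.first
    rw [div_le_iff₀ (by positivity)] at h1
    simp only [f]
    rw [div_pow, ← pow_mul, div_le_iff₀ (by positivity)]
    linarith
  have hmk := momentConst_pos k
  have hm4 := momentConst_pos 4
  refine (lintegral_le_of_le_pow (k := k) hFm hQm hF0 hQ0 hA₀ hA₁ hA₂ hA₃ (by positivity)
    (by positivity) (by positivity) (fun ω' => ?_) hFk hF4 hQ4).trans (ENNReal.ofReal_le_ofReal
      (upper_numerics hM hN hK hδ hd hΔ hη hW0 hρ hρW hγ0 hγ2 rfl hp hpf hpK hfk rfl rfl rfl rfl))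
  have h1 := loss_le (m := m) hd hW hΓ hβ heS hγ1 hs
    (observations β σ (fun i => Xs i ω') (fun i => εs i ω'))
  have h2 := loss_linearization (k := k) (hF0 ω') (hQ0 ω') hp hf hv ha.le hG hρ.le rfl
  have hF1 := hF0 ω'
  have hQ1 := hQ0 ω'
  have h3 : (0 : ℝ) ≤ if 1 / 4 < F ω' then 1 else 0 := by split_ifs <;> norm_num
  refine h1.trans ?_
  calc _ ≤ ENNReal.ofReal (2 * (5 * d ^ 6 * ρ * δ)) +
        ENNReal.ofReal (a * Q ω' + G * ((if 1 / 4 < F ω' then 1 else 0) * F ω' * Q ω')) +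
        ENNReal.ofReal ρ * ENNReal.ofReal (if 1 / 4 < F ω' then 1 else 0) := by
        rw [← two_mul_ofReal]
        exact add_le_add (add_le_add (mul_le_mul_right hb1 2) le_rfl) le_rfl
    _ = ENNReal.ofReal (2 * (5 * d ^ 6 * ρ * δ) +
        (a * Q ω' + G * ((if 1 / 4 < F ω' then 1 else 0) * F ω' * Q ω')) +
        ρ * (if 1 / 4 < F ω' then 1 else 0)) := by
        rw [← ENNReal.ofReal_mul hρ.le, ← ENNReal.ofReal_add (by positivity) (by positivity),
          ← ENNReal.ofReal_add (by positivity) (by positivity)]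
    _ ≤ _ := by
        apply ENNReal.ofReal_le_ofReal
        simp only [A₀]
        linarith

end Upper

/-! ### Gaussian change of measure -/

section GaussianShift

/-- The Cameron–Martin formula on the real line. -/
theorem lintegral_gaussianReal_add (h : ℝ) {φ : ℝ → ℝ≥0∞} (hφ : Measurable φ) :
    ∫⁻ e, φ (e + h) ∂gaussianReal 0 1
      = ∫⁻ e, φ e * ENNReal.ofReal (Real.exp (h * e - h ^ 2 / 2)) ∂gaussianReal 0 1 := by
  rw [← lintegral_map (g := fun e => e + h) hφ (by fun_prop), gaussianReal_map_add_const,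
    gaussianReal_of_var_ne_zero _ one_ne_zero, gaussianReal_of_var_ne_zero _ one_ne_zero,
    lintegral_withDensity_eq_lintegral_mul _ (measurable_gaussianPDF _ _) hφ,
    lintegral_withDensity_eq_lintegral_mul _ (measurable_gaussianPDF _ _) (by fun_prop)]
  refine lintegral_congr fun e => ?_
  simp only [Pi.mul_apply, gaussianPDF]
  rw [mul_comm (φ e), ← mul_assoc, ← ENNReal.ofReal_mul (gaussianPDFReal_nonneg _ _ _)]
  congr 2
  simp only [gaussianPDFReal]
  rw [mul_assoc _ (Real.exp _) (Real.exp _), ← Real.exp_add]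
  congr 2
  push_cast
  ring

/-- The log-likelihood ratio of the error `e + h x` with respect to the standard normal error
`e`, at the observation `z = (x, e)`. -/
noncomputable def logRatio {E : Type*} (h : E → ℝ) (z : E × ℝ) : ℝ :=
  h z.1 * z.2 - h z.1 ^ 2 / 2

variable {E : Type*} [MeasurableSpace E] {h : E → ℝ}

@[fun_prop]
theorem measurable_logRatio (hh : Measurable h) : Measurable (logRatio h) := by
  unfold logRatio
  fun_prop

/-- The law of regressor and error after a shift of the error that depends on the regressor. -/
theorem map_shift_eq_withDensity (ν : Measure E) [IsProbabilityMeasure ν] (hh : Measurable h) :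
    (ν.prod (gaussianReal 0 1)).map (fun z => (z.1, z.2 + h z.1))
      = (ν.prod (gaussianReal 0 1)).withDensity
          fun z => ENNReal.ofReal (Real.exp (logRatio h z)) := by
  have hl := measurable_logRatio hh
  refine Measure.ext_of_lintegral _ fun φ hφ => ?_
  rw [lintegral_map hφ (by fun_prop), lintegral_withDensity_eq_lintegral_mul _ (by fun_prop) hφ,
    lintegral_prod _ (by fun_prop), lintegral_prod _ (by fun_prop)]
  refine lintegral_congr fun x => ?_
  rw [lintegral_gaussianReal_add (h x) (φ := fun e => φ (x, e)) (by fun_prop)]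
  refine lintegral_congr fun e => ?_
  simp only [Pi.mul_apply, logRatio]
  rw [mul_comm]

theorem pi_withDensity {ι α : Type*} [Fintype ι] [MeasurableSpace α] (μ : Measure α)
    [IsProbabilityMeasure μ] {r : α → ℝ≥0∞} (hr : Measurable r)
    [IsProbabilityMeasure (μ.withDensity r)] :
    Measure.pi (fun _ : ι => μ.withDensity r)
      = (Measure.pi fun _ : ι => μ).withDensity fun z => ∏ i, r (z i) := by
  refine Measure.pi_eq fun s hs => ?_
  rw [withDensity_apply _ (MeasurableSet.univ_pi hs), ← lintegral_indicator (.univ_pi hs)]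
  have h1 : ∀ z : ι → α, (Set.univ.pi s).indicator (fun z => ∏ i, r (z i)) z
      = ∏ i, (s i).indicator r (z i) := by
    intro z
    by_cases hz : z ∈ Set.univ.pi s
    · rw [Set.indicator_of_mem hz]
      exact Finset.prod_congr rfl fun i _ => (Set.indicator_of_mem (hz i trivial) r).symm
    · rw [Set.indicator_of_notMem hz]
      simp only [Set.mem_pi, Set.mem_univ, true_imp_iff, not_forall] at hz
      obtain ⟨i, hi⟩ := hz
      exact (Finset.prod_eq_zero (Finset.mem_univ i) (Set.indicator_of_notMem hi r)).symm
  simp_rw [h1]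
  have h2 := lintegral_prod_eq_prod_lintegral_of_indepFun (μ := Measure.pi fun _ : ι => μ)
    Finset.univ (fun i (z : ι → α) => (s i).indicator r (z i))
    (iIndepFun_pi (μ := fun _ : ι => μ) (X := fun i => (s i).indicator r)
      fun i => (hr.indicator (hs i)).aemeasurable)
    fun i => (hr.indicator (hs i)).comp (measurable_pi_apply i)
  rw [h2]
  refine Finset.prod_congr rfl fun i _ => ?_
  rw [withDensity_apply _ (hs i), ← lintegral_indicator (hs i),
    ← (measurePreserving_eval (fun _ : ι => μ) i).lintegral_comp (hr.indicator (hs i))]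

/-- Change of measure for a sample: shifting the errors by `h` amounts to weighting by the
likelihood ratio. -/
theorem lintegral_pi_shift {ι : Type*} [Fintype ι] (ν : Measure E) [IsProbabilityMeasure ν]
    (hh : Measurable h) {φ : (ι → E × ℝ) → ℝ≥0∞} (hφ : Measurable φ) :
    ∫⁻ z, φ (fun i => ((z i).1, (z i).2 + h (z i).1))
        ∂Measure.pi (fun _ : ι => ν.prod (gaussianReal 0 1))
      = ∫⁻ z, ENNReal.ofReal (Real.exp (∑ i, logRatio h (z i))) * φ z
        ∂Measure.pi (fun _ : ι => ν.prod (gaussianReal 0 1)) := by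
  set μ := ν.prod (gaussianReal 0 1)
  have hl := measurable_logRatio hh
  have hτ : Measurable fun z : E × ℝ => (z.1, z.2 + h z.1) := by fun_prop
  have hmap := map_shift_eq_withDensity ν hh
  have : IsProbabilityMeasure (μ.map fun z => (z.1, z.2 + h z.1)) :=
    Measure.isProbabilityMeasure_map hτ.aemeasurable
  have : IsProbabilityMeasure
      (μ.withDensity fun z => ENNReal.ofReal (Real.exp (logRatio h z))) := hmap ▸ this
  rw [← lintegral_map (g := fun (z : ι → E × ℝ) i => ((z i).1, (z i).2 + h (z i).1)) hφ
    (by fun_prop), Measure.pi_map_pi (μ := fun _ : ι => μ)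
      (f := fun _ z => (z.1, z.2 + h z.1)) fun _ => hτ.aemeasurable]
  simp_rw [μ, hmap]
  rw [pi_withDensity _ (by fun_prop), lintegral_withDensity_eq_lintegral_mul _ (by fun_prop) hφ]
  refine lintegral_congr fun z => ?_
  rw [Pi.mul_apply, Real.exp_sum, ENNReal.ofReal_prod_of_nonneg fun i _ => (Real.exp_pos _).le]

end GaussianShift

/-! ### Two-point testing -/

section TwoPoint

/-- With `p = exp u` and `q = exp v`, minimization over `T` bounds the weighted errors below by
`4 a² p q / (p + q)`, and `√(p q) / 2 - (p + q) / 16 ≤ p q / (p + q)`. -/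
theorem two_point_pointwise (T t a u v : ℝ) :
    2 * a ^ 2 * Real.exp ((u + v) / 2) ≤ (T - (t + a)) ^ 2 * Real.exp u
      + (T - (t - a)) ^ 2 * Real.exp v + a ^ 2 / 4 * (Real.exp u + Real.exp v) := by
  have hu : Real.exp u = Real.exp (u / 2) ^ 2 := by
    rw [← Real.exp_nat_mul]; congr 1; push_cast; ring
  have hv : Real.exp v = Real.exp (v / 2) ^ 2 := by
    rw [← Real.exp_nat_mul]; congr 1; push_cast; ring
  have hg : Real.exp ((u + v) / 2) = Real.exp (u / 2) * Real.exp (v / 2) := by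
    rw [← Real.exp_add]; congr 1; ring
  rw [hu, hv, hg]
  have hp := Real.exp_pos (u / 2)
  have hq := Real.exp_pos (v / 2)
  set p := Real.exp (u / 2)
  set q := Real.exp (v / 2)
  -- Multiplied by `p² + q²`, the difference is a sum of two squares.
  have hs : 0 < p ^ 2 + q ^ 2 := by positivity
  refine le_of_mul_le_mul_right ?_ hs
  have h1 := sq_nonneg ((T - t) * (p ^ 2 + q ^ 2) - a * (p ^ 2 - q ^ 2))
  have h2 := sq_nonneg (a * ((p ^ 2 + q ^ 2) / 2 - 2 * (p * q)))
  nlinarith [h1, h2]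

/-- If the affinity of two densities `exp u`, `exp v` of probability measures is at least `1/2`,
then no statistic `T` estimates both `t + a` and `t - a` well. -/
theorem two_point_bound {α : Type*} [MeasurableSpace α] {μ : Measure α} {T u v : α → ℝ}
    (hT : Measurable T) (hu : Measurable u) (hv : Measurable v)
    (hu1 : ∫⁻ z, ENNReal.ofReal (Real.exp (u z)) ∂μ = 1)
    (hv1 : ∫⁻ z, ENNReal.ofReal (Real.exp (v z)) ∂μ = 1)
    (haff : ENNReal.ofReal (1 / 2) ≤ ∫⁻ z, ENNReal.ofReal (Real.exp ((u z + v z) / 2)) ∂μ)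
    (t a : ℝ) :
    ENNReal.ofReal (a ^ 2 / 2) ≤
      ∫⁻ z, ENNReal.ofReal (Real.exp (u z)) * ENNReal.ofReal ((T z - (t + a)) ^ 2) ∂μ
      + ∫⁻ z, ENNReal.ofReal (Real.exp (v z)) * ENNReal.ofReal ((T z - (t - a)) ^ 2) ∂μ := by
  have h1 : ∫⁻ z, ENNReal.ofReal (2 * a ^ 2) * ENNReal.ofReal (Real.exp ((u z + v z) / 2)) ∂μ
      ≤ ∫⁻ z, (ENNReal.ofReal (Real.exp (u z)) * ENNReal.ofReal ((T z - (t + a)) ^ 2)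
        + ENNReal.ofReal (Real.exp (v z)) * ENNReal.ofReal ((T z - (t - a)) ^ 2)
        + ENNReal.ofReal (a ^ 2 / 4) * (ENNReal.ofReal (Real.exp (u z))
          + ENNReal.ofReal (Real.exp (v z)))) ∂μ := by
    refine lintegral_mono fun z => ?_
    have hu := (Real.exp_pos (u z)).le
    have hv := (Real.exp_pos (v z)).le
    rw [← ENNReal.ofReal_add hu hv, ← ENNReal.ofReal_mul (by positivity),
      ← ENNReal.ofReal_mul hu, ← ENNReal.ofReal_mul hv, ← ENNReal.ofReal_mul (by positivity),
      ← ENNReal.ofReal_add (by positivity) (by positivity),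
      ← ENNReal.ofReal_add (by positivity) (by positivity)]
    apply ENNReal.ofReal_le_ofReal
    have := two_point_pointwise (T z) t a (u z) (v z)
    linarith
  rw [lintegral_const_mul _ (by fun_prop), lintegral_add_left (by fun_prop),
    lintegral_add_left (by fun_prop), lintegral_const_mul _ (by fun_prop),
    lintegral_add_left (by fun_prop), hu1, hv1, one_add_one_eq_two] at h1
  have h2 : ENNReal.ofReal (a ^ 2 / 2) + ENNReal.ofReal (a ^ 2 / 2)
      ≤ ENNReal.ofReal (2 * a ^ 2) *
        ∫⁻ z, ENNReal.ofReal (Real.exp ((u z + v z) / 2)) ∂μ := by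
    refine le_trans (le_of_eq ?_) (mul_le_mul_right haff _)
    rw [← ENNReal.ofReal_add (by positivity) (by positivity),
      ← ENNReal.ofReal_mul (by positivity)]
    congr 1
    ring
  have h3 : ENNReal.ofReal (a ^ 2 / 4) * 2 = ENNReal.ofReal (a ^ 2 / 2) := by
    rw [mul_comm, two_mul_ofReal]
    congr 1
    ring
  rw [h3] at h1
  exact (ENNReal.add_le_add_iff_right ENNReal.ofReal_ne_top).1 (h2.trans h1)

end TwoPoint

/-! ### The lower bound -/

section Lower

variable {Ω Ω' : Type*} [MeasurableSpace Ω] [MeasurableSpace Ω'] {P : Measure Ω}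
  {P' : Measure Ω'} {X : Ω → L2I} {ε : Ω → ℝ} {n : ℕ} {Xs : Fin n → Ω' → L2I}
  {εs : Fin n → Ω' → ℝ} {ψ : HilbertBasis ℕ ℝ L2I}

theorem map_sample_eq_pi [IsProbabilityMeasure P] (hX : AEMeasurable X P)
    (hS : IsSample P X ε P' Xs εs) (hε : HasLaw ε (gaussianReal 0 1) P) (hi : IndepFun X ε P) :
    P'.map (fun ω' i => (Xs i ω', εs i ω'))
      = Measure.pi fun _ : Fin n => (P.map X).prod (gaussianReal 0 1) := by
  rw [hS.indep.map_fun_eq_pi_map fun i => (hS.identDistrib i).aemeasurable_fst]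
  congr 1
  funext i
  rw [(hS.identDistrib i).map_eq,
    (indepFun_iff_map_prod_eq_prod_map_map hX hε.aemeasurable).1 hi, hε.map_eq]

theorem lintegral_sample [IsProbabilityMeasure P] (hX : AEMeasurable X P)
    (hS : IsSample P X ε P' Xs εs) (hε : HasLaw ε (gaussianReal 0 1) P) (hi : IndepFun X ε P)
    {φ : (Fin n → L2I × ℝ) → ℝ≥0∞} (hφ : Measurable φ) :
    ∫⁻ ω', φ (fun i => (Xs i ω', εs i ω')) ∂P'
      = ∫⁻ z, φ z ∂Measure.pi fun _ : Fin n => (P.map X).prod (gaussianReal 0 1) := by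
  rw [← map_sample_eq_pi hX hS hε hi, lintegral_map' hφ.aemeasurable
    (aemeasurable_pi_lambda _ fun i => (hS.identDistrib i).aemeasurable_fst)]

theorem measurable_observations (β : L2I) (σ : ℝ) :
    Measurable fun z : Fin n → L2I × ℝ =>
      observations β σ (fun i => (z i).1) (fun i => (z i).2) := by
  have h := fun i : Fin n => (measurable_inner_left β).comp
    ((measurable_pi_apply i).fst : Measurable fun z : Fin n → L2I × ℝ => (z i).1)
  refine measurable_pi_lambda _ fun i => ?_
  simp only [observations]
  simp_rw [real_inner_comm _ β]
  have h' : Measurable fun z : Fin n → L2I × ℝ => ⟪(z i).1, β⟫ := h i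
  fun_prop

/-- Perturbing the slope amounts to shifting the errors. -/
theorem observations_add (β g : L2I) {σ : ℝ} (hσ : σ ≠ 0) (z : Fin n → L2I × ℝ) :
    observations (β + g) σ (fun i => (z i).1) (fun i => (z i).2)
      = observations β σ (fun i => (z i).1) (fun i => (z i).2 + ⟪(z i).1, g⟫ / σ) := by
  funext i
  simp only [observations, inner_add_left, real_inner_comm (z i).1 g]
  congr 1
  field_simp
  ring

theorem lintegral_inner_sq_pi [IsProbabilityMeasure P] (hX : MemLp X 2 P) (g : L2I) (i : Fin n) :
    ∫⁻ z, ENNReal.ofReal (⟪(z i).1, g⟫ ^ 2)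
        ∂Measure.pi (fun _ : Fin n => (P.map X).prod (gaussianReal 0 1))
      = ENNReal.ofReal ⟪covOp P X g, g⟫ := by
  have hXm := hX.aestronglyMeasurable.aemeasurable
  have : IsProbabilityMeasure (P.map X) := Measure.isProbabilityMeasure_map hXm
  have hm := measurable_inner_left g
  rw [(measurePreserving_eval (fun _ : Fin n => (P.map X).prod (gaussianReal 0 1)) i).lintegral_comp
      (f := fun y : L2I × ℝ => ENNReal.ofReal (⟪y.1, g⟫ ^ 2)) (by fun_prop),
    measurePreserving_fst.lintegral_comp (f := fun x : L2I => ENNReal.ofReal (⟪x, g⟫ ^ 2))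
      (by fun_prop), lintegral_map' (by fun_prop) hXm, inner_covOp hX]
  simp_rw [← sq]
  rw [ofReal_integral_eq_lintegral_ofReal]
  · simpa [sq] using integrable_inner_mul_inner hX g g
  · exact Filter.Eventually.of_forall fun ω => sq_nonneg _

/-- For Gaussian errors, no estimator estimates the `j`-th coefficient well at both slopes
`β ± a ψ_j` when `a` is at most the noise level `σ / √(n ⟪Γ ψ_j, ψ_j⟫)`. -/
theorem coordinate_lower_bound [IsProbabilityMeasure P] (hX : MemLp X 2 P)
    (hS : IsSample P X ε P' Xs εs) (hε : HasLaw ε (gaussianReal 0 1) P) (hi : IndepFun X ε P)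
    {σ : ℝ} (hσ : 0 < σ) {est : (Fin n → ℝ × L2I) → L2I} (hest : Measurable est) (β : L2I) (j : ℕ)
    {a : ℝ} (ha : n * (a ^ 2 * ⟪covOp P X (ψ j), ψ j⟫) ≤ σ ^ 2) :
    ENNReal.ofReal (a ^ 2 / 2) ≤
      ∫⁻ ω', ENNReal.ofReal (⟪est (observations (β + a • ψ j) σ (fun i => Xs i ω')
          (fun i => εs i ω')) - (β + a • ψ j), ψ j⟫ ^ 2) ∂P'
      + ∫⁻ ω', ENNReal.ofReal (⟪est (observations (β - a • ψ j) σ (fun i => Xs i ω')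
          (fun i => εs i ω')) - (β - a • ψ j), ψ j⟫ ^ 2) ∂P' := by
  have hXm := hX.aestronglyMeasurable.aemeasurable
  have : IsProbabilityMeasure (P.map X) := Measure.isProbabilityMeasure_map hXm
  set μ := Measure.pi fun _ : Fin n => (P.map X).prod (gaussianReal 0 1) with hμ
  have hmψ := measurable_inner_left (ψ j)
  have hob := measurable_observations (n := n) β σ
  set T : (Fin n → L2I × ℝ) → ℝ := fun z =>
    ⟪est (observations β σ (fun i => (z i).1) (fun i => (z i).2)), ψ j⟫
  have hT : Measurable T := hmψ.comp (hest.comp hob)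
  have hψ : ⟪ψ j, ψ j⟫ = (1 : ℝ) := by
    rw [real_inner_self_eq_norm_sq, ψ.orthonormal.1 j, one_pow]
  -- The risk at the slope `β + s ψ_j`, as an integral under the law for the slope `β`.
  have hrisk : ∀ s : ℝ, ∫⁻ ω', ENNReal.ofReal (⟪est (observations (β + s • ψ j) σ
        (fun i => Xs i ω') (fun i => εs i ω')) - (β + s • ψ j), ψ j⟫ ^ 2) ∂P'
      = ∫⁻ z, ENNReal.ofReal (Real.exp (∑ i, logRatio (fun x => s * ⟪x, ψ j⟫ / σ) (z i))) *
        ENNReal.ofReal ((T z - (⟪β, ψ j⟫ + s)) ^ 2) ∂μ := by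
    intro s
    have hob' := measurable_observations (n := n) (β + s • ψ j) σ
    rw [lintegral_sample hX.aestronglyMeasurable.aemeasurable hS hε hi
      (φ := fun z => ENNReal.ofReal (⟪est (observations (β + s • ψ j) σ
        (fun i => (z i).1) (fun i => (z i).2)) - (β + s • ψ j), ψ j⟫ ^ 2))
      (((hmψ.comp ((hest.comp hob').sub_const _)).pow_const 2).ennreal_ofReal),
      hμ, ← lintegral_pi_shift _ (by fun_prop)
        (φ := fun z => ENNReal.ofReal ((T z - (⟪β, ψ j⟫ + s)) ^ 2)) (by fun_prop)]
    refine lintegral_congr fun z => ?_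
    rw [observations_add _ _ hσ.ne']
    simp only [T, inner_sub_left, inner_add_left, inner_smul_left, inner_smul_right, hψ, mul_one,
      RCLike.conj_to_real]
  have hone : ∀ s : ℝ,
      ∫⁻ z, ENNReal.ofReal (Real.exp (∑ i, logRatio (fun x => s * ⟪x, ψ j⟫ / σ) (z i))) ∂μ = 1 := by
    intro s
    have h := lintegral_pi_shift (ι := Fin n) (P.map X) (h := fun x : L2I => s * ⟪x, ψ j⟫ / σ)
      (by fun_prop) (φ := fun _ => 1) measurable_const
    simp only [mul_one] at h
    rw [hμ, ← h, lintegral_one, measure_univ]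
  have hlm : ∀ s : ℝ, Measurable fun z : Fin n → L2I × ℝ =>
      ∑ i, logRatio (fun x : L2I => s * ⟪x, ψ j⟫ / σ) (z i) := by
    intro s
    have := measurable_logRatio (h := fun x : L2I => s * ⟪x, ψ j⟫ / σ) (by fun_prop)
    fun_prop
  rw [hrisk a, sub_eq_add_neg β, ← neg_smul, hrisk (-a)]
  refine two_point_bound hT (hlm a) (hlm (-a)) (hone a) (hone (-a)) ?_ _ _
  -- The affinity is `E exp (-∑ h(X_i)² / 2) ≥ 1 - n E h(X)² / 2`.
  have hsq : ∫⁻ z, ∑ i, ENNReal.ofReal (a ^ 2 / (2 * σ ^ 2)) * ENNReal.ofReal (⟪(z i).1, ψ j⟫ ^ 2)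
      ∂μ ≤ ENNReal.ofReal (1 / 2) := by
    rw [lintegral_finsetSum _ fun i _ => by fun_prop]
    have : ∀ i : Fin n, ∫⁻ z, ENNReal.ofReal (a ^ 2 / (2 * σ ^ 2)) *
        ENNReal.ofReal (⟪(z i).1, ψ j⟫ ^ 2) ∂μ
        = ENNReal.ofReal (a ^ 2 / (2 * σ ^ 2) * ⟪covOp P X (ψ j), ψ j⟫) := by
      intro i
      rw [lintegral_const_mul _ (by fun_prop), lintegral_inner_sq_pi hX,
        ← ENNReal.ofReal_mul (by positivity)]
    simp_rw [this]
    rw [Finset.sum_const, Finset.card_univ, Fintype.card_fin, nsmul_eq_mul,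
      ← ENNReal.ofReal_natCast, ← ENNReal.ofReal_mul (by positivity)]
    apply ENNReal.ofReal_le_ofReal
    rw [show (n : ℝ) * (a ^ 2 / (2 * σ ^ 2) * ⟪covOp P X (ψ j), ψ j⟫)
      = n * (a ^ 2 * ⟪covOp P X (ψ j), ψ j⟫) / (2 * σ ^ 2) by ring, div_le_div_iff₀ (by positivity)
      (by norm_num)]
    linarith
  have hadd : 1 ≤ ∫⁻ z, ENNReal.ofReal (Real.exp
        ((∑ i, logRatio (fun x => a * ⟪x, ψ j⟫ / σ) (z i)
          + ∑ i, logRatio (fun x => -a * ⟪x, ψ j⟫ / σ) (z i)) / 2)) ∂μ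
      + ENNReal.ofReal (1 / 2) := by
    calc (1 : ℝ≥0∞) = ∫⁻ _, 1 ∂μ := by rw [lintegral_one, measure_univ]
      _ ≤ ∫⁻ z, (ENNReal.ofReal (Real.exp
            ((∑ i, logRatio (fun x => a * ⟪x, ψ j⟫ / σ) (z i)
              + ∑ i, logRatio (fun x => -a * ⟪x, ψ j⟫ / σ) (z i)) / 2))
          + ∑ i, ENNReal.ofReal (a ^ 2 / (2 * σ ^ 2)) *
              ENNReal.ofReal (⟪(z i).1, ψ j⟫ ^ 2)) ∂μ := by
          refine lintegral_mono fun z => ?_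
          have h0 : ∀ i : Fin n, 0 ≤ a ^ 2 / (2 * σ ^ 2) * ⟪(z i).1, ψ j⟫ ^ 2 := fun i => by
            positivity
          simp_rw [← ENNReal.ofReal_mul (show 0 ≤ a ^ 2 / (2 * σ ^ 2) by positivity)]
          rw [← ENNReal.ofReal_sum_of_nonneg fun i _ => h0 i, ← ENNReal.ofReal_add
            (Real.exp_pos _).le (Finset.sum_nonneg fun i _ => h0 i), ← ENNReal.ofReal_one]
          apply ENNReal.ofReal_le_ofReal
          have h1 : (∑ i, logRatio (fun x => a * ⟪x, ψ j⟫ / σ) (z i)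
              + ∑ i, logRatio (fun x => -a * ⟪x, ψ j⟫ / σ) (z i)) / 2
              = -∑ i, a ^ 2 / (2 * σ ^ 2) * ⟪(z i).1, ψ j⟫ ^ 2 := by
            rw [← Finset.sum_add_distrib, Finset.sum_div, ← Finset.sum_neg_distrib]
            refine Finset.sum_congr rfl fun i _ => ?_
            simp only [logRatio]
            field_simp
            ring
          rw [h1]
          have := Real.add_one_le_exp (-∑ i, a ^ 2 / (2 * σ ^ 2) * ⟪(z i).1, ψ j⟫ ^ 2)
          linarith
      _ ≤ _ := by
          rw [lintegral_add_right _ (by fun_prop)]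
          exact add_le_add le_rfl hsq
  have h12 : (1 : ℝ≥0∞) = ENNReal.ofReal (1 / 2) + ENNReal.ofReal (1 / 2) := by
    rw [← ENNReal.ofReal_add (by norm_num) (by norm_num)]
    norm_num
  rw [h12] at hadd
  exact (ENNReal.add_le_add_iff_right ENNReal.ofReal_ne_top).1 hadd

/-- The vertex of the hypercube `∏ [-A_j, A_j]` whose signs are given by `θ`, with `true` for
`+`. -/
noncomputable def vertex {m : ℕ} (A : Fin m → ℝ) (θ : Fin m → Bool) (j : Fin m) : ℝ :=
  if θ j then A j else -A j

theorem vertex_sq {m : ℕ} (A : Fin m → ℝ) (θ : Fin m → Bool) (j : Fin m) :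
    vertex A θ j ^ 2 = A j ^ 2 := by
  unfold vertex
  split_ifs <;> simp

theorem vertex_update_not {m : ℕ} (A : Fin m → ℝ) (θ : Fin m → Bool) (j : Fin m) :
    vertex A (Function.update θ j !θ j) = vertex A θ - Pi.single j (2 * vertex A θ j) := by
  funext l
  by_cases hl : l = j
  · subst hl
    unfold vertex
    cases h : θ l <;> simp [h] <;> ring
  · simp [vertex, Function.update_of_ne hl, Pi.single_eq_of_ne hl]

/-- Assouad's lemma for the hypercube of slopes with coefficients `±A_j`, `j < m`: the maximal risk
is at least the average risk over the vertices, and pairing each vertex with its neighbour in the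
direction `j` bounds the error in the `j`-th coordinate. -/
theorem le_maxRisk_of_hypercube [IsProbabilityMeasure P] (hX : MemLp X 2 P)
    (hS : IsSample P X ε P' Xs εs) (hε : HasLaw ε (gaussianReal 0 1) P) (hi : IndepFun X ε P)
    {σ ρ : ℝ} (hσ : 0 < σ) {w b : ℕ → ℝ} (hw : ∀ j, 0 < w j) (hb : ∀ j, 0 < b j)
    {est : (Fin n → ℝ × L2I) → L2I} (hest : Measurable est) {m : ℕ} {A : Fin m → ℝ}
    (hA : ∀ j : Fin m, n * (A j ^ 2 * ⟪covOp P X (ψ j), ψ j⟫) ≤ σ ^ 2)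
    (hbA : ∑ j : Fin m, b j * A j ^ 2 ≤ ρ) :
    ENNReal.ofReal (∑ j : Fin m, w j * A j ^ 2 / 4) ≤ maxRisk ψ w b ρ σ P' Xs εs est := by
  set B : (Fin m → Bool) → L2I := fun θ => ∑ l, vertex A θ l • ψ l
  set D : (Fin m → Bool) → Ω' → L2I := fun θ ω' =>
    est (observations (B θ) σ (fun i => Xs i ω') (fun i => εs i ω')) - B θ
  set r : Fin m → (Fin m → Bool) → ℝ≥0∞ := fun j θ =>
    ∫⁻ ω', ENNReal.ofReal (⟪D θ ω', ψ j⟫ ^ 2) ∂P'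
  have hell : ∀ θ, B θ ∈ ellipsoid ψ b ρ := by
    intro θ
    simp only [B, ellipsoid, Set.mem_ofPred_eq]
    rw [wnormSq_sum_smul hb]
    exact ENNReal.ofReal_le_ofReal (by simpa only [vertex_sq] using hbA)
  have hZ : AEMeasurable (fun ω' i => (Xs i ω', εs i ω')) P' :=
    aemeasurable_pi_lambda _ fun i => (hS.identDistrib i).aemeasurable_fst
  have hEm : ∀ θ, Measurable fun z : Fin n → L2I × ℝ =>
      est (observations (B θ) σ (fun i => (z i).1) (fun i => (z i).2)) - B θ :=
    fun θ => (hest.comp (measurable_observations (B θ) σ)).sub_const _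
  have hDm : ∀ (j : Fin m) θ, AEMeasurable (fun ω' => ENNReal.ofReal (⟪D θ ω', ψ j⟫ ^ 2)) P' := by
    intro j θ
    have h := (measurable_inner_left (ψ j)).comp_aemeasurable ((hEm θ).comp_aemeasurable hZ)
    exact (h.pow_const 2).ennreal_ofReal
  have hrisk : ∀ θ, ∑ j : Fin m, ENNReal.ofReal (w j) * r j θ
      ≤ maxRisk ψ w b ρ σ P' Xs εs est := by
    intro θ
    have h1 : ∫⁻ ω', wnormSq ψ w (D θ ω') ∂P' ≤ maxRisk ψ w b ρ σ P' Xs εs est :=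
      le_iSup₂ (f := fun β (_ : β ∈ ellipsoid ψ b ρ) => ∫⁻ ω', wnormSq ψ w
        (est (observations β σ (fun i => Xs i ω') (fun i => εs i ω')) - β) ∂P') (B θ) (hell θ)
    refine le_trans ?_ h1
    simp only [r]
    simp_rw [← lintegral_const_mul'' _ (hDm _ θ)]
    rw [← lintegral_finsetSum' _ fun j _ => (hDm j θ).const_mul _]
    refine lintegral_mono fun ω' => ?_
    simp_rw [← ENNReal.ofReal_mul (hw _).le]
    rw [Fin.sum_univ_eq_sum_range
      (fun j => ENNReal.ofReal (w j * ⟪D θ ω', ψ j⟫ ^ 2)) m]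
    exact ENNReal.sum_le_tsum _
  have hflip : ∀ (j : Fin m) θ, ENNReal.ofReal (A j ^ 2 / 2)
      ≤ r j θ + r j (Function.update θ j !θ j) := by
    intro j θ
    have h1 : B θ - vertex A θ j • ψ j + vertex A θ j • ψ j = B θ := sub_add_cancel _ _
    have h2 : B θ - vertex A θ j • ψ j - vertex A θ j • ψ j
        = B (Function.update θ j !θ j) := by
      simp only [B, vertex_update_not, Pi.sub_apply, sub_smul, Finset.sum_sub_distrib]
      rw [Finset.sum_eq_single_of_mem (f := fun l : Fin m =>
        (Pi.single j (2 * vertex A θ j) : Fin m → ℝ) l • ψ l) j (Finset.mem_univ j)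
        fun l _ hl => by rw [Pi.single_eq_of_ne hl, zero_smul], Pi.single_eq_same, two_mul,
        add_smul, sub_sub]
    have h3 := coordinate_lower_bound hX hS hε hi hσ hest (B θ - vertex A θ j • ψ j) j
      (a := vertex A θ j) (by rw [vertex_sq]; exact hA j)
    rwa [h1, h2, vertex_sq] at h3
  have hsum : ∀ j : Fin m, (Fintype.card (Fin m → Bool) : ℝ≥0∞) * ENNReal.ofReal (A j ^ 2 / 2)
      ≤ 2 * ∑ θ, r j θ := by
    intro j
    have hinv : Function.Involutive fun θ : Fin m → Bool => Function.update θ j !θ j := by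
      intro θ
      simp
    rw [two_mul]
    nth_rw 2 [← hinv.bijective.sum_comp (r j)]
    rw [← Finset.sum_add_distrib, ← nsmul_eq_mul, ← Finset.card_univ, ← Finset.sum_const]
    exact Finset.sum_le_sum fun θ _ => hflip j θ
  have hcard0 : (Fintype.card (Fin m → Bool) : ℝ≥0∞) ≠ 0 := by simp
  have hmain : (Fintype.card (Fin m → Bool) : ℝ≥0∞) *
      ENNReal.ofReal (∑ j : Fin m, w j * A j ^ 2 / 2)
      ≤ (Fintype.card (Fin m → Bool) : ℝ≥0∞) * (2 * maxRisk ψ w b ρ σ P' Xs εs est) := by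
    calc _ = ∑ j : Fin m, ENNReal.ofReal (w j) *
          ((Fintype.card (Fin m → Bool) : ℝ≥0∞) * ENNReal.ofReal (A j ^ 2 / 2)) := by
          rw [ENNReal.ofReal_sum_of_nonneg fun j _ => by
            have := hw j
            positivity, Finset.mul_sum]
          refine Finset.sum_congr rfl fun j _ => ?_
          rw [mul_left_comm, ← ENNReal.ofReal_mul (hw j).le, mul_div_assoc]
      _ ≤ ∑ j : Fin m, ENNReal.ofReal (w j) * (2 * ∑ θ, r j θ) :=
          Finset.sum_le_sum fun j _ => mul_le_mul_right (hsum j) _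
      _ = 2 * ∑ θ, ∑ j : Fin m, ENNReal.ofReal (w j) * r j θ := by
          rw [Finset.sum_comm, Finset.mul_sum]
          refine Finset.sum_congr rfl fun j _ => ?_
          rw [mul_left_comm, Finset.mul_sum (f := r j)]
      _ ≤ 2 * ∑ _θ : Fin m → Bool, maxRisk ψ w b ρ σ P' Xs εs est :=
          mul_le_mul_right (Finset.sum_le_sum fun θ _ => hrisk θ) _
      _ = _ := by
          rw [Finset.sum_const, Finset.card_univ, nsmul_eq_mul, mul_left_comm]
  have h2 : 2 * ENNReal.ofReal (∑ j : Fin m, w j * A j ^ 2 / 4)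
      = ENNReal.ofReal (∑ j : Fin m, w j * A j ^ 2 / 2) := by
    rw [two_mul_ofReal, Finset.mul_sum]
    congr 1
    exact Finset.sum_congr rfl fun j _ => by ring
  rw [ENNReal.mul_le_mul_iff_right hcard0 (ENNReal.natCast_ne_top _), ← h2,
    ENNReal.mul_le_mul_iff_right two_ne_zero ENNReal.ofNat_ne_top] at hmain
  exact hmain

/-- The minimax lower bound: the hypercube with half side lengths `√(κ / (n υ_j))` lies in the
ellipsoid because `κ ≤ ρ / Δ`, and its side lengths are at the noise level because
`κ ≤ σ² / (2 d)`. -/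
theorem le_maxRisk [IsProbabilityMeasure P] {w b υ : ℕ → ℝ} {d Δ σ ρ : ℝ} {m : ℕ} (hd : 1 ≤ d)
    (hΔ : 1 ≤ Δ) (hσ : 0 < σ) (hρ : 0 < ρ) (hW : RegularWeights w b υ) (hX : RegressorClass P X)
    (hL : LinkClass ψ υ d (covOp P X)) (hn : 0 < n) (hm : IsOptimalDim w b υ Δ n m)
    (hS : IsSample P X ε P' Xs εs) (hε : HasLaw ε (gaussianReal 0 1) P) (hi : IndepFun X ε P)
    {est : (Fin n → ℝ × L2I) → L2I} (hest : Measurable est) :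
    ENNReal.ofReal (1 / (4 * Δ) * min (σ ^ 2 / (2 * d)) (ρ / Δ) * rate w b m)
      ≤ maxRisk ψ w b ρ σ P' Xs εs est := by
  have hΓ := DiagComparable.of_linkClass hd hW.υ_summable hW.υ_pos hL hX.strictlyPositive
  have hn0 : (0 : ℝ) < n := Nat.cast_pos.2 hn
  have hd0 : 0 < d := by linarith
  have hΔ0 : 0 < Δ := by linarith
  set κ := min (σ ^ 2 / (2 * d)) (ρ / Δ)
  have hκ : 0 < κ := lt_min (by positivity) (by positivity)
  have hκ1 : κ * (2 * d) ≤ σ ^ 2 := (le_div_iff₀ (by positivity)).1 (min_le_left _ _)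
  have hκ2 : κ * Δ ≤ ρ := (le_div_iff₀ hΔ0).1 (min_le_right _ _)
  have hv := hW.υ_pos
  have hwp := hW.w_pos
  have hbp := hW.b_pos
  have hsq : ∀ j, √(κ / (n * υ j)) ^ 2 = κ / (n * υ j) := fun j =>
    Real.sq_sqrt (by have := hv j; positivity)
  have hlow := hm.lower
  have hup := hm.upper
  set S := ∑ j ∈ Finset.range m, w j / υ j with hSdef
  set bm := b (m - 1)
  set wm := w (m - 1)
  have hbm : 0 < bm := hbp _
  have hwm : 0 < wm := hwp _
  refine le_trans (ENNReal.ofReal_le_ofReal ?_) (le_maxRisk_of_hypercube hX.memLp hS hε hi hσ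
    hwp hbp hest (A := fun j : Fin m => √(κ / (n * υ j))) ?_ ?_)
  · simp_rw [hsq]
    rw [Fin.sum_univ_eq_sum_range (fun j => w j * (κ / (n * υ j)) / 4) m]
    have h1 : ∑ j ∈ Finset.range m, w j * (κ / (n * υ j)) / 4 = κ / (4 * n) * S := by
      rw [hSdef, Finset.mul_sum]
      refine Finset.sum_congr rfl fun j _ => ?_
      have := (hv j).ne'
      field_simp
    rw [h1]
    calc 1 / (4 * Δ) * κ * rate w b m = κ / 4 * (wm / bm) * Δ⁻¹ := by
          simp only [rate, wm, bm]
          field_simp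
      _ ≤ κ / 4 * (wm / bm) * (bm / (n * wm) * S) := by gcongr
      _ = κ / (4 * n) * S := by field_simp
  · intro j
    rw [hsq]
    have h1 : ⟪covOp P X (ψ j), ψ j⟫ ≤ d * υ j := by
      have h := hΓ.inner_le (ψ j)
      rwa [inner_diagOp_basis ψ hW.υ_summable, real_inner_self_eq_norm_sq,
        ψ.orthonormal.1 (j : ℕ), one_pow, mul_one] at h
    have hvj := hv j
    calc n * (κ / (n * υ j) * ⟪covOp P X (ψ j), ψ j⟫) ≤ n * (κ / (n * υ j) * (d * υ j)) := by
          gcongr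
      _ = κ * d := by field_simp
      _ ≤ κ * (2 * d) := by gcongr; linarith
      _ ≤ σ ^ 2 := hκ1
  · simp_rw [hsq]
    rw [Fin.sum_univ_eq_sum_range (fun j => b j * (κ / (n * υ j))) m]
    calc ∑ j ∈ Finset.range m, b j * (κ / (n * υ j))
        ≤ ∑ j ∈ Finset.range m, κ * (bm / (n * wm) * (w j / υ j)) := by
          refine Finset.sum_le_sum fun j hj => ?_
          have hj' : j ≤ m - 1 := by
            have := Finset.mem_range.1 hj
            omega
          have h1 : b j / w j ≤ bm / wm := hW.b_div_w_mono hj'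
          have hwj := hwp j
          have hvj := hv j
          calc b j * (κ / (n * υ j)) = κ / n * (w j / υ j) * (b j / w j) := by field_simp
            _ ≤ κ / n * (w j / υ j) * (bm / wm) := by gcongr
            _ = _ := by field_simp
      _ = κ * (bm / (n * wm) * S) := by rw [← Finset.mul_sum, ← Finset.mul_sum]
      _ ≤ κ * Δ := by gcongr
      _ ≤ ρ := hκ2

end Lower

theorem theorem2 (k : ℕ) (hk : 4 ≤ k) (K : ℝ) :
    ∃ C : ℝ, 0 < C ∧
    ∀ (ψ : HilbertBasis ℕ ℝ L2I) (w b υ : ℕ → ℝ) (d Δ η σ ρ : ℝ),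
      1 ≤ d → 1 ≤ Δ → 1 ≤ η → 0 < σ → 0 < ρ → RegularWeights w b υ →
    ∀ (Ω : Type*) [MeasurableSpace Ω] (P : Measure Ω) [IsProbabilityMeasure P]
      (X : Ω → L2I) (ε : Ω → ℝ),
      RegressorMomentClass ψ (4 * k) η P X → ErrorClass (4 * k) η P ε →
      ∫ ω, ε ω • X ω ∂P = 0 → LinkClass ψ υ d (covOp P X) →
    ∀ (mstar : ℕ → ℕ) (n₀ : ℕ), 1 ≤ n₀ →
      (∀ n ≥ n₀, IsOptimalDim w b υ Δ n (mstar n)) →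
      (∀ n ≥ n₀, RateBounds w b υ k K n (mstar n)) →
    ∀ n ≥ n₀, ∀ (Ω' : Type*) [MeasurableSpace Ω'] (P' : Measure Ω') [IsProbabilityMeasure P']
      (Xs : Fin n → Ω' → L2I) (εs : Fin n → Ω' → ℝ), IsSample P X ε P' Xs εs →
      maxRisk ψ w b ρ σ P' Xs εs
          (betaHat ψ (mstar n) (n * max 1 (8 * d ^ 3 * Δ / b (mstar n - 1))))
        ≤ ENNReal.ofReal
          (C * rate w b (mstar n) * η * d ^ 16 * Δ ^ 2 * (σ ^ 2 + ρ * ∑' j, υ j)) ∧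
      (HasLaw ε (gaussianReal 0 1) P → IndepFun X ε P →
        ∀ est : (Fin n → ℝ × L2I) → L2I, Measurable est →
          ENNReal.ofReal (1 / (4 * Δ) * min (σ ^ 2 / (2 * d)) (ρ / Δ) * rate w b (mstar n))
            ≤ maxRisk ψ w b ρ σ P' Xs εs est) := by
  refine ⟨upperConst k K, upperConst_pos k K, ?_⟩
  intro ψ w b υ d Δ η σ ρ hd hΔ hη hσ hρ hW Ω _ P _ X ε hX hε hεX hL mstar n₀ hn₀ hm hB n hn
    Ω' _ P' _ Xs εs hS
  have hn0 : 0 < n := by omega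
  exact ⟨maxRisk_betaHat_le hk hd hΔ hη hσ hρ hW hX hε hεX hL hn0 (hm n hn) (hB n hn) hS,
    fun hlaw hind _ hest => le_maxRisk hd hΔ hσ hρ hW hX.toRegressorClass hL hn0 (hm n hn) hS
      hlaw hind hest⟩
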